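/- Let $\mathbf u=(u_1,u_2,u_3)$ and $\mathbf x=(x,y,z)\in\mathbb R^3$. For $\nu>0$ and $f>0$ consider the perturbation system of the Couette flow $(y,0,0)$ for the Navier–Stokes–Coriolis equations on $\mathbb R^3$, $$\partial_t\mathbf u+\mathbf u\cdot\nabla\mathbf u+(u_2,0,0)+y\,\partial_x\mathbf u+f(-u_2,u_1,0)=\nu\Delta\mathbf u-\nabla q,\qquad \nabla\cdot\mathbf u=0,$$ where $q=-\Delta^{-1}\,\mathrm{div}\big(\mathbf u\cdot\nabla\mathbf u+(u_2,0,0)+y\,\partial_x\mathbf u+f(-u_2,u_1,0)\big)$, i.e. $q(t)\in L^6(\mathbb R^3)$ solves the corresponding Poisson equation in the sense of distributions for almost every $t$. A strong solution on $[0,T]$ is a function $\mathbf u\in C([0,T];H^1(\mathbb R^3)^3)\cap L^2(0,T;H^2(\mathbb R^3)^3)$, with pressure $q$ such that $\nabla q\in L^2(0,T;L^2(\mathbb R^3)^3)$, that satisfies the system (with weak derivatives, the momentum equation being integrated in time and tested against $C_c^\infty(\mathbb R^3)$). Here $\|\mathbf u\|_{H^1}^2=\|\mathbf u\|_{L^2}^2+\|\nabla\mathbf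 u\|_{L^2}^2$ and $\|(\mathbf a,\mathbf b)\|_{L^2}^2=\|\mathbf a\|_{L^2}^2+\|\mathbf b\|_{L^2}^2$. There is a constant $\bar\delta_0\in(0,1]$ such that for every $\nu>0$ there is a constant $C>0$, depending only on $\nu$, with the following property. Let $f>0$, let $T>0$, and let $\mathbf u$ be a strong solution on $[0,T]$ with $$\|\mathbf u(t)\|_{H^1}\le\bar\delta_0\qquad\text{for all }t\in[0,T].$$ Then, with $\mathcal E_{\rm in}=\|\mathbf u(0)\|_{H^1}$, $$\|(\mathbf u,\nabla\mathbf u)(t)\|_{L^2}^2+\int_0^t\|(\nabla\mathbf u,\Delta\mathbf u)(\tau)\|_{L^2}^2\,d\tau\le C\Big(\mathcal E_{\rm in}^2+\int_0^t\|\mathbf u(\tau)\|_{L^2}^2\,d\tau\Big)\qquad\text{for all }t\in[0,T].$$ -/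

import Mathlib

open MeasureTheory Set Filter Topology
open scoped ContDiff

noncomputable section

namespace RotatingCouette

/-- Three-dimensional Euclidean space. The coordinates `x, y, z` (and the components
`u₁, u₂, u₃`) carry the indices `0, 1, 2`. -/
abbrev E3 : Type := EuclideanSpace ℝ (Fin 3)

section WeakDerivatives

variable {V : Type*} [NormedAddCommGroup V] [NormedSpace ℝ V]

/-- Scalar test functions: `C_c^∞(ℝ³)`. -/
def IsTest (φ : E3 → ℝ) : Prop :=
  ContDiff ℝ ∞ φ ∧ HasCompactSupport φ

/-- The classical partial derivative `∂_i φ`. -/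
def classicalPartial (i : Fin 3) (φ : E3 → ℝ) (x : E3) : ℝ :=
  fderiv ℝ φ x (EuclideanSpace.single i 1)

/-- `g` is the weak partial derivative `∂_i f`. -/
def IsWeakPartial (i : Fin 3) (f g : E3 → V) : Prop :=
  LocallyIntegrable f ∧ LocallyIntegrable g ∧
    ∀ φ : E3 → ℝ, IsTest φ →
      ∫ x, classicalPartial i φ x • f x = -∫ x, φ x • g x

/-- The weak partial derivative `∂_i f` exists. -/
def HasWeakPartial (i : Fin 3) (f : E3 → V) : Prop :=
  ∃ g : E3 → V, IsWeakPartial i f g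

open Classical in
/-- The weak partial derivative `∂_i f`, which is unique up to a null set
(and `0` if there is none). -/
def weakPartial (i : Fin 3) (f : E3 → V) : E3 → V :=
  if h : HasWeakPartial i f then h.choose else 0

theorem HasWeakPartial.isWeakPartial {i : Fin 3} {f : E3 → V} (h : HasWeakPartial i f) :
    IsWeakPartial i f (weakPartial i f) := by
  unfold weakPartial
  rw [dif_pos h]
  exact h.choose_spec

/-- The Laplacian `Δ f = ∑ ∂_i ∂_i f`, with weak derivatives. -/
def weakLaplacian (f : E3 → V) (x : E3) : V :=
  ∑ i, weakPartial i (weakPartial i f) x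

/-- `‖f‖²_{L²}`. -/
def l2Sq (f : E3 → V) : ℝ :=
  ∫ x, ‖f x‖ ^ 2

/-- `‖∇f‖²_{L²}`. -/
def gradSq (f : E3 → V) : ℝ :=
  ∑ i, l2Sq (weakPartial i f)

/-- `‖f‖_{H¹}`. -/
def h1Norm (f : E3 → V) : ℝ :=
  Real.sqrt (l2Sq f + gradSq f)

/-- `f ∈ H¹(ℝ³)`. -/
def MemH1 (f : E3 → V) : Prop :=
  MemLp f 2 ∧ ∀ i, HasWeakPartial i f ∧ MemLp (weakPartial i f) 2

/-- `f ∈ H²(ℝ³)`. -/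
def MemH2 (f : E3 → V) : Prop :=
  MemH1 f ∧ ∀ i, MemH1 (weakPartial i f)

/-- `F ∈ L²(0,T; L²(ℝ³))`: weakly measurable in time, with square integrable norm. -/
def MemL2L2 (T : ℝ) (F : ℝ → E3 → V) : Prop :=
  (∀ᵐ t ∂(volume.restrict (Icc 0 T)), MemLp (F t) 2) ∧
  (∀ φ : E3 → ℝ, IsTest φ →
    AEStronglyMeasurable (fun t => ∫ x, φ x • F t x) (volume.restrict (Icc 0 T))) ∧
  IntegrableOn (fun t => l2Sq (F t)) (Icc 0 T)

/-- `u ∈ C([0,T]; H¹(ℝ³))`. -/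
def MemCH1 (T : ℝ) (u : ℝ → E3 → V) : Prop :=
  (∀ t ∈ Icc 0 T, MemH1 (u t)) ∧
  ∀ t ∈ Icc 0 T, Tendsto (fun s => h1Norm (u s - u t)) (𝓝[Icc 0 T] t) (𝓝 0)

/-- `u ∈ L²(0,T; H²(ℝ³))`. -/
def MemL2H2 (T : ℝ) (u : ℝ → E3 → V) : Prop :=
  (∀ᵐ t ∂(volume.restrict (Icc 0 T)), MemH2 (u t)) ∧
  MemL2L2 T u ∧
  (∀ i, MemL2L2 T (fun t => weakPartial i (u t))) ∧
  ∀ i j, MemL2L2 T (fun t => weakPartial i (weakPartial j (u t)))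

end WeakDerivatives

/-- The weak divergence `∑ ∂_i u_i`. -/
def weakDiv (u : E3 → E3) (x : E3) : ℝ :=
  ∑ i, weakPartial i u x i

/-- The weak gradient of a scalar function. -/
def weakGrad (q : E3 → ℝ) (x : E3) : E3 :=
  WithLp.toLp 2 fun i => weakPartial i q x

/-- The convective term `(u · ∇) u`. -/
def convection (u : E3 → E3) (x : E3) : E3 :=
  ∑ i, u x i • weakPartial i u x

/-- The sum of the convective terms and of the Coriolis term in the system for the perturbation `u`
of the Couette flow `v̄ = (y,0,0)`:
`u · ∇u + u · ∇v̄ + v̄ · ∇u + (0,0,f) × u = u · ∇u + (u₂,0,0) + y ∂ₓu + f (-u₂,u₁,0)`. -/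
def inertialTerm (f : ℝ) (u : E3 → E3) (x : E3) : E3 :=
  convection u x + !₂[u x 1, 0, 0] + x 1 • weakPartial 0 u x + f • !₂[-u x 1, u x 0, 0]

/-- `q = -Δ⁻¹ div G`: the solution of `-Δ q = div G` that vanishes at infinity (in the sense that
`q ∈ L⁶(ℝ³)`), with a weak gradient in `L²(ℝ³)`. -/
def IsPressureOf (q : E3 → ℝ) (G : E3 → E3) : Prop :=
  MemLp q 6 ∧
  (∀ i, HasWeakPartial i q ∧ MemLp (weakPartial i q) 2) ∧
  ∀ φ : E3 → ℝ, IsTest φ →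
    ∫ x, inner ℝ (weakGrad q x) (gradient φ x) = -∫ x, inner ℝ (G x) (gradient φ x)

/-- `(u,q)` is a strong solution on `[0,T]` of the perturbed Navier–Stokes–Coriolis system
`∂ₜu + u · ∇u + (u₂,0,0) + y ∂ₓu + f (-u₂,u₁,0) = ν Δu - ∇q`, `div u = 0`,
`q = -Δ⁻¹ div (u · ∇u + (u₂,0,0) + y ∂ₓu + f (-u₂,u₁,0))`
on `ℝ³`, in the class `C([0,T]; H¹) ∩ L²(0,T; H²)`. All terms are locally integrable
functions; the momentum equation is integrated in time and tested in space. -/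
structure IsStrongSolution (ν f T : ℝ) (u : ℝ → E3 → E3) (q : ℝ → E3 → ℝ) : Prop where
  continuous_H1 : MemCH1 T u
  square_integrable_H2 : MemL2H2 T u
  div_free : ∀ t ∈ Icc 0 T, ∀ᵐ x : E3, weakDiv (u t) x = 0
  pressure : ∀ᵐ t ∂(volume.restrict (Icc 0 T)), IsPressureOf (q t) (inertialTerm f (u t))
  pressure_grad : ∀ i, MemL2L2 T (fun t => weakPartial i (q t))
  momentum : ∀ φ : E3 → ℝ, IsTest φ → ∀ t ∈ Icc 0 T,
    IntervalIntegrable (fun s => ∫ x, φ x •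
      (ν • weakLaplacian (u s) x - weakGrad (q s) x - inertialTerm f (u s) x)) volume 0 t ∧
    (∫ x, φ x • u t x) - (∫ x, φ x • u 0 x) =
      ∫ s in (0 : ℝ)..t, ∫ x, φ x •
        (ν • weakLaplacian (u s) x - weakGrad (q s) x - inertialTerm f (u s) x)

end RotatingCouette

end

/-! The proof is an `H¹` energy estimate: the momentum equation is paired with `u - Δu`. The viscous
term gives `-ν (‖∇u‖² + ‖Δu‖²)`. The pressure drops out because `u - Δu` is divergence free. The
Coriolis term drops out because `(-u₂, u₁, 0)` is pointwise orthogonal to `u`, and `∫ u₂ Δu₁ = ∫ u₁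
Δu₂`; hence the constant does not depend on `f`. The transport `y ∂ₓ` is skew, so it contributes
only the commutator `-∫ ∂_y u · ∂ₓ u`. With `A = ‖u‖`, `B = ‖∇u‖`, `L = ‖Δu‖` and `N` a bound for
the convective terms, what remains is at most a multiple of `(A + L) N + (A + L) A + B²`.

Hölder and Sobolev give `N² ≲ B³ L`, hence `N² ≲ B L` when `B ≤ 1`, and `B² = -∫ u · Δu ≲ A L`.
Young's inequality then absorbs everything into `(ν/2) L²` at the price of `C A²`. Since `∫ ‖u‖²` is
allowed on the right, no smallness relative to `ν` is needed, and `δ₀ = 1` works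
(`exists_energy_absorption`, `exists_sum_energyRate_le`).

The analytic difficulty is to justify the energy identity: `y ∂ₓ u` need not lie in `L²`, so the
equation cannot be paired directly with `u - Δu`. Each component solves `∂ₜv + y ∂ₓv = G` with `G`
in `L²` for almost every time. The equation is mollified and multiplied by a cutoff at radius of
order `n`. Commuting `y` with the mollifier leaves a convolution with a kernel of `L¹` norm at most
`1/(n+1)`; integrating by parts against the cutoff leaves `y ∂ₓχₙ`, which is bounded uniformly in
`n` and tends to zero pointwise. Both errors vanish in the limit (`tendsto_regRate`), a uniform
bound (`exists_abs_regRate_le`) permits dominated convergence in time, and `energy_balance` follows.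
Orthogonality of the pressure gradient (`sum_integral_weakPartial_mul_eq_zero`) rests on `q ∈ L⁶`
and on the scale invariance of `‖∇χₙ‖_{L³}` in three dimensions. -/

namespace RotatingCouette

/-! ### Test functions and classical partial derivatives -/

section Calculus

theorem IsTest.continuous {φ : E3 → ℝ} (h : IsTest φ) : Continuous φ := h.1.continuous

theorem IsTest.differentiable {φ : E3 → ℝ} (h : IsTest φ) : Differentiable ℝ φ :=
  h.1.differentiable (by simp)

theorem IsTest.memLp {φ : E3 → ℝ} (h : IsTest φ) (p : ENNReal) : MemLp φ p :=
  h.continuous.memLp_of_hasCompactSupport h.2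

theorem contDiff_classicalPartial {φ : E3 → ℝ} (h : ContDiff ℝ ∞ φ) (i : Fin 3) :
    ContDiff ℝ ∞ (classicalPartial i φ) := by
  unfold classicalPartial
  exact (h.fderiv_right (m := ∞) (by simp)).clm_apply contDiff_const

theorem IsTest.classicalPartial {φ : E3 → ℝ} (h : IsTest φ) (i : Fin 3) :
    IsTest (classicalPartial i φ) :=
  ⟨contDiff_classicalPartial h.1 i, h.2.fderiv_apply ℝ _⟩

theorem IsTest.mul_contDiff {φ ψ : E3 → ℝ} (h : IsTest φ) (hψ : ContDiff ℝ ∞ ψ) :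
    IsTest (fun x => φ x * ψ x) :=
  ⟨h.1.mul hψ, h.2.mul_right⟩

theorem IsTest.add {φ ψ : E3 → ℝ} (h : IsTest φ) (hψ : IsTest ψ) :
    IsTest (fun x => φ x + ψ x) :=
  ⟨h.1.add hψ.1, h.2.add hψ.2⟩

theorem IsTest.sum {ι : Type*} (s : Finset ι) {φ : ι → E3 → ℝ} (h : ∀ i ∈ s, IsTest (φ i)) :
    IsTest (fun x => ∑ i ∈ s, φ i x) := by
  classical
  induction s using Finset.induction_on with
  | empty => exact ⟨by simpa using contDiff_const, by simpa using! (HasCompactSupport.zero : HasCompactSupport (0 : E3 → ℝ))⟩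
  | insert a s ha ih =>
    simp only [Finset.sum_insert ha]
    exact (h a (Finset.mem_insert_self a s)).add
      (ih fun i hi => h i (Finset.mem_insert_of_mem hi))

theorem IsTest.comp_sub_left {φ : E3 → ℝ} (h : IsTest φ) (x : E3) :
    IsTest (fun y => φ (x - y)) :=
  ⟨h.1.comp (contDiff_const.sub contDiff_id),
    h.2.comp_homeomorph (Homeomorph.subLeft x)⟩

theorem contDiff_coord (j : Fin 3) : ContDiff ℝ ∞ (fun x : E3 => x j) :=
  (EuclideanSpace.proj (𝕜 := ℝ) j).contDiff

theorem classicalPartial_add {φ ψ : E3 → ℝ} (h : Differentiable ℝ φ) (h' : Differentiable ℝ ψ)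
    (i : Fin 3) (x : E3) :
    classicalPartial i (fun x => φ x + ψ x) x = classicalPartial i φ x + classicalPartial i ψ x := by
  unfold classicalPartial
  rw [fderiv_fun_add (h x) (h' x)]; rfl

theorem classicalPartial_sub {φ ψ : E3 → ℝ} (h : Differentiable ℝ φ) (h' : Differentiable ℝ ψ)
    (i : Fin 3) (x : E3) :
    classicalPartial i (fun x => φ x - ψ x) x = classicalPartial i φ x - classicalPartial i ψ x := by
  unfold classicalPartial
  rw [fderiv_fun_sub (h x) (h' x)]; rfl

theorem classicalPartial_mul {φ ψ : E3 → ℝ} (h : Differentiable ℝ φ) (h' : Differentiable ℝ ψ)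
    (i : Fin 3) (x : E3) :
    classicalPartial i (fun x => φ x * ψ x) x =
      classicalPartial i φ x * ψ x + φ x * classicalPartial i ψ x := by
  unfold classicalPartial
  rw [fderiv_fun_mul (h x) (h' x)]
  simp [add_comm, mul_comm]

theorem classicalPartial_sum {ι : Type*} (s : Finset ι) {φ : ι → E3 → ℝ}
    (h : ∀ i ∈ s, Differentiable ℝ (φ i)) (i : Fin 3) (x : E3) :
    classicalPartial i (fun x => ∑ k ∈ s, φ k x) x = ∑ k ∈ s, classicalPartial i (φ k) x := by
  unfold classicalPartial
  rw [fderiv_fun_sum fun k hk => h k hk x]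
  simp

theorem classicalPartial_coord (i j : Fin 3) (x : E3) :
    classicalPartial i (fun x : E3 => x j) x = if j = i then 1 else 0 := by
  unfold classicalPartial
  have : fderiv ℝ (fun x : E3 => x j) x = EuclideanSpace.proj (𝕜 := ℝ) j :=
    (EuclideanSpace.proj (𝕜 := ℝ) j).fderiv
  rw [this]
  simp

theorem classicalPartial_comm {φ : E3 → ℝ} (h : ContDiff ℝ ∞ φ) (i j : Fin 3) (x : E3) :
    classicalPartial i (classicalPartial j φ) x = classicalPartial j (classicalPartial i φ) x := by
  have hd : DifferentiableAt ℝ (fderiv ℝ φ) x :=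
    ((h.fderiv_right (m := ∞) (by simp)).differentiable (by simp)) x
  have hs : IsSymmSndFDerivAt ℝ φ x :=
    h.contDiffAt.isSymmSndFDerivAt (by simpa using (WithTop.coe_le_coe.2 le_top : ((2 : ℕ∞) : WithTop ℕ∞) ≤ ∞))
  have key : ∀ a b : Fin 3, classicalPartial a (classicalPartial b φ) x =
      fderiv ℝ (fderiv ℝ φ) x (EuclideanSpace.single a 1) (EuclideanSpace.single b 1) := by
    intro a b
    unfold classicalPartial
    rw [fderiv_clm_apply hd (differentiableAt_const _)]
    simp
  rw [key, key]
  exact hs _ _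

theorem classicalPartial_comp_sub_left {φ : E3 → ℝ} (h : Differentiable ℝ φ) (i : Fin 3) (x y : E3) :
    classicalPartial i (fun y => φ (x - y)) y = -classicalPartial i φ (x - y) := by
  unfold classicalPartial
  have h1 : HasFDerivAt (fun y : E3 => x - y) (-ContinuousLinearMap.id ℝ E3) y :=
    (hasFDerivAt_id y).const_sub x
  have h2 : HasFDerivAt (fun y : E3 => φ (x - y)) _ y := (h (x - y)).hasFDerivAt.comp y h1
  rw [h2.fderiv]
  simp

theorem norm_fderiv_le_sum (φ : E3 → ℝ) (x : E3) :
    ‖fderiv ℝ φ x‖ ≤ ∑ i, |classicalPartial i φ x| := by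
  refine ContinuousLinearMap.opNorm_le_bound _ (by positivity) fun y => ?_
  have hy : y = ∑ i, y i • EuclideanSpace.single i (1 : ℝ) := by
    ext j
    fin_cases j <;> simp [Fin.sum_univ_three]
  calc ‖fderiv ℝ φ x y‖ = ‖∑ i, y i * classicalPartial i φ x‖ := by
        conv_lhs => rw [hy]
        simp [classicalPartial]
    _ ≤ ∑ i, ‖y i * classicalPartial i φ x‖ := norm_sum_le _ _
    _ ≤ ∑ i, |classicalPartial i φ x| * ‖y‖ := by
        refine Finset.sum_le_sum fun i _ => ?_
        rw [norm_mul, mul_comm]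
        exact mul_le_mul_of_nonneg_left (PiLp.norm_apply_le y i) (by positivity)
    _ = _ := by rw [Finset.sum_mul]

theorem integral_classicalPartial_eq_zero {φ : E3 → ℝ} (h : IsTest φ) (i : Fin 3) :
    ∫ x, classicalPartial i φ x = 0 := by
  have h1 := (h.classicalPartial i).continuous.integrable_of_hasCompactSupport
    (μ := volume) (h.classicalPartial i).2
  have h2 := h.continuous.integrable_of_hasCompactSupport (μ := volume) h.2
  have := integral_mul_fderiv_eq_neg_fderiv_mul_of_integrable (μ := volume) (f := fun _ : E3 => (1 : ℝ))
    (g := φ) (v := EuclideanSpace.single i 1) (by simp) (by simp only [one_mul]; exact h1)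
    (by simpa using h2) (fun x _ => by fun_prop) (fun x _ => h.differentiable x)
  simp only [one_mul, fderiv_fun_const, Pi.zero_apply, zero_apply, zero_mul,
    integral_zero, neg_zero] at this
  exact this

end Calculus

/-! ### Convolution with smooth kernels -/

section Convolution

/-- The convolution of a function `f` with a smooth kernel `k`. -/
noncomputable def conv (k f : E3 → ℝ) : E3 → ℝ :=
  convolution f k (ContinuousLinearMap.lsmul ℝ ℝ) volume

theorem conv_apply (k f : E3 → ℝ) (x : E3) : conv k f x = ∫ y, f y * k (x - y) := by
  simp [conv, convolution_def]

theorem conv_apply' (k f : E3 → ℝ) (x : E3) : conv k f x = ∫ y, k y * f (x - y) := by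
  rw [conv_apply, ← integral_sub_left_eq_self _ volume x]
  simp [mul_comm]

theorem integrable_conv {k f : E3 → ℝ} (hk : IsTest k) (hf : LocallyIntegrable f) (x : E3) :
    Integrable (fun y => f y * k (x - y)) := by
  have := (hk.2.convolutionExists_right (ContinuousLinearMap.lsmul ℝ ℝ) hf hk.continuous x)
  simpa [ConvolutionExistsAt] using this

theorem contDiff_conv {k f : E3 → ℝ} (hk : IsTest k) (hf : LocallyIntegrable f) :
    ContDiff ℝ ∞ (conv k f) :=
  hk.2.contDiff_convolution_right _ hf hk.1

theorem classicalPartial_conv {k f : E3 → ℝ} (hk : IsTest k) (hf : LocallyIntegrable f)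
    (i : Fin 3) : classicalPartial i (conv k f) = conv (classicalPartial i k) f := by
  ext x
  have h1 : ContDiff ℝ 1 k := hk.1.of_le (by simp)
  have := (hk.2.hasFDerivAt_convolution_right (ContinuousLinearMap.lsmul ℝ ℝ) hf h1 x).fderiv
  unfold classicalPartial conv
  rw [this, convolution_precompR_apply _ hf (hk.2.fderiv ℝ) (h1.continuous_fderiv one_ne_zero)]

/-- The weak derivative is tested against `y ↦ k (x - y)`; the sign from the reflection cancels the
sign of the integration by parts. -/
theorem conv_classicalPartial {k f g : E3 → ℝ} (hk : IsTest k) {i : Fin 3}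
    (h : IsWeakPartial i f g) : conv (classicalPartial i k) f = conv k g := by
  ext x
  have := h.2.2 _ (hk.comp_sub_left x)
  simp only [classicalPartial_comp_sub_left hk.differentiable, smul_eq_mul, neg_mul, integral_neg, neg_inj] at this
  rw [conv_apply, conv_apply]
  simpa only [mul_comm] using this

theorem conv_sub {k f g : E3 → ℝ} (hk : IsTest k) (hf : LocallyIntegrable f)
    (hg : LocallyIntegrable g) (x : E3) :
    conv k (fun y => f y - g y) x = conv k f x - conv k g x := by
  simp only [conv_apply, sub_mul]
  exact integral_sub (integrable_conv hk hf x) (integrable_conv hk hg x)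

/-- Multiplication by a coordinate commutes with the convolution, up to a kernel with an
additional factor. -/
theorem conv_coord_mul {k f : E3 → ℝ} (hk : IsTest k) (hf : LocallyIntegrable f) (j : Fin 3)
    (x : E3) : conv k (fun y => y j * f y) x =
      x j * conv k f x - conv (fun w => w j * k w) f x := by
  have hk' : IsTest (fun w => w j * k w) := by
    simpa only [mul_comm] using hk.mul_contDiff (contDiff_coord j)
  simp only [conv_apply]
  rw [← integral_const_mul, ← integral_sub ((integrable_conv hk hf x).const_mul _)
    (integrable_conv hk' hf x)]
  congr 1 with y
  simp only [PiLp.sub_apply]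
  ring

end Convolution

/-! ### Norms and convergence in `L²` -/

section L2

open scoped ENNReal

/-- `‖f‖_{L²}` for scalar functions. -/
noncomputable def l2Norm (f : E3 → ℝ) : ℝ := (eLpNorm f 2 volume).toReal

theorem l2Norm_nonneg (f : E3 → ℝ) : 0 ≤ l2Norm f := ENNReal.toReal_nonneg

theorem eLpNorm_two_sq (f : E3 → ℝ) : eLpNorm f 2 volume ^ 2 = ∫⁻ x, ‖f x‖ₑ ^ 2 := by
  have := eLpNorm_nnreal_pow_eq_lintegral (f := f) (μ := (volume : Measure E3)) (p := 2) (by simp)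
  have h2 : ((2 : NNReal) : ℝ≥0∞) = 2 := rfl
  rw [h2] at this
  simpa using this

theorem l2Norm_sq {f : E3 → ℝ} (hf : MemLp f 2) : l2Norm f ^ 2 = ∫ x, f x ^ 2 := by
  have h := eLpNorm_two_sq f
  rw [l2Norm, ← ENNReal.toReal_pow, h, integral_eq_lintegral_of_nonneg_ae
    (Eventually.of_forall fun x => sq_nonneg _) (hf.1.pow 2)]
  congr 1
  refine lintegral_congr fun x => ?_
  rw [← enorm_pow, Real.enorm_of_nonneg (sq_nonneg _)]

theorem ofReal_l2Norm {f : E3 → ℝ} (hf : MemLp f 2) :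
    ENNReal.ofReal (l2Norm f) = eLpNorm f 2 volume := ENNReal.ofReal_toReal hf.2.ne

theorem memLp_sub {f g : E3 → ℝ} {p : ℝ≥0∞} (hf : MemLp f p) (hg : MemLp g p) :
    MemLp (fun x => f x - g x) p := hf.sub hg

theorem eLpNorm_one_mul_le {f g : E3 → ℝ} (hf : MemLp f 2) (hg : MemLp g 2) :
    eLpNorm (fun x => f x * g x) 1 volume ≤ eLpNorm f 2 volume * eLpNorm g 2 volume :=
  eLpNorm_smul_le_mul_eLpNorm (𝕜 := ℝ) (E := ℝ) (φ := f) (f := g) (p := 2) (q := 2) (r := 1)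
    hg.1 hf.1

theorem integrable_mul {f g : E3 → ℝ} (hf : MemLp f 2) (hg : MemLp g 2) :
    Integrable (fun x => f x * g x) := hf.integrable_mul hg

theorem integral_abs_mul_le {f g : E3 → ℝ} (hf : MemLp f 2) (hg : MemLp g 2) :
    ∫ x, |f x * g x| ≤ l2Norm f * l2Norm g := by
  have h := eLpNorm_one_mul_le hf hg
  rw [l2Norm, l2Norm, ← ENNReal.toReal_mul]
  have h1 : ∫ x, |f x * g x| = (eLpNorm (fun x => f x * g x) 1 volume).toReal := by
    rw [eLpNorm_one_eq_lintegral_enorm]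
    exact integral_norm_eq_lintegral_enorm (integrable_mul hf hg).1
  rw [h1]
  exact ENNReal.toReal_mono (ENNReal.mul_ne_top hf.2.ne hg.2.ne) h

theorem abs_integral_mul_le {f g : E3 → ℝ} (hf : MemLp f 2) (hg : MemLp g 2) :
    |∫ x, f x * g x| ≤ l2Norm f * l2Norm g :=
  (norm_integral_le_integral_norm (fun x => f x * g x)).trans (integral_abs_mul_le hf hg)

theorem abs_integral_mul_mul_le {c f g : E3 → ℝ} {M : ℝ} (hM : ∀ x, |c x| ≤ M)
    (hf : MemLp f 2) (hg : MemLp g 2) :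
    |∫ x, c x * (f x * g x)| ≤ M * (l2Norm f * l2Norm g) := by
  refine (norm_integral_le_integral_norm (fun x => c x * (f x * g x))).trans ?_
  refine le_trans (integral_mono_of_nonneg (Eventually.of_forall fun x => norm_nonneg _)
    ((integrable_mul hf hg).abs.const_mul M) (Eventually.of_forall fun x => ?_)) ?_
  · simp only [norm_mul, Real.norm_eq_abs, abs_mul]
    exact mul_le_mul_of_nonneg_right (hM x) (by positivity)
  · rw [integral_const_mul]
    exact mul_le_mul_of_nonneg_left (integral_abs_mul_le hf hg)
      ((abs_nonneg _).trans (hM 0))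

/-- Convergence in `L²(ℝ³)`. -/
structure TendstoL2 (F : ℕ → E3 → ℝ) (f : E3 → ℝ) : Prop where
  memLp : ∀ n, MemLp (F n) 2
  memLp_lim : MemLp f 2
  tendsto : Tendsto (fun n => l2Norm (fun x => F n x - f x)) atTop (𝓝 0)

theorem l2Norm_add_le {f g : E3 → ℝ} (hf : MemLp f 2) (hg : MemLp g 2) :
    l2Norm (fun x => f x + g x) ≤ l2Norm f + l2Norm g := by
  rw [l2Norm, l2Norm, l2Norm, ← ENNReal.toReal_add hf.2.ne hg.2.ne]
  exact ENNReal.toReal_mono (ENNReal.add_ne_top.2 ⟨hf.2.ne, hg.2.ne⟩)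
    (eLpNorm_add_le hf.1 hg.1 (by norm_num))

theorem l2Norm_mono {f g : E3 → ℝ} (hg : MemLp g 2) (h : ∀ x, |f x| ≤ |g x|) :
    l2Norm f ≤ l2Norm g :=
  ENNReal.toReal_mono hg.2.ne (eLpNorm_mono h)

theorem l2Norm_const_mul (c : ℝ) (f : E3 → ℝ) : l2Norm (fun x => c * f x) = |c| * l2Norm f := by
  have := eLpNorm_const_smul c f 2 (volume : Measure E3)
  rw [l2Norm, l2Norm, show (fun x => c * f x) = c • f from rfl, this]
  simp

theorem TendstoL2.const {f : E3 → ℝ} (hf : MemLp f 2) : TendstoL2 (fun _ => f) f :=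
  ⟨fun _ => hf, hf, by simp [l2Norm]⟩

theorem TendstoL2.add {F G : ℕ → E3 → ℝ} {f g : E3 → ℝ} (hf : TendstoL2 F f)
    (hg : TendstoL2 G g) : TendstoL2 (fun n x => F n x + G n x) (fun x => f x + g x) := by
  refine ⟨fun n => (hf.memLp n).add (hg.memLp n), hf.memLp_lim.add hg.memLp_lim, ?_⟩
  refine squeeze_zero (fun n => l2Norm_nonneg _) (fun n => ?_)
    (by simpa using hf.tendsto.add hg.tendsto)
  refine le_trans (le_of_eq ?_) (l2Norm_add_le (memLp_sub (hf.memLp n) hf.memLp_lim)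
    (memLp_sub (hg.memLp n) hg.memLp_lim))
  congr 1 with x
  ring

/-- Bounded multipliers that converge pointwise to a constant act continuously in the limit. -/
theorem TendstoL2.bounded_mul {F : ℕ → E3 → ℝ} {f : E3 → ℝ} (hf : TendstoL2 F f)
    {c : ℕ → E3 → ℝ} {c₀ M : ℝ} (hc : ∀ n, AEStronglyMeasurable (c n) volume) (hM : ∀ n x, |c n x| ≤ M)
    (hlim : ∀ x, Tendsto (fun n => c n x) atTop (𝓝 c₀)) :
    TendstoL2 (fun n x => c n x * F n x) (fun x => c₀ * f x) := by
  have hM0 : 0 ≤ M := (abs_nonneg _).trans (hM 0 0)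
  have hc₀ : |c₀| ≤ M := le_of_tendsto ((hlim 0).abs) (Eventually.of_forall fun n => hM n 0)
  have mem : ∀ n (g : E3 → ℝ), MemLp g 2 → MemLp (fun x => c n x * g x) 2 := fun n g hg =>
    hg.of_le_mul (c := M) ((hc n).mul hg.1)
      (Eventually.of_forall fun x => by
        rw [norm_mul]; exact mul_le_mul_of_nonneg_right (hM n x) (norm_nonneg _))
  refine ⟨fun n => mem n _ (hf.memLp n), hf.memLp_lim.const_mul c₀, ?_⟩
  -- The error splits as `cₙ (Fₙ - f) + (cₙ - c₀) f`. The second part vanishes by dominated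
  -- convergence with majorant `(2M)² f²`, the first by the uniform bound `M`.
  have h2 : Tendsto (fun n => l2Norm (fun x => c n x * f x - c₀ * f x)) atTop (𝓝 0) := by
    have hsq : Tendsto (fun n => ∫ x, (c n x * f x - c₀ * f x) ^ 2) atTop (𝓝 (∫ _ : E3, (0:ℝ))) := by
      refine tendsto_integral_of_dominated_convergence (fun x => (2 * M) ^ 2 * f x ^ 2)
        (fun n => (((mem n _ hf.memLp_lim).sub (hf.memLp_lim.const_mul c₀)).1.pow 2))
        (hf.memLp_lim.integrable_sq.const_mul _) (fun n => Eventually.of_forall fun x => ?_)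
        (Eventually.of_forall fun x => ?_)
      · rw [Real.norm_of_nonneg (sq_nonneg _), ← sub_mul, mul_pow]
        refine mul_le_mul_of_nonneg_right ?_ (sq_nonneg _)
        rw [← sq_abs]
        have := abs_sub (c n x) c₀
        have := hM n x
        exact pow_le_pow_left₀ (abs_nonneg _) (by linarith) 2
      · have := (((hlim x).mul_const (f x)).sub_const (c₀ * f x)).pow 2
        simpa using this
    have : ∀ n, l2Norm (fun x => c n x * f x - c₀ * f x) =
        Real.sqrt (∫ x, (c n x * f x - c₀ * f x) ^ 2) := fun n => by
      rw [← l2Norm_sq (memLp_sub (mem n _ hf.memLp_lim) (hf.memLp_lim.const_mul c₀)),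
        Real.sqrt_sq (l2Norm_nonneg _)]
    simp only [this]
    simpa using hsq.sqrt
  have h1 : Tendsto (fun n => M * l2Norm (fun x => F n x - f x) +
      l2Norm (fun x => c n x * f x - c₀ * f x)) atTop (𝓝 0) := by
    simpa using (hf.tendsto.const_mul M).add h2
  refine squeeze_zero (fun n => l2Norm_nonneg _) (fun n => ?_) h1
  have hd : MemLp (fun x => F n x - f x) 2 := (hf.memLp n).sub hf.memLp_lim
  have hle : l2Norm (fun x => c n x * (F n x - f x)) ≤ M * l2Norm (fun x => F n x - f x) := by
    have := l2Norm_const_mul M (fun x => F n x - f x)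
    rw [abs_of_nonneg hM0] at this
    rw [← this]
    refine l2Norm_mono (hd.const_mul M) fun x => ?_
    rw [abs_mul, abs_mul, abs_of_nonneg hM0]
    exact mul_le_mul_of_nonneg_right (hM n x) (abs_nonneg _)
  refine le_trans ?_ (add_le_add hle le_rfl)
  refine le_trans (le_of_eq ?_) (l2Norm_add_le (mem n _ hd)
    (memLp_sub (mem n _ hf.memLp_lim) (hf.memLp_lim.const_mul c₀)))
  congr 1 with x
  ring

theorem TendstoL2.l2Norm_le_add {F : ℕ → E3 → ℝ} {f : E3 → ℝ} (hf : TendstoL2 F f) (n : ℕ) :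
    l2Norm (F n) ≤ l2Norm f + l2Norm (fun x => F n x - f x) := by
  have := l2Norm_add_le hf.memLp_lim (memLp_sub (hf.memLp n) hf.memLp_lim)
  simpa using this

theorem TendstoL2.tendsto_integral_mul {F G : ℕ → E3 → ℝ} {f g : E3 → ℝ} (hf : TendstoL2 F f)
    (hg : TendstoL2 G g) :
    Tendsto (fun n => ∫ x, F n x * G n x) atTop (𝓝 (∫ x, f x * g x)) := by
  rw [tendsto_iff_norm_sub_tendsto_zero]
  have hlim : Tendsto (fun n => l2Norm (fun x => F n x - f x) *
      (l2Norm g + l2Norm (fun x => G n x - g x)) + l2Norm f * l2Norm (fun x => G n x - g x))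
      atTop (𝓝 0) := by
    simpa using (hf.tendsto.mul (hg.tendsto.const_add (l2Norm g))).add
      (hg.tendsto.const_mul (l2Norm f))
  refine squeeze_zero (fun n => norm_nonneg _) (fun n => ?_) hlim
  have hF := memLp_sub (hf.memLp n) hf.memLp_lim
  have hG := memLp_sub (hg.memLp n) hg.memLp_lim
  have e : (∫ x, F n x * G n x) - ∫ x, f x * g x =
      (∫ x, (F n x - f x) * G n x) + ∫ x, f x * (G n x - g x) := by
    rw [← integral_sub (integrable_mul (hf.memLp n) (hg.memLp n))
      (integrable_mul hf.memLp_lim hg.memLp_lim),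
      ← integral_add (integrable_mul hF (hg.memLp n)) (integrable_mul hf.memLp_lim hG)]
    congr 1 with x
    ring
  rw [e]
  refine (norm_add_le _ _).trans (add_le_add ?_ (abs_integral_mul_le hf.memLp_lim hG))
  exact (abs_integral_mul_le hF (hg.memLp n)).trans
    (mul_le_mul_of_nonneg_left (hg.l2Norm_le_add n) (l2Norm_nonneg _))

theorem TendstoL2.tendsto_integral_mul_mul {F G : ℕ → E3 → ℝ} {f g : E3 → ℝ} (hf : TendstoL2 F f)
    (hg : TendstoL2 G g) {c : ℕ → E3 → ℝ} {c₀ M : ℝ} (hc : ∀ n, AEStronglyMeasurable (c n) volume)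
    (hM : ∀ n x, |c n x| ≤ M) (hlim : ∀ x, Tendsto (fun n => c n x) atTop (𝓝 c₀)) :
    Tendsto (fun n => ∫ x, c n x * (F n x * G n x)) atTop (𝓝 (c₀ * ∫ x, f x * g x)) := by
  have := (hf.bounded_mul hc hM hlim).tendsto_integral_mul hg
  simpa only [mul_assoc, integral_const_mul] using this

/-- Cauchy–Schwarz after writing `|k| = |k|^{1/2} |k|^{1/2}`, then Tonelli. With `Φ x h = f (x - h)`
this yields Young's inequality, with `Φ x h = f (x - h) - f x` the convergence of mollifications. -/
theorem lintegral_kernel_sq_le {k : E3 → ℝ} (hk : AEStronglyMeasurable k volume)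
    {Φ : E3 → E3 → ℝ} (hΦ : AEStronglyMeasurable (Function.uncurry Φ) (volume.prod volume)) :
    ∫⁻ x, ‖∫ h, k h * Φ x h‖ₑ ^ 2 ≤
      (∫⁻ h, ‖k h‖ₑ) * ∫⁻ h, ‖k h‖ₑ * ∫⁻ x, ‖Φ x h‖ₑ ^ 2 := by
  have hk' : AEMeasurable (fun h => ‖k h‖ₑ) volume := hk.enorm
  have step : ∀ᵐ x : E3, ‖∫ h, k h * Φ x h‖ₑ ^ 2 ≤
      (∫⁻ h, ‖k h‖ₑ) * ∫⁻ h, ‖k h‖ₑ * ‖Φ x h‖ₑ ^ 2 := by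
    filter_upwards [hΦ.prodMk_left] with x hx
    have hx' : AEMeasurable (fun h => ‖Φ x h‖ₑ) volume := hx.enorm
    have h1 : ‖∫ h, k h * Φ x h‖ₑ ≤ ∫⁻ h, ‖k h‖ₑ * ‖Φ x h‖ₑ := by
      refine (enorm_integral_le_lintegral_enorm _).trans (le_of_eq ?_)
      simp only [enorm_mul]
    have h2 := ENNReal.lintegral_mul_le_Lp_mul_Lq (volume : Measure E3)
      Real.HolderConjugate.two_two (f := fun h => ‖k h‖ₑ ^ (1/2 : ℝ))
      (g := fun h => ‖k h‖ₑ ^ (1/2 : ℝ) * ‖Φ x h‖ₑ) (hk'.pow_const _) ((hk'.pow_const _).mul hx')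
    have e1 : ∀ h : E3, ‖k h‖ₑ ^ (1/2 : ℝ) * ‖k h‖ₑ ^ (1/2 : ℝ) = ‖k h‖ₑ := fun h => by
      rw [← ENNReal.rpow_add_of_nonneg _ _ (by norm_num) (by norm_num)]; norm_num
    simp only [Pi.mul_apply, ← mul_assoc, e1, ENNReal.rpow_two, sq] at h2
    have e2 : ∀ h : E3, ‖k h‖ₑ ^ (1/2 : ℝ) * ‖Φ x h‖ₑ * ‖k h‖ₑ ^ (1/2 : ℝ) * ‖Φ x h‖ₑ
        = ‖k h‖ₑ * ‖Φ x h‖ₑ ^ 2 := fun h => by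
      rw [mul_right_comm (_ ^ _), e1, sq, mul_assoc]
    simp only [e2] at h2
    calc ‖∫ h, k h * Φ x h‖ₑ ^ 2
        ≤ ((∫⁻ h, ‖k h‖ₑ) ^ (1/2 : ℝ) * (∫⁻ h, ‖k h‖ₑ * ‖Φ x h‖ₑ ^ 2) ^ (1/2 : ℝ)) ^ 2 :=
          pow_le_pow_left' (h1.trans h2) 2
      _ = _ := by
          rw [mul_pow, ← ENNReal.rpow_two, ← ENNReal.rpow_two, ← ENNReal.rpow_mul,
            ← ENNReal.rpow_mul]
          norm_num
  refine (lintegral_mono_ae step).trans ?_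
  have hmeas : AEMeasurable (Function.uncurry fun x h : E3 => ‖k h‖ₑ * ‖Φ x h‖ₑ ^ 2)
      (volume.prod volume) :=
    (hk.comp_snd.enorm).mul (hΦ.enorm.pow_const 2)
  have hm' : AEMeasurable (fun x => ∫⁻ h, ‖k h‖ₑ * ‖Φ x h‖ₑ ^ 2) (volume : Measure E3) :=
    hmeas.lintegral_prod_right'
  rw [lintegral_const_mul'' _ hm', lintegral_lintegral_swap hmeas]
  gcongr with h
  by_cases hh : ‖k h‖ₑ = 0
  · simp [hh]
  · rw [lintegral_const_mul' _ _ (by simp)]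

end L2

/-! ### Mollification in `L²` and the moment kernels -/

section Mollifier

open scoped ENNReal

theorem locallyIntegrable_of_memLp {f : E3 → ℝ} (hf : MemLp f 2) : LocallyIntegrable f :=
  hf.locallyIntegrable (by norm_num)

theorem IsTest.integrable {φ : E3 → ℝ} (h : IsTest φ) : Integrable φ :=
  h.continuous.integrable_of_hasCompactSupport h.2

theorem lintegral_enorm_conv_sq_le {k f : E3 → ℝ} (hk : AEStronglyMeasurable k volume)
    (hf : AEStronglyMeasurable f volume) :
    eLpNorm (conv k f) 2 volume ≤ eLpNorm k 1 volume * eLpNorm f 2 volume := by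
  have hΦ : AEStronglyMeasurable (Function.uncurry fun x h : E3 => f (x - h))
      (volume.prod volume) :=
    hf.comp_quasiMeasurePreserving (quasiMeasurePreserving_sub volume volume)
  have h := lintegral_kernel_sq_le hk hΦ
  have e : ∀ h : E3, ∫⁻ x, ‖f (x - h)‖ₑ ^ 2 = eLpNorm f 2 volume ^ 2 := fun h => by
    rw [eLpNorm_two_sq, lintegral_sub_right_eq_self (fun x => ‖f x‖ₑ ^ 2) h]
  simp only [e, ← conv_apply'] at h
  rw [lintegral_mul_const'' _ hk.enorm, ← eLpNorm_two_sq, ← eLpNorm_one_eq_lintegral_enorm,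
    ← mul_assoc, ← sq, ← mul_pow] at h
  exact (ENNReal.pow_le_pow_left_iff two_ne_zero).1 h

theorem memLp_conv {k f : E3 → ℝ} (hk : IsTest k) (hf : MemLp f 2) : MemLp (conv k f) 2 :=
  ⟨(contDiff_conv hk (locallyIntegrable_of_memLp hf)).continuous.aestronglyMeasurable,
    (lintegral_enorm_conv_sq_le hk.continuous.aestronglyMeasurable hf.1).trans_lt
      (ENNReal.mul_lt_top (hk.memLp 1).2 hf.2)⟩

theorem l2Norm_conv_le {k f : E3 → ℝ} (hk : IsTest k) (hf : MemLp f 2) :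
    l2Norm (conv k f) ≤ (∫ x, |k x|) * l2Norm f := by
  have h := lintegral_enorm_conv_sq_le hk.continuous.aestronglyMeasurable hf.1
  have h1 : ∫ x, |k x| = (eLpNorm k 1 volume).toReal := by
    rw [eLpNorm_one_eq_lintegral_enorm]
    exact integral_norm_eq_lintegral_enorm hk.continuous.aestronglyMeasurable
  rw [h1, l2Norm, l2Norm, ← ENNReal.toReal_mul]
  exact ENNReal.toReal_mono (ENNReal.mul_ne_top (hk.memLp 1).2.ne hf.2.ne) h

theorem abs_conv_le {k f : E3 → ℝ} (hk : IsTest k) (hf : MemLp f 2) (x : E3) :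
    |conv k f x| ≤ l2Norm k * l2Norm f := by
  rw [conv_apply, mul_comm]
  have hk' := (hk.comp_sub_left x).memLp 2
  refine (abs_integral_mul_le hf hk').trans (mul_le_mul_of_nonneg_left ?_ (l2Norm_nonneg f))
  refine le_of_eq ?_
  unfold l2Norm
  congr 1
  exact eLpNorm_comp_measurePreserving (g := k) hk.continuous.aestronglyMeasurable
    (Measure.measurePreserving_sub_left volume x)

/-- Translations act continuously on `L²`. -/
theorem tendsto_eLpNorm_translate_sub {f : E3 → ℝ} (hf : MemLp f 2) :
    Tendsto (fun h : E3 => eLpNorm (fun x => f (x - h) - f x) 2 volume) (𝓝 0) (𝓝 0) := by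
  have : Fact ((1 : ℝ≥0∞) ≤ 2) := ⟨by norm_num⟩
  let g : E3 → C(E3, E3) := fun h => ⟨fun x => x - h, by fun_prop⟩
  have hg : Continuous g := ContinuousMap.continuous_of_continuous_uncurry _ (by
    simp only [g, ContinuousMap.coe_mk, Function.uncurry_def]; fun_prop)
  have hgm : ∀ h, MeasurePreserving (g h) volume volume := fun h => MeasureTheory.measurePreserving_sub_right volume h
  have key := (Continuous.compMeasurePreservingLp (continuous_const (y := hf.toLp f)) hg hgm
    (by norm_num)).tendsto 0
  rw [tendsto_iff_edist_tendsto_0] at key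
  refine key.congr fun h => ?_
  rw [Lp.edist_def]
  refine eLpNorm_congr_ae ?_
  have e : ∀ h, (Lp.compMeasurePreserving (g h) (hgm h) (hf.toLp f) : E3 → ℝ) =ᵐ[volume]
      fun x => f (x - h) := fun h =>
    (Lp.coeFn_compMeasurePreserving _ _).trans
      ((hgm h).quasiMeasurePreserving.ae_eq_comp hf.coeFn_toLp)
  filter_upwards [e h, e 0] with x h1 h2
  rw [Pi.sub_apply, h1, h2, sub_zero]

/-- A sequence of bump functions that shrink to the origin. -/
noncomputable def shrinkingBump (n : ℕ) : ContDiffBump (0 : E3) where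
  rIn := 1 / (2 * ((n : ℝ) + 1))
  rOut := 1 / ((n : ℝ) + 1)
  rIn_pos := by positivity
  rIn_lt_rOut := by
    apply one_div_lt_one_div_of_lt <;> [positivity; skip]
    have : (0 : ℝ) ≤ n := Nat.cast_nonneg n
    linarith

/-- The standard mollifier at scale `1 / (n + 1)`. -/
noncomputable def mollifier (n : ℕ) : E3 → ℝ := (shrinkingBump n).normed volume

theorem isTest_mollifier (n : ℕ) : IsTest (mollifier n) :=
  ⟨(shrinkingBump n).contDiff_normed, (shrinkingBump n).hasCompactSupport_normed⟩

theorem mollifier_nonneg (n : ℕ) (x : E3) : 0 ≤ mollifier n x := (shrinkingBump n).nonneg_normed x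

theorem integral_mollifier (n : ℕ) : ∫ x, mollifier n x = 1 := (shrinkingBump n).integral_normed

theorem mollifier_eq_zero {n : ℕ} {x : E3} (h : 1 / ((n : ℝ) + 1) ≤ ‖x‖) : mollifier n x = 0 := by
  by_contra hx
  have : x ∈ Function.support (mollifier n) := hx
  rw [mollifier, (shrinkingBump n).support_normed_eq, mem_ball_zero_iff] at this
  exact absurd this (not_lt.2 h)

theorem lintegral_mollifier (n : ℕ) : ∫⁻ x, ‖mollifier n x‖ₑ = 1 := by
  have h := ofReal_integral_norm_eq_lintegral_enorm
    (isTest_mollifier n).integrable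
  rw [← h]
  simp [Real.norm_of_nonneg (mollifier_nonneg n _), integral_mollifier]

theorem tendstoL2_mollify {f : E3 → ℝ} (hf : MemLp f 2) :
    TendstoL2 (fun n => conv (mollifier n) f) f := by
  refine ⟨fun n => memLp_conv (isTest_mollifier n) hf, hf, ?_⟩
  suffices Tendsto (fun n => eLpNorm (fun x => conv (mollifier n) f x - f x) 2 volume)
      atTop (𝓝 0) by
    exact (ENNReal.tendsto_toReal ENNReal.zero_ne_top).comp this
  rw [ENNReal.tendsto_atTop_zero]
  intro ε hε
  have ht := ENNReal.tendsto_nhds_zero.1 (tendsto_eLpNorm_translate_sub hf) ε hε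
  obtain ⟨δ, hδ, hball⟩ := Metric.eventually_nhds_iff.1 ht
  obtain ⟨N, hN⟩ := exists_nat_one_div_lt hδ
  refine ⟨N, fun n hn => ?_⟩
  have hΦ : AEStronglyMeasurable (Function.uncurry fun x h : E3 => f (x - h) - f x)
      (volume.prod volume) :=
    (hf.1.comp_quasiMeasurePreserving (quasiMeasurePreserving_sub volume volume)).sub
      hf.1.comp_fst
  have h := lintegral_kernel_sq_le (isTest_mollifier n).continuous.aestronglyMeasurable hΦ
  -- As the mollifier has integral one, the error is an average of translation differences over `|h|
  -- < 1/(n+1)`.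
  have e : ∀ x, ∫ h, mollifier n h * (f (x - h) - f x) = conv (mollifier n) f x - f x := fun x => by
    have hi : Integrable (fun h => mollifier n h * f (x - h)) := by
      have := (integrable_conv (isTest_mollifier n) (locallyIntegrable_of_memLp hf) x).comp_sub_left x
      simpa [mul_comm] using this
    simp only [mul_sub]
    rw [integral_sub hi ((isTest_mollifier n).integrable.mul_const _),
      integral_mul_const, integral_mollifier, ← conv_apply', one_mul]
  simp only [e, ← eLpNorm_two_sq, lintegral_mollifier, one_mul] at h
  refine (ENNReal.pow_le_pow_left_iff two_ne_zero).1 (h.trans ?_)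
  calc ∫⁻ h, ‖mollifier n h‖ₑ * eLpNorm (fun x => f (x - h) - f x) 2 volume ^ 2
      ≤ ∫⁻ h, ‖mollifier n h‖ₑ * ε ^ 2 := by
        refine lintegral_mono fun h => ?_
        by_cases hh : 1 / ((n : ℝ) + 1) ≤ ‖h‖
        · simp [mollifier_eq_zero hh]
        · gcongr
          apply hball
          rw [dist_zero_right]
          refine (not_le.1 hh).trans (lt_of_le_of_lt ?_ hN)
          apply one_div_le_one_div_of_le (by positivity)
          have : (N : ℝ) ≤ n := by exact_mod_cast hn
          linarith
    _ = ε ^ 2 := by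
        rw [lintegral_mul_const'' _
          (isTest_mollifier n).continuous.aestronglyMeasurable.enorm, lintegral_mollifier, one_mul]

/-- The mollifier with an additional coordinate factor. -/
noncomputable def mollifierMoment (n : ℕ) (j : Fin 3) : E3 → ℝ := fun w => w j * mollifier n w

theorem isTest_mollifierMoment (n : ℕ) (j : Fin 3) : IsTest (mollifierMoment n j) := by
  unfold mollifierMoment
  simpa only [mul_comm] using (isTest_mollifier n).mul_contDiff (contDiff_coord j)

/-- The coordinate factor is at most `1/(n+1)` on the support of the mollifier. This smallness makes
the commutator of mollification with `y ∂ₓ` disappear in the limit. -/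
theorem integral_abs_mollifierMoment_le (n : ℕ) (j : Fin 3) :
    ∫ x, |mollifierMoment n j x| ≤ 1 / ((n : ℝ) + 1) := by
  have hi := (isTest_mollifier n).integrable
  calc ∫ x, |mollifierMoment n j x| ≤ ∫ x, 1 / ((n : ℝ) + 1) * mollifier n x := by
        refine integral_mono (isTest_mollifierMoment n j).integrable.abs
          (hi.const_mul _) fun x => ?_
        by_cases hh : 1 / ((n : ℝ) + 1) ≤ ‖x‖
        · simp [mollifierMoment, mollifier_eq_zero hh]
        · simp only [mollifierMoment, abs_mul, abs_of_nonneg (mollifier_nonneg n x)]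
          refine mul_le_mul_of_nonneg_right ?_ (mollifier_nonneg n x)
          exact (PiLp.norm_apply_le x j).trans (not_le.1 hh).le
    _ = _ := by rw [integral_const_mul, integral_mollifier, mul_one]

theorem tendstoL2_mollifierMoment {f : E3 → ℝ} (hf : MemLp f 2) (j : Fin 3) :
    TendstoL2 (fun n => conv (mollifierMoment n j) f) (fun _ => 0) := by
  refine ⟨fun n => memLp_conv (isTest_mollifierMoment n j) hf, MemLp.zero, ?_⟩
  simp only [sub_zero]
  have h : Tendsto (fun n : ℕ => 1 / ((n : ℝ) + 1) * l2Norm f) atTop (𝓝 0) := by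
    simpa using tendsto_one_div_add_atTop_nhds_zero_nat.mul_const (l2Norm f)
  refine squeeze_zero (fun n => l2Norm_nonneg _) (fun n => ?_) h
  exact (l2Norm_conv_le (isTest_mollifierMoment n j) hf).trans
    (mul_le_mul_of_nonneg_right (integral_abs_mollifierMoment_le n j) (l2Norm_nonneg f))

theorem l2Norm_mollify_le {f : E3 → ℝ} (hf : MemLp f 2) (n : ℕ) :
    l2Norm (conv (mollifier n) f) ≤ l2Norm f := by
  have := l2Norm_conv_le (isTest_mollifier n) hf
  simpa only [abs_of_nonneg (mollifier_nonneg n _), integral_mollifier, one_mul] using this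

theorem l2Norm_mollifierMoment_le {f : E3 → ℝ} (hf : MemLp f 2) (n : ℕ) (j : Fin 3) :
    l2Norm (conv (mollifierMoment n j) f) ≤ l2Norm f := by
  refine (l2Norm_conv_le (isTest_mollifierMoment n j) hf).trans
    (mul_le_of_le_one_left (l2Norm_nonneg f) ((integral_abs_mollifierMoment_le n j).trans ?_))
  rw [div_le_one (by positivity)]
  have : (0 : ℝ) ≤ n := Nat.cast_nonneg n
  linarith

end Mollifier

/-! ### Cutoff functions at growing scales -/

section Cutoff

open scoped ENNReal

/-- A bump function that is `1` on the unit ball and vanishes outside the ball of radius `2`. -/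
noncomputable def unitBump : ContDiffBump (0 : E3) := ⟨1, 2, one_pos, one_lt_two⟩

/-- A cutoff function that is `1` on the ball of radius `n + 1`. -/
noncomputable def cutoff (n : ℕ) (x : E3) : ℝ := unitBump (((n : ℝ) + 1)⁻¹ • x)

theorem isTest_unitBump : IsTest unitBump := ⟨unitBump.contDiff, unitBump.hasCompactSupport⟩

theorem isTest_cutoff (n : ℕ) : IsTest (cutoff n) := by
  have hn : ((n : ℝ) + 1)⁻¹ ≠ 0 := by positivity
  exact ⟨isTest_unitBump.1.comp (contDiff_const_smul _),
    isTest_unitBump.2.comp_homeomorph (Homeomorph.smulOfNeZero _ hn)⟩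

theorem abs_cutoff_le_one (n : ℕ) (x : E3) : |cutoff n x| ≤ 1 := by
  rw [cutoff, abs_of_nonneg unitBump.nonneg]
  exact unitBump.le_one

theorem eventually_norm_inv_smul_lt (x : E3) :
    ∀ᶠ n : ℕ in atTop, ‖((n : ℝ) + 1)⁻¹ • x‖ < 1 := by
  have : Tendsto (fun n : ℕ => ‖((n : ℝ) + 1)⁻¹ • x‖) atTop (𝓝 0) := by
    simpa [one_div] using
      ((tendsto_one_div_add_atTop_nhds_zero_nat (𝕜 := ℝ)).smul_const x).norm
  exact this.eventually (gt_mem_nhds one_pos)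

theorem tendsto_cutoff (x : E3) : Tendsto (fun n => cutoff n x) atTop (𝓝 1) := by
  refine tendsto_const_nhds.congr' ?_
  filter_upwards [eventually_norm_inv_smul_lt x] with n hn
  exact (unitBump.one_of_mem_closedBall (mem_closedBall_zero_iff.2 hn.le)).symm

theorem classicalPartial_cutoff (n : ℕ) (i : Fin 3) (x : E3) :
    classicalPartial i (cutoff n) x =
      ((n : ℝ) + 1)⁻¹ * classicalPartial i unitBump (((n : ℝ) + 1)⁻¹ • x) := by
  unfold classicalPartial cutoff
  have h1 : HasFDerivAt (fun y : E3 => ((n : ℝ) + 1)⁻¹ • y)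
      (((n : ℝ) + 1)⁻¹ • ContinuousLinearMap.id ℝ E3) x :=
    (hasFDerivAt_id (𝕜 := ℝ) x).const_smul (((n : ℝ) + 1)⁻¹)
  have h2 : HasFDerivAt (fun y : E3 => unitBump (((n : ℝ) + 1)⁻¹ • y)) _ x :=
    (isTest_unitBump.differentiable _).hasFDerivAt.comp x h1
  rw [h2.fderiv]
  simp

theorem classicalPartial_unitBump_eq_zero (i : Fin 3) {x : E3} (hx : ‖x‖ < 1) :
    classicalPartial i unitBump x = 0 := by
  have : (unitBump : E3 → ℝ) =ᶠ[𝓝 x] fun _ => 1 :=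
    unitBump.eventuallyEq_one_of_mem_ball (mem_ball_zero_iff.2 hx)
  unfold classicalPartial
  rw [this.fderiv_eq]
  simp

theorem tendsto_classicalPartial_cutoff (i : Fin 3) (x : E3) :
    Tendsto (fun n => classicalPartial i (cutoff n) x) atTop (𝓝 0) := by
  refine tendsto_const_nhds.congr' ?_
  filter_upwards [eventually_norm_inv_smul_lt x] with n hn
  rw [classicalPartial_cutoff, classicalPartial_unitBump_eq_zero i hn, mul_zero]

theorem exists_abs_classicalPartial_cutoff_le :
    ∃ M, ∀ (i : Fin 3) n x, |classicalPartial i (cutoff n) x| ≤ M := by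
  have : ∀ i : Fin 3, ∃ M, ∀ x, |classicalPartial i unitBump x| ≤ M := fun i =>
    (isTest_unitBump.classicalPartial i).2.exists_bound_of_continuous
      (isTest_unitBump.classicalPartial i).continuous
  choose M hM using this
  refine ⟨∑ i, M i, fun i n x => ?_⟩
  have hM0 : ∀ i, 0 ≤ M i := fun i => (abs_nonneg _).trans (hM i 0)
  refine le_trans ?_ (Finset.single_le_sum (fun i _ => hM0 i) (Finset.mem_univ i))
  rw [classicalPartial_cutoff, abs_mul]
  refine (mul_le_of_le_one_left (abs_nonneg _) ?_).trans (hM i _)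
  rw [abs_of_nonneg (by positivity)]
  exact inv_le_one_of_one_le₀ (by linarith [(Nat.cast_nonneg n : (0 : ℝ) ≤ n)])

/-- The expression is the fixed function `x_j ∂_i χ` evaluated at `x / (n + 1)`: the decay of the
gradient compensates the linear growth of the Couette flow. -/
theorem exists_abs_coord_mul_classicalPartial_cutoff_le (i j : Fin 3) :
    ∃ M, ∀ n (x : E3), |x j * classicalPartial i (cutoff n) x| ≤ M := by
  have ht : IsTest (fun x => classicalPartial i unitBump x * x j) :=
    (isTest_unitBump.classicalPartial i).mul_contDiff (contDiff_coord j)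
  obtain ⟨M, hM⟩ := ht.2.exists_bound_of_continuous ht.continuous
  refine ⟨M, fun n x => ?_⟩
  refine le_trans (le_of_eq ?_) (hM (((n : ℝ) + 1)⁻¹ • x))
  rw [classicalPartial_cutoff, Real.norm_eq_abs]
  congr 1
  simp only [PiLp.smul_apply, smul_eq_mul]
  ring

/-- In three dimensions the `L³` norm of the gradient of the cutoff does not depend on the scale. -/
theorem eLpNorm_classicalPartial_cutoff (n : ℕ) (i : Fin 3) :
    eLpNorm (classicalPartial i (cutoff n)) 3 volume =
      eLpNorm (classicalPartial i unitBump) 3 volume := by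
  set c : ℝ := ((n : ℝ) + 1)⁻¹ with hc
  have hc0 : 0 < c := by positivity
  have hmap : Measure.map (fun x : E3 => c • x) volume =
      ENNReal.ofReal (c⁻¹ ^ 3) • (volume : Measure E3) := by
    have := Measure.map_addHaar_smul (volume : Measure E3) hc0.ne'
    rw [this, finrank_euclideanSpace_fin, abs_of_pos (by positivity), inv_pow c]
  have hcont := (isTest_unitBump.classicalPartial i).continuous
  have e : classicalPartial i (cutoff n) =
      c • (classicalPartial i unitBump ∘ fun x : E3 => c • x) := by
    ext x
    simp [classicalPartial_cutoff, hc]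
  rw [e, eLpNorm_const_smul, ← eLpNorm_map_measure (hcont.aestronglyMeasurable)
    (by fun_prop), hmap, eLpNorm_smul_measure_of_ne_top (by norm_num), smul_eq_mul, ← mul_assoc]
  -- The change of variables contributes `(c⁻³)^{1/3} = c⁻¹`, which cancels the factor `c` from the
  -- chain rule.
  have h3 : ENNReal.ofReal (c⁻¹ ^ 3) ^ (1 / (3 : ℝ≥0∞)).toReal = ENNReal.ofReal c⁻¹ := by
    rw [ENNReal.ofReal_pow (by positivity), ← ENNReal.rpow_natCast, ← ENNReal.rpow_mul]
    simp
  rw [h3, Real.enorm_of_nonneg hc0.le, ← ENNReal.ofReal_mul hc0.le, mul_inv_cancel₀ hc0.ne']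
  simp

end Cutoff

/-! ### Weak integration by parts, second derivatives and the Sobolev inequality -/

section Sobolev

open scoped ENNReal NNReal

/-- `f ∈ H¹(ℝ³)` with weak partial derivatives `g i`. -/
structure IsH1 (f : E3 → ℝ) (g : Fin 3 → E3 → ℝ) : Prop where
  memLp : MemLp f 2
  memLp_partial : ∀ i, MemLp (g i) 2
  weak : ∀ i, IsWeakPartial i f (g i)

/-- Mollification followed by a cutoff. -/
noncomputable def approx (n : ℕ) (f : E3 → ℝ) : E3 → ℝ :=
  fun x => cutoff n x * conv (mollifier n) f x

theorem isTest_approx (n : ℕ) {f : E3 → ℝ} (hf : LocallyIntegrable f) : IsTest (approx n f) :=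
  (isTest_cutoff n).mul_contDiff (contDiff_conv (isTest_mollifier n) hf)

theorem classicalPartial_mollify {k f g : E3 → ℝ} (hk : IsTest k) {i : Fin 3}
    (h : IsWeakPartial i f g) : classicalPartial i (conv k f) = conv k g := by
  rw [classicalPartial_conv hk h.1, conv_classicalPartial hk h]

theorem classicalPartial_approx (n : ℕ) {f g : E3 → ℝ} {i : Fin 3} (h : IsWeakPartial i f g)
    (x : E3) : classicalPartial i (approx n f) x =
      classicalPartial i (cutoff n) x * conv (mollifier n) f x +
        cutoff n x * conv (mollifier n) g x := by
  unfold approx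
  rw [classicalPartial_mul (isTest_cutoff n).differentiable
    ((contDiff_conv (isTest_mollifier n) h.1).differentiable (by simp)),
    classicalPartial_mollify (isTest_mollifier n) h]

theorem tendstoL2_cutoff_mul {F : ℕ → E3 → ℝ} {f : E3 → ℝ} (hf : TendstoL2 F f) :
    TendstoL2 (fun n x => cutoff n x * F n x) f := by
  simpa using hf.bounded_mul (c := cutoff)
    (fun n => (isTest_cutoff n).continuous.aestronglyMeasurable) abs_cutoff_le_one tendsto_cutoff

theorem tendstoL2_classicalPartial_cutoff_mul {F : ℕ → E3 → ℝ} {f : E3 → ℝ} (hf : TendstoL2 F f)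
    (i : Fin 3) : TendstoL2 (fun n x => classicalPartial i (cutoff n) x * F n x) (fun _ => 0) := by
  obtain ⟨M, hM⟩ := exists_abs_classicalPartial_cutoff_le
  simpa using hf.bounded_mul (c := fun n => classicalPartial i (cutoff n))
    (fun n => ((isTest_cutoff n).classicalPartial i).continuous.aestronglyMeasurable) (hM i)
    (tendsto_classicalPartial_cutoff i)

theorem tendstoL2_approx {f : E3 → ℝ} (hf : MemLp f 2) : TendstoL2 (fun n => approx n f) f :=
  tendstoL2_cutoff_mul (tendstoL2_mollify hf)

theorem tendstoL2_classicalPartial_approx {f g : E3 → ℝ} (hf : MemLp f 2) (hg : MemLp g 2)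
    {i : Fin 3} (h : IsWeakPartial i f g) :
    TendstoL2 (fun n => classicalPartial i (approx n f)) g := by
  have h1 := (tendstoL2_classicalPartial_cutoff_mul (tendstoL2_mollify hf) i).add
    (tendstoL2_cutoff_mul (tendstoL2_mollify hg))
  simp only [zero_add] at h1
  convert h1 using 2 with n
  ext x
  exact classicalPartial_approx n h x

/-- Integration by parts for weak derivatives. -/
theorem integral_weakPartial_mul {f g h k : E3 → ℝ} {i : Fin 3} (hf : MemLp f 2) (hg : MemLp g 2)
    (hh : MemLp h 2) (hk : MemLp k 2) (hfg : IsWeakPartial i f g) (hhk : IsWeakPartial i h k) :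
    ∫ x, g x * h x = -∫ x, f x * k x := by
  have h1 := (tendstoL2_classicalPartial_approx hh hk hhk).tendsto_integral_mul
    (TendstoL2.const hf)
  have h2 := ((tendstoL2_approx hh).tendsto_integral_mul (TendstoL2.const hg)).neg
  have e : ∀ n, ∫ x, classicalPartial i (approx n h) x * f x = -∫ x, approx n h x * g x :=
    fun n => hfg.2.2 _ (isTest_approx n hhk.1)
  simp only [e] at h1
  have := tendsto_nhds_unique h1 h2
  simp only [mul_comm (g _), mul_comm (f _)]
  linarith

theorem integral_classicalPartial_mul {φ ψ : E3 → ℝ} (hφ : IsTest φ) (hψ : ContDiff ℝ ∞ ψ)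
    (i : Fin 3) :
    ∫ x, classicalPartial i φ x * ψ x = -∫ x, φ x * classicalPartial i ψ x := by
  have h := integral_classicalPartial_eq_zero (hφ.mul_contDiff hψ) i
  simp only [classicalPartial_mul hφ.differentiable (hψ.differentiable (by simp))] at h
  rw [integral_add ((hφ.classicalPartial i).mul_contDiff hψ).integrable
    (hφ.mul_contDiff (contDiff_classicalPartial hψ i)).integrable] at h
  linarith

theorem isWeakPartial_classicalPartial {ψ : E3 → ℝ} (hψ : ContDiff ℝ ∞ ψ) (i : Fin 3) :
    IsWeakPartial i ψ (classicalPartial i ψ) :=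
  ⟨hψ.continuous.locallyIntegrable,
    (contDiff_classicalPartial hψ i).continuous.locallyIntegrable,
    fun _ hφ => integral_classicalPartial_mul hφ hψ i⟩

theorem isWeakPartial_conv {k f : E3 → ℝ} (hk : IsTest k) (hf : LocallyIntegrable f) (i : Fin 3) :
    IsWeakPartial i (conv k f) (conv (classicalPartial i k) f) := by
  rw [← classicalPartial_conv hk hf]
  exact isWeakPartial_classicalPartial (contDiff_conv hk hf) i

/-- For `v ∈ H²`, the products `∂_i∂_k v ∂_i∂_k v` and `∂_i∂_i v ∂_k∂_k v` have the same integral. -/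
theorem integral_sq_mixed_partial {v : E3 → ℝ} {g : Fin 3 → E3 → ℝ} {h : Fin 3 → Fin 3 → E3 → ℝ}
    (hv : IsH1 v g) (hg : ∀ k, IsH1 (g k) (fun i => h i k)) (i k : Fin 3) :
    ∫ x, h i k x * h i k x = ∫ x, h k k x * h i i x := by
  have hh : ∀ a b, MemLp (h a b) 2 := fun a b => (hg b).memLp_partial a
  refine tendsto_nhds_unique ((tendstoL2_mollify (hh i k)).tendsto_integral_mul
    (tendstoL2_mollify (hh i k))) ?_
  refine ((tendstoL2_mollify (hh k k)).tendsto_integral_mul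
    (tendstoL2_mollify (hh i i))).congr fun n => ?_
  set ρ := mollifier n
  have hρ : IsTest ρ := isTest_mollifier n
  have hloc : ∀ a b, LocallyIntegrable (h a b) := fun a b => locallyIntegrable_of_memLp (hh a b)
  have hw : ∀ j a b, IsWeakPartial j (conv ρ (h a b)) (conv (classicalPartial j ρ) (h a b)) :=
    fun j a b => isWeakPartial_conv hρ (hloc a b) j
  have hgw : ∀ a b, IsWeakPartial a (conv ρ (g b)) (conv ρ (h a b)) := fun a b => by
    rw [← conv_classicalPartial hρ ((hg b).weak a)]
    exact isWeakPartial_conv hρ ((hg b).weak a).1 a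
  have hm : ∀ a b, MemLp (conv ρ (h a b)) 2 := fun a b => memLp_conv hρ (hh a b)
  have hm' : ∀ j a b, MemLp (conv (classicalPartial j ρ) (h a b)) 2 := fun j a b =>
    memLp_conv (hρ.classicalPartial j) (hh a b)
  have hmg : ∀ b, MemLp (conv ρ (g b)) 2 := fun b => memLp_conv hρ (hg b).memLp
  -- Third derivatives exist after mollification. Both integrals become minus the integral of `ρ * g
  -- k` against a third derivative of `ρ * v`, namely `∂_k ∂_i ∂_i` and `∂_i ∂_i ∂_k`, and these
  -- agree.
  rw [integral_weakPartial_mul (hmg k) (hm k k) (hm i i) (hm' k i i) (hgw k k) (hw k i i),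
    integral_weakPartial_mul (hmg k) (hm i k) (hm i k) (hm' i i k) (hgw i k) (hw i i k)]
  have e : conv (classicalPartial k ρ) (h i i) = conv (classicalPartial i ρ) (h i k) := by
    have hs := contDiff_conv hρ (hv.weak 0).1
    rw [← classicalPartial_conv hρ (hloc i i), ← classicalPartial_conv hρ (hloc i k),
      ← classicalPartial_mollify hρ ((hg i).weak i), ← classicalPartial_mollify hρ ((hg k).weak i),
      ← classicalPartial_mollify hρ (hv.weak i), ← classicalPartial_mollify hρ (hv.weak k)]
    have c : classicalPartial i (classicalPartial k (conv ρ v)) =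
        classicalPartial k (classicalPartial i (conv ρ v)) :=
      funext (classicalPartial_comm hs i k)
    rw [c]
    exact funext (classicalPartial_comm (contDiff_classicalPartial hs i) k i)
  rw [e]

/-- Each product of two pure second derivatives in the expanded square is replaced by the square of
a mixed one. The Laplacian thereby controls the full Hessian. -/
theorem integral_laplacian_sq {v : E3 → ℝ} {g : Fin 3 → E3 → ℝ} {h : Fin 3 → Fin 3 → E3 → ℝ}
    (hv : IsH1 v g) (hg : ∀ k, IsH1 (g k) (fun i => h i k)) :
    ∫ x, (∑ i, h i i x) ^ 2 = ∑ i, ∑ k, ∫ x, h i k x ^ 2 := by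
  have hh : ∀ a b, MemLp (h a b) 2 := fun a b => (hg b).memLp_partial a
  have hi : ∀ i k, Integrable (fun x => h k k x * h i i x) := fun i k =>
    integrable_mul (hh k k) (hh i i)
  have e : ∀ x, (∑ i, h i i x) ^ 2 = ∑ i, ∑ k, h k k x * h i i x := fun x => by
    rw [sq, Finset.sum_mul_sum, Finset.sum_comm]
  simp only [e]
  rw [integral_finsetSum _ fun i _ => integrable_finsetSum _ fun k _ => hi i k]
  refine Finset.sum_congr rfl fun i _ => ?_
  rw [integral_finsetSum _ fun k _ => hi i k]
  refine Finset.sum_congr rfl fun k _ => ?_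
  rw [← integral_sq_mixed_partial hv hg]
  simp only [sq]

theorem TendstoL2.tendsto_eLpNorm {F : ℕ → E3 → ℝ} {f : E3 → ℝ} (hf : TendstoL2 F f) :
    Tendsto (fun n => eLpNorm (fun x => F n x - f x) 2 volume) atTop (𝓝 0) := by
  have := ENNReal.tendsto_ofReal hf.tendsto
  simpa only [ofReal_l2Norm (memLp_sub (hf.memLp _) hf.memLp_lim), ENNReal.ofReal_zero] using this

theorem TendstoL2.exists_seq_tendsto_ae {F : ℕ → E3 → ℝ} {f : E3 → ℝ} (hf : TendstoL2 F f) :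
    ∃ ns : ℕ → ℕ, StrictMono ns ∧ ∀ᵐ x, Tendsto (fun n => F (ns n) x) atTop (𝓝 (f x)) :=
  (tendstoInMeasure_of_tendsto_eLpNorm two_ne_zero (fun n => (hf.memLp n).1) hf.memLp_lim.1
    hf.tendsto_eLpNorm).exists_seq_tendsto_ae

theorem TendstoL2.eLpNorm_le_add {F : ℕ → E3 → ℝ} {f : E3 → ℝ} (hf : TendstoL2 F f) (n : ℕ) :
    eLpNorm (F n) 2 volume ≤
      eLpNorm f 2 volume + eLpNorm (fun x => F n x - f x) 2 volume := by
  have := eLpNorm_add_le hf.memLp_lim.1 (memLp_sub (hf.memLp n) hf.memLp_lim).1 (p := 2)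
    (by norm_num)
  have e : (f + fun x => F n x - f x) = F n := by
    ext x
    simp
  rwa [e] at this

theorem exists_eLpNorm_six_le_of_isTest : ∃ C : ℝ≥0, ∀ φ : E3 → ℝ, IsTest φ →
    eLpNorm φ 6 volume ≤ C * ∑ i, eLpNorm (classicalPartial i φ) 2 volume := by
  refine ⟨eLpNormLESNormFDerivOfEqInnerConst (volume : Measure E3) 2, fun φ ht => ?_⟩
  -- The exponent is determined by `1/6 = 1/2 - 1/3`.
  have h1 := eLpNorm_le_eLpNorm_fderiv_of_eq_inner (volume : Measure E3) (p := 2) (p' := 6)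
    (ht.1.of_le (by simp)) ht.2 (by norm_num) (by simp)
    (by rw [finrank_euclideanSpace_fin]; norm_num)
  refine h1.trans (mul_le_mul_right ?_ _)
  calc eLpNorm (fderiv ℝ φ) (2 : ℝ≥0) volume
      ≤ eLpNorm (∑ i, fun x => |classicalPartial i φ x|) 2 volume := by
        refine eLpNorm_mono fun x => ?_
        simp only [Finset.sum_apply]
        exact (norm_fderiv_le_sum _ x).trans (le_abs_self _)
    _ ≤ ∑ i, eLpNorm (fun x => |classicalPartial i φ x|) 2 volume :=
        eLpNorm_sum_le (fun i _ => (ht.classicalPartial i).continuous.abs.aestronglyMeasurable)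
          (by norm_num)
    _ = _ := by
        refine Finset.sum_congr rfl fun i _ => ?_
        exact eLpNorm_norm (classicalPartial i φ)

/-- The Sobolev inequality `‖f‖_{L⁶} ≤ C ‖∇f‖_{L²}` on `ℝ³`. -/
theorem exists_eLpNorm_six_le : ∃ C : ℝ≥0, ∀ (f : E3 → ℝ) (g : Fin 3 → E3 → ℝ), IsH1 f g →
    eLpNorm f 6 volume ≤ C * ∑ i, eLpNorm (g i) 2 volume := by
  obtain ⟨C, hC⟩ := exists_eLpNorm_six_le_of_isTest
  refine ⟨C, fun f g hf => ?_⟩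
  have ht := fun i => tendstoL2_classicalPartial_approx hf.memLp (hf.memLp_partial i) (hf.weak i)
  have hfn := tendstoL2_approx hf.memLp
  -- Along an almost everywhere convergent subsequence, Fatou's lemma gives lower semicontinuity of
  -- the `L⁶` norm, so that the limit need not be known to lie in `L⁶`.
  obtain ⟨ns, hns, hae⟩ := hfn.exists_seq_tendsto_ae
  refine (Lp.eLpNorm_lim_le_liminf_eLpNorm (fun n => (hfn.memLp (ns n)).1) f hae).trans ?_
  have hlim : Tendsto (fun n => C * ∑ i, (eLpNorm (g i) 2 volume +
      eLpNorm (fun x => classicalPartial i (approx (ns n) f) x - g i x) 2 volume))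
      atTop (𝓝 (C * ∑ i, eLpNorm (g i) 2 volume)) := by
    refine ENNReal.Tendsto.const_mul (tendsto_finsetSum _ fun i _ => ?_) (Or.inr ENNReal.coe_ne_top)
    simpa using (((ht i).tendsto_eLpNorm.comp hns.tendsto_atTop).const_add (eLpNorm (g i) 2 volume))
  rw [← hlim.liminf_eq]
  refine liminf_le_liminf (Eventually.of_forall fun n => ?_)
  exact (hC _ (isTest_approx (ns n) (hf.weak 0).1)).trans
    (mul_le_mul_right (Finset.sum_le_sum fun i _ => (ht i).eLpNorm_le_add (ns n)) _)

end Sobolev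

/-! ### Orthogonality of pressure gradients and divergence free fields -/

section Pressure

open scoped ENNReal NNReal

theorem sum_classicalPartial_mollify_eq_zero {k : E3 → ℝ} (hk : IsTest k) {w : Fin 3 → E3 → ℝ}
    (hw : ∀ i, LocallyIntegrable (w i))
    (hdiv : ∀ φ, IsTest φ → ∑ i, ∫ x, w i x * classicalPartial i φ x = 0) (x : E3) :
    ∑ i, classicalPartial i (conv k (w i)) x = 0 := by
  have h := hdiv _ (hk.comp_sub_left x)
  simp only [classicalPartial_comp_sub_left hk.differentiable, mul_neg, integral_neg,
    Finset.sum_neg_distrib, neg_eq_zero, ← conv_apply] at h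
  simpa only [classicalPartial_conv hk (hw _)] using h

/-- A gradient in `L²` of a function in `L⁶` is orthogonal to the divergence free fields in `L²`. -/
theorem sum_integral_weakPartial_mul_eq_zero {q : E3 → ℝ} {p w : Fin 3 → E3 → ℝ} (hq : MemLp q 6)
    (hp : ∀ i, MemLp (p i) 2) (hqp : ∀ i, IsWeakPartial i q (p i)) (hw : ∀ i, MemLp (w i) 2)
    (hdiv : ∀ φ, IsTest φ → ∑ i, ∫ x, w i x * classicalPartial i φ x = 0) :
    ∑ i, ∫ x, w i x * p i x = 0 := by
  have hloc := fun i => locallyIntegrable_of_memLp (hw i)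
  have hW : ∀ n i, ContDiff ℝ ∞ (conv (mollifier n) (w i)) := fun n i =>
    contDiff_conv (isTest_mollifier n) (hloc i)
  have ht : ∀ n i, IsTest (approx n (w i)) := fun n i => isTest_approx n (hloc i)
  have h1 : Tendsto (fun n => ∑ i, ∫ x, approx n (w i) x * p i x) atTop
      (𝓝 (∑ i, ∫ x, w i x * p i x)) :=
    tendsto_finsetSum _ fun i _ =>
      (tendstoL2_approx (hw i)).tendsto_integral_mul (TendstoL2.const (hp i))
  -- Hölder with `1/3 + 1/6 = 1/2`. The bound does not depend on `n`, because `‖∇χₙ‖_{L³}` does not.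
  have hr : ∀ n i, MemLp (fun x => classicalPartial i (cutoff n) x * q x) 2 ∧
      l2Norm (fun x => classicalPartial i (cutoff n) x * q x) ≤
        (eLpNorm (classicalPartial i unitBump) 3 volume * eLpNorm q 6 volume).toReal := by
    intro n i
    have htr : ENNReal.HolderTriple 3 6 2 := ⟨by
      rw [← ENNReal.toReal_eq_toReal_iff' (by simp) (by simp),
        ENNReal.toReal_add (by simp) (by simp)]
      simp; norm_num⟩
    have hc := (isTest_cutoff n).classicalPartial i
    have hle := eLpNorm_smul_le_mul_eLpNorm (𝕜 := ℝ) (E := ℝ) (p := 3) (q := 6) (r := 2)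
      (μ := volume) hq.1 hc.continuous.aestronglyMeasurable
    rw [eLpNorm_classicalPartial_cutoff] at hle
    have hfin : eLpNorm (classicalPartial i unitBump) 3 volume * eLpNorm q 6 volume ≠ ⊤ :=
      ENNReal.mul_ne_top ((isTest_unitBump.classicalPartial i).memLp 3).2.ne hq.2.ne
    exact ⟨⟨hc.continuous.aestronglyMeasurable.mul hq.1, hle.trans_lt hfin.lt_top⟩,
      ENNReal.toReal_mono hfin hle⟩
  have hsupp : ∀ (n : ℕ) i x, ‖x‖ < (n : ℝ) + 1 → classicalPartial i (cutoff n) x = 0 := by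
    intro n i x hx
    rw [classicalPartial_cutoff, classicalPartial_unitBump_eq_zero i, mul_zero]
    rw [norm_smul, norm_inv, Real.norm_of_nonneg (by positivity)]
    rw [inv_mul_lt_iff₀ (by positivity), mul_one]
    exact hx
  -- The divergence of the cut-off mollified field consists only of the terms in which the cutoff is
  -- differentiated.
  have hsplit : ∀ n, ∑ i, ∫ x, (classicalPartial i (cutoff n) x * q x) *
      conv (mollifier n) (w i) x = -∑ i, ∫ x, approx n (w i) x * p i x := by
    intro n
    have e1 : ∀ i, ∫ x, classicalPartial i (approx n (w i)) x * q x =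
        -∫ x, approx n (w i) x * p i x := fun i => (hqp i).2.2 _ (ht n i)
    rw [← Finset.sum_neg_distrib, ← Finset.sum_congr rfl fun i _ => e1 i]
    have hi1 : ∀ i, Integrable (fun x => classicalPartial i (approx n (w i)) x * q x) := fun i => by
      have := ((hqp 0).1).integrable_smul_left_of_hasCompactSupport
        ((ht n i).classicalPartial i).continuous ((ht n i).classicalPartial i).2
      simpa using this
    have hi2 : ∀ i, Integrable (fun x => (classicalPartial i (cutoff n) x * q x) *
        conv (mollifier n) (w i) x) := fun i =>
      integrable_mul (hr n i).1 (memLp_conv (isTest_mollifier n) (hw i))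
    rw [← integral_finsetSum _ fun i _ => hi1 i, ← integral_finsetSum _ fun i _ => hi2 i]
    congr 1 with x
    have hz := sum_classicalPartial_mollify_eq_zero (isTest_mollifier n) hloc hdiv x
    have e2 : ∀ i, classicalPartial i (approx n (w i)) x =
        classicalPartial i (cutoff n) x * conv (mollifier n) (w i) x +
          cutoff n x * classicalPartial i (conv (mollifier n) (w i)) x := fun i =>
      classicalPartial_mul (isTest_cutoff n).differentiable ((hW n i).differentiable (by simp)) i x
    simp only [e2, add_mul, Finset.sum_add_distrib]
    have e3 : ∑ i, cutoff n x * classicalPartial i (conv (mollifier n) (w i)) x * q x = 0 := by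
      rw [← Finset.sum_mul, ← Finset.mul_sum, hz, mul_zero, zero_mul]
    rw [e3, add_zero]
    refine Finset.sum_congr rfl fun i _ => ?_
    ring
  have h2 : Tendsto (fun n => ∑ i, ∫ x, (classicalPartial i (cutoff n) x * q x) *
      conv (mollifier n) (w i) x) atTop (𝓝 0) := by
    rw [show (0 : ℝ) = ∑ _i : Fin 3, (0 : ℝ) by simp]
    refine tendsto_finsetSum _ fun i _ => ?_
    -- `∇χₙ` is supported in `|x| ≥ n + 1`, where the `L²` mass of the mollified field tends to
    -- zero. Together with the uniform bound on `q ∇χₙ` this annihilates the commutator.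
    have htail : TendstoL2 (fun n x => ({x : E3 | (n : ℝ) + 1 ≤ ‖x‖}.indicator 1 x : ℝ) *
        conv (mollifier n) (w i) x) (fun x => 0 * w i x) := by
      refine (tendstoL2_mollify (hw i)).bounded_mul
        (c := fun n => {x : E3 | (n : ℝ) + 1 ≤ ‖x‖}.indicator 1) (M := 1) (fun n => ?_)
        (fun n x => ?_) fun x => ?_
      · exact (measurable_one.indicator
          (measurableSet_le measurable_const measurable_norm)).aestronglyMeasurable
      · by_cases hx : (n : ℝ) + 1 ≤ ‖x‖ <;> simp [indicator, hx]
      · refine tendsto_const_nhds.congr' ?_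
        obtain ⟨N, hN⟩ := exists_nat_gt ‖x‖
        filter_upwards [eventually_ge_atTop N] with n hn
        have hn' : (N : ℝ) ≤ n := by exact_mod_cast hn
        rw [indicator_of_notMem]
        simp only [mem_ofPred_eq, not_le]
        linarith
    set K := (eLpNorm (classicalPartial i unitBump) 3 volume * eLpNorm q 6 volume).toReal
    have hK := htail.tendsto.const_mul K
    rw [mul_zero] at hK
    refine squeeze_zero_norm (fun n => ?_) hK
    have e : ∀ x, (classicalPartial i (cutoff n) x * q x) * conv (mollifier n) (w i) x =
        (classicalPartial i (cutoff n) x * q x) *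
          (({x : E3 | (n : ℝ) + 1 ≤ ‖x‖}.indicator 1 x : ℝ) * conv (mollifier n) (w i) x) := by
      intro x
      by_cases hx : (n : ℝ) + 1 ≤ ‖x‖
      · simp [indicator, hx]
      · simp [hsupp n i x (not_le.1 hx)]
    simp only [e]
    refine (abs_integral_mul_le (hr n i).1 (htail.memLp n)).trans ?_
    simp only [zero_mul, sub_zero]
    exact mul_le_mul_of_nonneg_right (hr n i).2 (l2Norm_nonneg _)
  simp only [hsplit] at h2
  have := tendsto_nhds_unique h1.neg h2
  linarith

end Pressure

/-! ### Product estimate for the convective term -/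

section Convection

open scoped ENNReal NNReal

/-- Hölder for `a · a · b · b` with exponents `6, 6, 6, 2`. Only one factor `b` is measured in `L⁶`;
for `b = ∂_i u_j` the second derivatives therefore enter only to the first power. -/
theorem eLpNorm_mul_sq_le {a b : E3 → ℝ} (ha : AEStronglyMeasurable a volume)
    (hb : AEStronglyMeasurable b volume) :
    eLpNorm (fun x => a x * b x) 2 volume ^ 2 ≤
      eLpNorm a 6 volume ^ 2 * eLpNorm b 6 volume * eLpNorm b 2 volume := by
  have t1 : ENNReal.HolderTriple 6 6 3 := ⟨by
    rw [← ENNReal.toReal_eq_toReal_iff' (by simp) (by simp),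
      ENNReal.toReal_add (by simp) (by simp)]
    simp; norm_num⟩
  have t2 : ENNReal.HolderTriple 6 3 2 := ⟨by
    rw [← ENNReal.toReal_eq_toReal_iff' (by simp) (by simp),
      ENNReal.toReal_add (by simp) (by simp)]
    simp; norm_num⟩
  have h1 : eLpNorm (fun x => a x * b x) 3 volume ≤ eLpNorm a 6 volume * eLpNorm b 6 volume :=
    eLpNorm_smul_le_mul_eLpNorm (𝕜 := ℝ) (E := ℝ) (φ := a) (f := b) (p := 6) (q := 6) (r := 3) hb ha
  have h2 : eLpNorm (fun x => a x * (a x * b x)) 2 volume ≤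
      eLpNorm a 6 volume * eLpNorm (fun x => a x * b x) 3 volume :=
    eLpNorm_smul_le_mul_eLpNorm (𝕜 := ℝ) (E := ℝ) (φ := a) (f := fun x => a x * b x)
      (p := 6) (q := 3) (r := 2) (ha.mul hb) ha
  have h3 : eLpNorm (fun x => a x * (a x * b x) * b x) 1 volume ≤
      eLpNorm (fun x => a x * (a x * b x)) 2 volume * eLpNorm b 2 volume :=
    eLpNorm_smul_le_mul_eLpNorm (𝕜 := ℝ) (E := ℝ) (φ := fun x => a x * (a x * b x)) (f := b)
      (p := 2) (q := 2) (r := 1) hb (ha.mul (ha.mul hb))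
  have e : eLpNorm (fun x => a x * b x) 2 volume ^ 2 =
      eLpNorm (fun x => a x * (a x * b x) * b x) 1 volume := by
    rw [eLpNorm_two_sq, eLpNorm_one_eq_lintegral_enorm]
    refine lintegral_congr fun x => ?_
    rw [← enorm_pow]
    congr 1
    ring
  rw [e]
  refine h3.trans (mul_le_mul_left (h2.trans ?_) _)
  rw [sq, mul_assoc]
  exact mul_le_mul_right h1 _

/-- The Gagliardo–Nirenberg estimate of a convective term. -/
theorem exists_l2Norm_mul_sq_le : ∃ C : ℝ, 0 ≤ C ∧ ∀ (a b : E3 → ℝ) (ga gb : Fin 3 → E3 → ℝ),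
    IsH1 a ga → IsH1 b gb → MemLp (fun x => a x * b x) 2 ∧
      l2Norm (fun x => a x * b x) ^ 2 ≤
        C * (∑ i, l2Norm (ga i)) ^ 2 * (∑ i, l2Norm (gb i)) * l2Norm b := by
  obtain ⟨C, hC⟩ := exists_eLpNorm_six_le
  refine ⟨(C : ℝ) ^ 3, by positivity, fun a b ga gb ha hb => ?_⟩
  have h := eLpNorm_mul_sq_le ha.memLp.1 hb.memLp.1
  have hle : eLpNorm (fun x => a x * b x) 2 volume ^ 2 ≤
      (C * ∑ i, eLpNorm (ga i) 2 volume) ^ 2 * (C * ∑ i, eLpNorm (gb i) 2 volume) *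
        eLpNorm b 2 volume := by
    refine h.trans ?_
    gcongr
    · exact hC a ga ha
    · exact hC b gb hb
  have hsum : ∀ {f : E3 → ℝ} {g : Fin 3 → E3 → ℝ}, IsH1 f g →
      ∑ i, eLpNorm (g i) 2 volume ≠ ⊤ := fun hf =>
    ENNReal.sum_ne_top.2 fun i _ => (hf.memLp_partial i).2.ne
  have hfin : (C * ∑ i, eLpNorm (ga i) 2 volume) ^ 2 * (C * ∑ i, eLpNorm (gb i) 2 volume) *
      eLpNorm b 2 volume ≠ ⊤ :=
    ENNReal.mul_ne_top (ENNReal.mul_ne_top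
      (ENNReal.pow_ne_top (ENNReal.mul_ne_top ENNReal.coe_ne_top (hsum ha)))
      (ENNReal.mul_ne_top ENNReal.coe_ne_top (hsum hb))) hb.memLp.2.ne
  refine ⟨⟨ha.memLp.1.mul hb.memLp.1, ?_⟩, ?_⟩
  · by_contra htop
    rw [not_lt_top_iff] at htop
    rw [htop] at hle
    exact hfin (top_le_iff.1 (by simpa using hle))
  · have := ENNReal.toReal_mono hfin hle
    simp only [ENNReal.toReal_mul, ENNReal.toReal_pow, ENNReal.coe_toReal,
      ENNReal.toReal_sum fun i _ => (ha.memLp_partial i).2.ne,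
      ENNReal.toReal_sum fun i _ => (hb.memLp_partial i).2.ne] at this
    refine this.trans (le_of_eq ?_)
    simp only [l2Norm]
    ring

end Convection

/-! ### Energy identity with a cutoff, at fixed time -/

section StaticEnergy

/-- Correcting by derivatives of total integral zero turns an integration by parts into a pointwise
identity. -/
theorem integral_eq_integral_sub_add {L S T : E3 → ℝ} (hL : Integrable L) (hS : Integrable S)
    (hT : Integrable T) (hS0 : ∫ x, S x = 0) (hT0 : ∫ x, T x = 0) :
    ∫ x, L x = ∫ x, (L x - S x + T x) := by
  have h1 : ∫ x, (L x - S x + T x) = (∫ x, (L x - S x)) + ∫ x, T x := integral_add (hL.sub hS) hT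
  rw [h1, integral_sub hL hS, hS0, hT0, sub_zero, add_zero]

/-- The integration by parts behind the energy balance of `Γ - y ∂ₓ V`, with a cutoff. -/
theorem integral_cutoff_energy {χ V Γ : E3 → ℝ} (hχ : IsTest χ) (hV : ContDiff ℝ ∞ V)
    (hΓ : ContDiff ℝ ∞ Γ) :
    ∫ x, (χ x * (V x * (Γ x - x 1 * classicalPartial 0 V x)) +
      ∑ i, χ x * (classicalPartial i V x *
        classicalPartial i (fun y => Γ y - y 1 * classicalPartial 0 V y) x)) =
    ∫ x, (χ x * (V x * Γ x) -
      ∑ i, (classicalPartial i χ x * (classicalPartial i V x * Γ x) +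
        χ x * (classicalPartial i (classicalPartial i V) x * Γ x)) -
      χ x * (classicalPartial 1 V x * classicalPartial 0 V x) +
      1 / 2 * (x 1 * classicalPartial 0 χ x * (V x * V x) +
        ∑ i, x 1 * classicalPartial 0 χ x * (classicalPartial i V x * classicalPartial i V x))) := by
  have hP : ∀ i, ContDiff ℝ ∞ (classicalPartial i V) := fun i => contDiff_classicalPartial hV i
  have hPP : ∀ i j, ContDiff ℝ ∞ (classicalPartial i (classicalPartial j V)) := fun i j =>
    contDiff_classicalPartial (hP j) i
  have hPχ : ∀ i, IsTest (classicalPartial i χ) := fun i => hχ.classicalPartial i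
  have hc := contDiff_coord 1
  have hF : ContDiff ℝ ∞ (fun y : E3 => Γ y - y 1 * classicalPartial 0 V y) :=
    hΓ.sub (hc.mul (hP 0))
  have dd : ∀ {f : E3 → ℝ}, ContDiff ℝ ∞ f → Differentiable ℝ f := fun h =>
    h.differentiable (by simp)
  set e : E3 → ℝ := fun x => V x * V x + ∑ i, classicalPartial i V x * classicalPartial i V x
    with he
  have hee : ContDiff ℝ ∞ e :=
    (hV.mul hV).add (ContDiff.sum fun i _ => (hP i).mul (hP i))
  -- The divergence of this field moves the derivative off `Γ`.
  have hΨ : ∀ i, IsTest (fun x => χ x * (classicalPartial i V x * Γ x)) := fun i =>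
    hχ.mul_contDiff ((hP i).mul hΓ)
  -- Half the `x`-derivative of this function moves the transport onto the cutoff; the weight `y` is
  -- independent of `x`.
  have hΘ : IsTest (fun x => χ x * (x 1 * e x)) := hχ.mul_contDiff (hc.mul hee)
  have hL : Integrable (fun x => χ x * (V x * (Γ x - x 1 * classicalPartial 0 V x)) +
      ∑ i, χ x * (classicalPartial i V x *
        classicalPartial i (fun y => Γ y - y 1 * classicalPartial 0 V y) x)) :=
    ((hχ.mul_contDiff (hV.mul hF)).add (IsTest.sum _ fun i _ => hχ.mul_contDiff
      ((hP i).mul (contDiff_classicalPartial hF i)))).integrable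
  have hS : Integrable (fun x => ∑ i, classicalPartial i
      (fun x => χ x * (classicalPartial i V x * Γ x)) x) :=
    (IsTest.sum _ fun i _ => (hΨ i).classicalPartial i).integrable
  have hT := ((hΘ.classicalPartial 0).integrable).const_mul (1 / 2)
  have hSz : ∫ x, ∑ i, classicalPartial i (fun x => χ x * (classicalPartial i V x * Γ x)) x = 0 := by
    rw [integral_finsetSum _ fun i _ => ((hΨ i).classicalPartial i).integrable]
    exact Finset.sum_eq_zero fun i _ => integral_classicalPartial_eq_zero (hΨ i) i
  have hTz : ∫ x, 1 / 2 * classicalPartial 0 (fun x => χ x * (x 1 * e x)) x = 0 := by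
    rw [integral_const_mul, integral_classicalPartial_eq_zero hΘ, mul_zero]
  rw [integral_eq_integral_sub_add hL hS hT hSz hTz]
  congr 1 with x
  -- Only `∂_y` hits the coefficient `y`; this is the origin of the term `∂_y V ∂ₓ V`.
  have d1 : ∀ i, classicalPartial i (fun y => Γ y - y 1 * classicalPartial 0 V y) x =
      classicalPartial i Γ x - ((if (1 : Fin 3) = i then 1 else 0) * classicalPartial 0 V x +
        x 1 * classicalPartial 0 (classicalPartial i V) x) := fun i => by
    rw [classicalPartial_sub (dd hΓ) (dd (hc.mul (hP 0))), classicalPartial_mul (dd hc) (dd (hP 0)),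
      classicalPartial_coord, classicalPartial_comm hV]
  have d2 : ∀ i, classicalPartial i (fun x => χ x * (classicalPartial i V x * Γ x)) x =
      classicalPartial i χ x * (classicalPartial i V x * Γ x) + χ x *
        (classicalPartial i (classicalPartial i V) x * Γ x +
          classicalPartial i V x * classicalPartial i Γ x) := fun i => by
    rw [classicalPartial_mul hχ.differentiable (dd ((hP i).mul hΓ)),
      classicalPartial_mul (dd (hP i)) (dd hΓ)]
  have d3 : classicalPartial 0 e x = 2 * (V x * classicalPartial 0 V x) +
      ∑ i, 2 * (classicalPartial i V x * classicalPartial 0 (classicalPartial i V) x) := by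
    rw [he, classicalPartial_add (dd (hV.mul hV))
      (dd (ContDiff.sum fun i _ => (hP i).mul (hP i))),
      classicalPartial_sum _ fun i _ => dd ((hP i).mul (hP i)), classicalPartial_mul (dd hV) (dd hV)]
    simp only [classicalPartial_mul (dd (hP _)) (dd (hP _))]
    congr 1
    · ring
    · exact Finset.sum_congr rfl fun i _ => by ring
  have d4 : classicalPartial 0 (fun x => χ x * (x 1 * e x)) x =
      classicalPartial 0 χ x * (x 1 * e x) + χ x * (x 1 * classicalPartial 0 e x) := by
    rw [classicalPartial_mul hχ.differentiable (dd (hc.mul hee)),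
      classicalPartial_mul (dd hc) (dd hee), classicalPartial_coord]
    simp
  rw [d4, d3]
  simp only [d1, d2, he, Fin.sum_univ_three]
  simp only [show (1 : Fin 3) ≠ 0 by decide, show (1 : Fin 3) ≠ 2 by decide, if_true, if_false]
  ring

end StaticEnergy

/-! ### The regularized energy rate: formula, limit and uniform bound -/

section RegularizedRate

/-- The rate of change of half the regularized `H¹` energy of a scalar `v` with `∂ₜ v = F`. -/
noncomputable def regRate (n : ℕ) (v F : E3 → ℝ) : ℝ :=
  (∫ x, cutoff n x * (conv (mollifier n) v x * conv (mollifier n) F x)) +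
    ∑ i, ∫ x, cutoff n x * (conv (classicalPartial i (mollifier n)) v x *
      conv (classicalPartial i (mollifier n)) F x)

/-- The mollification of `G`, corrected by the commutator with `y ∂ₓ`. -/
noncomputable def regForce (n : ℕ) (G g₀ : E3 → ℝ) : E3 → ℝ :=
  fun x => conv (mollifier n) G x + conv (mollifierMoment n 1) g₀ x

theorem locallyIntegrable_coord_mul {f : E3 → ℝ} (hf : LocallyIntegrable f) (j : Fin 3) :
    LocallyIntegrable (fun x => x j * f x) := by
  rw [← locallyIntegrableOn_univ] at hf ⊢
  exact hf.continuousOn_mul (contDiff_coord j).continuous.continuousOn isOpen_univ.isLocallyClosed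

variable {v G : E3 → ℝ} {g : Fin 3 → E3 → ℝ} {h : Fin 3 → Fin 3 → E3 → ℝ}

theorem conv_sub_coord_mul {k : E3 → ℝ} (hk : IsTest k) (hG : MemLp G 2) {f : E3 → ℝ}
    (hf : MemLp f 2) (j : Fin 3) (x : E3) : conv k (fun y => G y - y j * f y) x =
      conv k G x + conv (fun w => w j * k w) f x - x j * conv k f x := by
  have hl := locallyIntegrable_of_memLp hf
  rw [conv_sub hk (locallyIntegrable_of_memLp hG) (locallyIntegrable_coord_mul hl j),
    conv_coord_mul hk hl]
  ring

theorem contDiff_regForce (n : ℕ) (hG : MemLp G 2) {f : E3 → ℝ} (hf : MemLp f 2) :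
    ContDiff ℝ ∞ (regForce n G f) :=
  (contDiff_conv (isTest_mollifier n) (locallyIntegrable_of_memLp hG)).add
    (contDiff_conv (isTest_mollifierMoment n 1) (locallyIntegrable_of_memLp hf))

theorem tendstoL2_regForce (hG : MemLp G 2) {f : E3 → ℝ} (hf : MemLp f 2) :
    TendstoL2 (fun n => regForce n G f) G := by
  simpa using! (tendstoL2_mollify hG).add (tendstoL2_mollifierMoment hf 1)

theorem l2Norm_regForce_le (n : ℕ) (hG : MemLp G 2) {f : E3 → ℝ} (hf : MemLp f 2) :
    l2Norm (regForce n G f) ≤ l2Norm G + l2Norm f :=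
  (l2Norm_add_le (memLp_conv (isTest_mollifier n) hG)
    (memLp_conv (isTest_mollifierMoment n 1) hf)).trans
    (add_le_add (l2Norm_mollify_le hG n) (l2Norm_mollifierMoment_le hf n 1))

/-- Mollifying `G - y ∂ₓ v` gives `Γ - y ∂ₓ (ρ * v)` with `Γ` the corrected force, so
`integral_cutoff_energy` applies. On the right, `y` survives only next to `∂ₓχₙ`, and every term is
a product of two `L²` functions with a bounded multiplier. -/
theorem regRate_eq (hv : IsH1 v g) (hg : ∀ k, IsH1 (g k) (fun i => h i k)) (hG : MemLp G 2)
    (n : ℕ) :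
    regRate n v (fun x => G x - x 1 * g 0 x) =
      (∫ x, cutoff n x * (conv (mollifier n) v x * regForce n G (g 0) x)) -
      ∑ i, ((∫ x, classicalPartial i (cutoff n) x *
          (conv (mollifier n) (g i) x * regForce n G (g 0) x)) +
        ∫ x, cutoff n x * (conv (mollifier n) (h i i) x * regForce n G (g 0) x)) -
      (∫ x, cutoff n x * (conv (mollifier n) (g 1) x * conv (mollifier n) (g 0) x)) +
      1 / 2 * ((∫ x, x 1 * classicalPartial 0 (cutoff n) x *
          (conv (mollifier n) v x * conv (mollifier n) v x)) +
        ∑ i, ∫ x, x 1 * classicalPartial 0 (cutoff n) x *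
          (conv (mollifier n) (g i) x * conv (mollifier n) (g i) x)) := by
  have hρ := isTest_mollifier n
  have hχ := isTest_cutoff n
  set ρ := mollifier n with hρdef
  set V := conv ρ v
  set Γ := regForce n G (g 0) with hΓdef
  have hV : ContDiff ℝ ∞ V := contDiff_conv hρ (hv.weak 0).1
  have hΓ : ContDiff ℝ ∞ Γ := contDiff_regForce n hG (hv.memLp_partial 0)
  have p1 : ∀ i, classicalPartial i V = conv ρ (g i) := fun i =>
    classicalPartial_mollify hρ (hv.weak i)
  have p2 : ∀ i, classicalPartial i (conv ρ (g i)) = conv ρ (h i i) := fun i =>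
    classicalPartial_mollify hρ ((hg i).weak i)
  have hF : conv ρ (fun x => G x - x 1 * g 0 x) = fun y => Γ y - y 1 * conv ρ (g 0) y := by
    ext x
    exact conv_sub_coord_mul hρ hG (hv.memLp_partial 0) 1 x
  have hloc : LocallyIntegrable (fun x => G x - x 1 * g 0 x) :=
    (locallyIntegrable_of_memLp hG).sub (locallyIntegrable_coord_mul (hv.weak 0).2.1 1)
  have hcg : ∀ i, ContDiff ℝ ∞ (conv ρ (g i)) := fun i => contDiff_conv hρ (hg i |>.weak 0).1
  have hch : ∀ i, ContDiff ℝ ∞ (conv ρ (h i i)) := fun i => contDiff_conv hρ ((hg i).weak i).2.1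
  have hcΦ : ContDiff ℝ ∞ (fun y : E3 => Γ y - y 1 * conv ρ (g 0) y) :=
    hΓ.sub ((contDiff_coord 1).mul (hcg 0))
  have main := integral_cutoff_energy hχ hV hΓ
  simp only [p1, p2] at main
  have ht : ∀ {c A B : E3 → ℝ}, IsTest c → ContDiff ℝ ∞ A → ContDiff ℝ ∞ B →
      Integrable (fun x => c x * (A x * B x)) := fun hc hA hB =>
    (hc.mul_contDiff (hA.mul hB)).integrable
  have hχ1 : IsTest (fun x => x 1 * classicalPartial 0 (cutoff n) x) := by
    simpa only [mul_comm] using (hχ.classicalPartial 0).mul_contDiff (contDiff_coord 1)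
  have i1 := ht hχ hV hΓ
  have i2 : ∀ i, Integrable (fun x => classicalPartial i (cutoff n) x * (conv ρ (g i) x * Γ x)) :=
    fun i => ht (hχ.classicalPartial i) (hcg i) hΓ
  have i3 : ∀ i, Integrable (fun x => cutoff n x * (conv ρ (h i i) x * Γ x)) :=
    fun i => ht hχ (hch i) hΓ
  have i4 := ht hχ (hcg 1) (hcg 0)
  have i5 := ht hχ1 hV hV
  have i6 : ∀ i, Integrable (fun x => x 1 * classicalPartial 0 (cutoff n) x *
      (conv ρ (g i) x * conv ρ (g i) x)) := fun i => ht hχ1 (hcg i) (hcg i)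
  have i23 : Integrable (fun x => ∑ i, (classicalPartial i (cutoff n) x * (conv ρ (g i) x * Γ x) +
      cutoff n x * (conv ρ (h i i) x * Γ x))) := integrable_finsetSum _ fun i _ => (i2 i).add (i3 i)
  have i56 : Integrable (fun x => 1 / 2 * (x 1 * classicalPartial 0 (cutoff n) x * (V x * V x) +
      ∑ i, x 1 * classicalPartial 0 (cutoff n) x * (conv ρ (g i) x * conv ρ (g i) x))) :=
    (i5.add (integrable_finsetSum _ fun i _ => i6 i)).const_mul _
  have i23' : ∀ i, Integrable (fun x => classicalPartial i (cutoff n) x * (conv ρ (g i) x * Γ x) +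
      cutoff n x * (conv ρ (h i i) x * Γ x)) := fun i => (i2 i).add (i3 i)
  have ia : Integrable (fun x => cutoff n x * (V x * Γ x) -
      ∑ i, (classicalPartial i (cutoff n) x * (conv ρ (g i) x * Γ x) +
      cutoff n x * (conv ρ (h i i) x * Γ x))) := i1.sub i23
  have ib : Integrable (fun x => cutoff n x * (V x * Γ x) -
      ∑ i, (classicalPartial i (cutoff n) x * (conv ρ (g i) x * Γ x) +
      cutoff n x * (conv ρ (h i i) x * Γ x)) -
      cutoff n x * (conv ρ (g 1) x * conv ρ (g 0) x)) := ia.sub i4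
  rw [integral_add ib i56, integral_sub ia i4, integral_sub i1 i23, integral_const_mul,
    integral_add i5 (integrable_finsetSum _ fun i _ => i6 i), integral_finsetSum _ fun i _ => i6 i,
    integral_finsetSum _ fun i _ => i23' i] at main
  simp only [integral_add (i2 _) (i3 _)] at main
  rw [← main, integral_add (ht hχ hV hcΦ) (integrable_finsetSum _ fun i _ =>
    ht hχ (hcg i) (contDiff_classicalPartial hcΦ i)), integral_finsetSum _ fun i _ =>
    ht hχ (hcg i) (contDiff_classicalPartial hcΦ i)]
  unfold regRate
  simp only [← hρdef, ← classicalPartial_conv hρ hloc, hF, ← classicalPartial_conv hρ (hv.weak 0).1]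
  simp only [V] at p1 ⊢
  simp only [p1]

/-- The limit of the regularized rates. -/
theorem tendsto_regRate (hv : IsH1 v g) (hg : ∀ k, IsH1 (g k) (fun i => h i k)) (hG : MemLp G 2) :
    Tendsto (fun n => regRate n v (fun x => G x - x 1 * g 0 x)) atTop
      (𝓝 ((∫ x, v x * G x) - (∑ i, ∫ x, h i i x * G x) - ∫ x, g 1 x * g 0 x)) := by
  simp only [regRate_eq hv hg hG]
  obtain ⟨M, hM⟩ := exists_abs_classicalPartial_cutoff_le
  obtain ⟨M', hM'⟩ := exists_abs_coord_mul_classicalPartial_cutoff_le 0 1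
  have hh : ∀ i k, MemLp (h i k) 2 := fun i k => (hg k).memLp_partial i
  have t1 : ∀ {A B : ℕ → E3 → ℝ} {a b : E3 → ℝ}, TendstoL2 A a → TendstoL2 B b →
      Tendsto (fun n => ∫ x, cutoff n x * (A n x * B n x)) atTop (𝓝 (∫ x, a x * b x)) :=
    fun hA hB => by
      simpa using hA.tendsto_integral_mul_mul hB (c := cutoff)
        (fun n => (isTest_cutoff n).continuous.aestronglyMeasurable) abs_cutoff_le_one
        tendsto_cutoff
  have t2 : ∀ {A B : ℕ → E3 → ℝ} {a b : E3 → ℝ} (i : Fin 3), TendstoL2 A a → TendstoL2 B b →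
      Tendsto (fun n => ∫ x, classicalPartial i (cutoff n) x * (A n x * B n x)) atTop (𝓝 0) :=
    fun i hA hB => by
      simpa using hA.tendsto_integral_mul_mul hB (c := fun n => classicalPartial i (cutoff n))
        (fun n => ((isTest_cutoff n).classicalPartial i).continuous.aestronglyMeasurable)
        (hM i) (tendsto_classicalPartial_cutoff i)
  have t3 : ∀ {A B : ℕ → E3 → ℝ} {a b : E3 → ℝ}, TendstoL2 A a → TendstoL2 B b →
      Tendsto (fun n => ∫ x, x 1 * classicalPartial 0 (cutoff n) x * (A n x * B n x)) atTop
        (𝓝 0) := fun hA hB => by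
      simpa using hA.tendsto_integral_mul_mul hB
        (c := fun n x => x 1 * classicalPartial 0 (cutoff n) x) (c₀ := 0)
        (fun n => ((contDiff_coord 1).continuous.mul
          ((isTest_cutoff n).classicalPartial 0).continuous).aestronglyMeasurable)
        hM' (fun x => by simpa using (tendsto_classicalPartial_cutoff 0 x).const_mul (x 1))
  have lv := tendstoL2_mollify hv.memLp
  have lg := fun i => tendstoL2_mollify (hv.memLp_partial i)
  have lh := fun i => tendstoL2_mollify (hh i i)
  have lΓ := tendstoL2_regForce hG (hv.memLp_partial 0)
  have := (((t1 lv lΓ).sub (tendsto_finsetSum Finset.univ fun i _ =>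
    (t2 i (lg i) lΓ).add (t1 (lh i) lΓ))).sub (t1 (lg 1) (lg 0))).add
    (((t3 lv lv).add (tendsto_finsetSum Finset.univ fun i _ => t3 (lg i) (lg i))).const_mul (1 / 2))
  simpa using this

/-- The norms that control the rate of change of the energy. -/
noncomputable def sizeH2 (v G : E3 → ℝ) (g : Fin 3 → E3 → ℝ) (h : Fin 3 → Fin 3 → E3 → ℝ) : ℝ :=
  l2Norm v + ∑ i, l2Norm (g i) + ∑ i, l2Norm (h i i) + l2Norm G

/-- Uniformity in `n` provides the majorant for dominated convergence in time. -/
theorem exists_abs_regRate_le : ∃ M : ℝ, 0 ≤ M ∧ ∀ (v G : E3 → ℝ) (g : Fin 3 → E3 → ℝ)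
    (h : Fin 3 → Fin 3 → E3 → ℝ), IsH1 v g → (∀ k, IsH1 (g k) (fun i => h i k)) → MemLp G 2 →
    ∀ n, |regRate n v (fun x => G x - x 1 * g 0 x)| ≤ M * sizeH2 v G g h ^ 2 := by
  obtain ⟨M, hM⟩ := exists_abs_classicalPartial_cutoff_le
  obtain ⟨M', hM'⟩ := exists_abs_coord_mul_classicalPartial_cutoff_le 0 1
  have hM0 : 0 ≤ M := (abs_nonneg _).trans (hM 0 0 0)
  have hM0' : 0 ≤ M' := (abs_nonneg _).trans (hM' 0 0)
  -- One summand for each group of terms of `regRate_eq`: force, three pairs with gradient and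
  -- Laplacian, shear, and transport of the cutoff.
  refine ⟨1 + 3 * (M + 1) + 1 + 1 / 2 * (M' + 3 * M'), by positivity,
    fun v G g h hv hg hG n => ?_⟩
  rw [regRate_eq hv hg hG]
  set S := sizeH2 v G g h with hS
  have hh : ∀ i k, MemLp (h i k) 2 := fun i k => (hg k).memLp_partial i
  have bnd : ∀ {c A B : E3 → ℝ} {K : ℝ}, (∀ x, |c x| ≤ K) → MemLp A 2 → MemLp B 2 → l2Norm A ≤ S →
      l2Norm B ≤ S → |∫ x, c x * (A x * B x)| ≤ K * S ^ 2 := fun {c A B K} hc hA hB hAS hBS => by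
    refine (abs_integral_mul_mul_le hc hA hB).trans ?_
    have hK : 0 ≤ K := (abs_nonneg _).trans (hc 0)
    have := mul_le_mul hAS hBS (l2Norm_nonneg B) ((l2Norm_nonneg A).trans hAS)
    rw [sq]
    exact mul_le_mul_of_nonneg_left this hK
  have nn := fun f => l2Norm_nonneg f
  have sv : l2Norm v ≤ S ∧ (∀ i, l2Norm (g i) ≤ S) ∧ (∀ i, l2Norm (h i i) ≤ S) ∧
      l2Norm G + l2Norm (g 0) ≤ S := by
    have h1 : ∀ i, l2Norm (g i) ≤ ∑ i, l2Norm (g i) := fun i =>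
      Finset.single_le_sum (f := fun i => l2Norm (g i)) (fun i _ => nn _) (Finset.mem_univ i)
    have h2 : ∀ i, l2Norm (h i i) ≤ ∑ i, l2Norm (h i i) := fun i =>
      Finset.single_le_sum (f := fun i => l2Norm (h i i)) (fun i _ => nn _) (Finset.mem_univ i)
    have n1 : 0 ≤ ∑ i, l2Norm (g i) := (nn _).trans (h1 0)
    have n2 : 0 ≤ ∑ i, l2Norm (h i i) := (nn _).trans (h2 0)
    have n3 := nn v
    have n4 := nn G
    refine ⟨?_, fun i => ?_, fun i => ?_, ?_⟩
    · rw [hS, sizeH2]; linarith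
    · have := h1 i; rw [hS, sizeH2]; linarith
    · have := h2 i; rw [hS, sizeH2]; linarith
    · have := h1 0; rw [hS, sizeH2]; linarith
  obtain ⟨sv, sg, sh, sG⟩ := sv
  have hρ := isTest_mollifier n
  have mv := memLp_conv hρ hv.memLp
  have mg := fun i => memLp_conv hρ (hv.memLp_partial i)
  have mh := fun i => memLp_conv hρ (hh i i)
  have mΓ := (tendstoL2_regForce hG (hv.memLp_partial 0)).memLp n
  have bv := (l2Norm_mollify_le hv.memLp n).trans sv
  have bg := fun i => (l2Norm_mollify_le (hv.memLp_partial i) n).trans (sg i)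
  have bh := fun i => (l2Norm_mollify_le (hh i i) n).trans (sh i)
  have bΓ := (l2Norm_regForce_le n hG (hv.memLp_partial 0)).trans sG
  have c1 := abs_cutoff_le_one n
  have e1 := bnd c1 mv mΓ bv bΓ
  have e2 := fun i => bnd (hM i n) (mg i) mΓ (bg i) bΓ
  have e3 := fun i => bnd c1 (mh i) mΓ (bh i) bΓ
  have e4 := bnd c1 (mg 1) (mg 0) (bg 1) (bg 0)
  have e5 := bnd (hM' n) mv mv bv bv
  have e6 := fun i => bnd (hM' n) (mg i) (mg i) (bg i) (bg i)
  simp only [Fin.sum_univ_three]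
  have a2 := e2 0; have a2' := e2 1; have a2'' := e2 2
  have a3 := e3 0; have a3' := e3 1; have a3'' := e3 2
  have a6 := e6 0; have a6' := e6 1; have a6'' := e6 2
  rw [abs_le] at *
  constructor <;> linarith [e1.1, e1.2, a2.1, a2.2, a2'.1, a2'.2, a2''.1, a2''.2, a3.1, a3.2, a3'.1,
    a3'.2, a3''.1, a3''.2, e4.1, e4.2, e5.1, e5.2, a6.1, a6.2, a6'.1, a6'.2, a6''.1, a6''.2]

end RegularizedRate

/-! ### Differentiation of squares in time and Fubini -/

section TimeDependence

/-- A Carathéodory function is jointly measurable, up to a null set. -/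
theorem aestronglyMeasurable_uncurry_of_continuous {μ : Measure ℝ} [SFinite μ] {b : ℝ → E3 → ℝ}
    (hx : ∀ x, AEStronglyMeasurable (fun s => b s x) μ) (hs : ∀ᵐ s ∂μ, Continuous (b s)) :
    AEStronglyMeasurable (Function.uncurry b) (μ.prod volume) := by
  classical
  let d : ℕ → E3 := TopologicalSpace.denseSeq E3
  have hgood : ∀ᵐ s ∂μ, Continuous (b s) ∧ ∀ n, b s (d n) = (hx (d n)).mk _ s :=
    hs.and (ae_all_iff.2 fun n => (hx (d n)).ae_eq_mk)
  rw [ae_iff] at hgood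
  -- Off this measurable null set `b s` is continuous and agrees with measurable versions on a dense
  -- sequence. Setting `b` to zero on it yields a genuine Carathéodory function.
  set N := toMeasurable μ {s | ¬(Continuous (b s) ∧ ∀ n, b s (d n) = (hx (d n)).mk _ s)} with hN
  have hN0 : μ N = 0 := by rw [hN, measure_toMeasurable]; exact hgood
  have hNm : MeasurableSet N := measurableSet_toMeasurable _ _
  have hgood' : ∀ s, s ∉ N → Continuous (b s) ∧ ∀ n, b s (d n) = (hx (d n)).mk _ s := by
    intro s hs
    by_contra hc
    exact hs (subset_toMeasurable _ _ hc)
  let b' : E3 → ℝ → ℝ := fun x s => if s ∈ N then 0 else b s x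
  have hcont : ∀ s, Continuous fun x => b' x s := fun s => by
    by_cases h : s ∈ N
    · simp [b', h, continuous_const]
    · simpa [b', h] using (hgood' s h).1
  have hmd : ∀ n, Measurable (b' (d n)) := fun n => by
    have : b' (d n) = fun s => if s ∈ N then 0 else (hx (d n)).mk _ s := by
      ext s
      by_cases h : s ∈ N
      · simp [b', h]
      · simp [b', h, (hgood' s h).2 n]
    rw [this]
    exact Measurable.ite hNm measurable_const (hx (d n)).stronglyMeasurable_mk.measurable
  have hm : ∀ x, Measurable (b' x) := fun x => by
    have hcl : x ∈ closure (range d) := TopologicalSpace.denseRange_denseSeq E3 x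
    obtain ⟨y, hy, hyx⟩ := mem_closure_iff_seq_limit.1 hcl
    refine measurable_of_tendsto_metrizable (f := fun n => b' (y n)) (fun n => ?_)
      (tendsto_pi_nhds.2 fun s => ((hcont s).tendsto x).comp hyx)
    obtain ⟨m, hm⟩ := hy n
    rw [← hm]
    exact hmd m
  have hjoint := (measurable_uncurry_of_continuous_of_measurable hcont hm).comp measurable_swap
    (α := ℝ × E3)
  refine ⟨_, hjoint.stronglyMeasurable, ?_⟩
  have hae : ∀ᵐ s ∂μ, s ∉ N := measure_eq_zero_iff_ae_notMem.1 hN0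
  filter_upwards [Measure.quasiMeasurePreserving_fst.ae hae] with p hp
  simp [b', hp, Function.uncurry]

/-- The function `b` is merely integrable, so the product rule is applied to its absolutely
continuous primitive `A`, whose derivative is `b` almost everywhere. The constant `a 0` is handled
separately. -/
theorem sq_sub_sq_eq_integral {a b : ℝ → ℝ} {t : ℝ} (ht : 0 ≤ t)
    (hb : IntervalIntegrable b volume 0 t)
    (ha : ∀ s ∈ Icc 0 t, a s = a 0 + ∫ r in (0 : ℝ)..s, b r) :
    a t ^ 2 - a 0 ^ 2 = ∫ s in (0 : ℝ)..t, 2 * (a s * b s) := by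
  set A : ℝ → ℝ := fun s => ∫ r in (0 : ℝ)..s, b r with hA
  have hAC : AbsolutelyContinuousOnInterval A 0 t :=
    hb.absolutelyContinuousOnInterval_intervalIntegral (c := 0) (by simp)
  have h1 := hAC.integral_deriv_mul_eq_sub hAC
  have h2 : ∫ s in (0 : ℝ)..t, (deriv A s * A s + A s * deriv A s) =
      ∫ s in (0 : ℝ)..t, 2 * (A s * b s) := by
    refine intervalIntegral.integral_congr_ae ?_
    filter_upwards [hb.ae_hasDerivAt_integral] with s hs hst
    rw [(hs (uIoc_subset_uIcc hst) 0 (by simp)).deriv]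
    ring
  have hA0 : A 0 = 0 := by simp [hA]
  rw [h2, hA0] at h1
  have h3 : ∫ s in (0 : ℝ)..t, 2 * (a s * b s) =
      ∫ s in (0 : ℝ)..t, (2 * a 0 * b s + 2 * (A s * b s)) := by
    refine intervalIntegral.integral_congr fun s hs => ?_
    rw [uIcc_of_le ht] at hs
    simp only [ha s hs]
    ring
  have hi : IntervalIntegrable (fun s => 2 * (A s * b s)) volume 0 t :=
    (hb.continuousOn_mul hAC.continuousOn).const_mul 2
  rw [h3, intervalIntegral.integral_add (hb.const_mul _) hi, h1,
    intervalIntegral.integral_const_mul, ha t ⟨ht, le_rfl⟩]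
  simp only [hA]
  ring

/-- The pointwise energy balance, integrated in space against a cutoff. -/
theorem integral_cutoff_sq_sub_sq {χ : E3 → ℝ} (hχ : IsTest χ) {a b : ℝ → E3 → ℝ} {t : ℝ}
    (ht : 0 ≤ t) {B : ℝ → ℝ} (hBi : IntegrableOn B (Icc 0 t))
    (hb : ∀ x, IntervalIntegrable (fun s => b s x) volume 0 t)
    (hab : ∀ x, ∀ s ∈ Icc 0 t, a s x = a 0 x + ∫ r in (0 : ℝ)..s, b r x)
    (hac : ∀ s ∈ Icc 0 t, Continuous (a s))
    (hbc : ∀ᵐ s ∂(volume.restrict (Icc 0 t)), Continuous (b s))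
    (hbB : ∀ᵐ s ∂(volume.restrict (Icc 0 t)), ∀ x ∈ tsupport χ, |b s x| ≤ B s) :
    IntegrableOn (fun s => ∫ x, χ x * (a s x * b s x)) (Icc 0 t) ∧
    (∫ x, χ x * a t x ^ 2) - ∫ x, χ x * a 0 x ^ 2 =
      ∫ s in (0 : ℝ)..t, 2 * ∫ x, χ x * (a s x * b s x) := by
  have h0 : (0 : ℝ) ∈ Icc 0 t := ⟨le_rfl, ht⟩
  have htt : t ∈ Icc 0 t := ⟨ht, le_rfl⟩
  set μ : Measure ℝ := volume.restrict (Icc 0 t) with hμ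
  have hbI : ∀ x, IntegrableOn (fun s => b s x) (Icc 0 t) := fun x =>
    (intervalIntegrable_iff_integrableOn_Icc_of_le ht).1 (hb x)
  have hacx : ∀ x, ContinuousOn (fun s => a s x) (Icc 0 t) := fun x => by
    have hAC := (hb x).absolutelyContinuousOnInterval_intervalIntegral (c := 0) (by simp)
    have h1 := (continuousOn_const (c := a 0 x)).add hAC.continuousOn
    rw [uIcc_of_le ht] at h1
    exact h1.congr fun s hs => hab x s hs
  have hbm : AEStronglyMeasurable (Function.uncurry b) (μ.prod volume) :=
    aestronglyMeasurable_uncurry_of_continuous (fun x => (hbI x).1) hbc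
  have ham : AEStronglyMeasurable (Function.uncurry a) (μ.prod volume) :=
    aestronglyMeasurable_uncurry_of_continuous
      (fun x => (hacx x).aestronglyMeasurable measurableSet_Icc)
      ((ae_restrict_iff' measurableSet_Icc).2 (Eventually.of_forall hac))
  obtain ⟨A₀, hA₀⟩ := (IsCompact.exists_bound_of_continuousOn (f := a 0) hχ.2
    (hac 0 h0).continuousOn)
  -- Initial maximum plus total variation bound: `A` dominates `|a|` on the support of `χ` at all
  -- times, and `|B(s)| |χ(x)| A` is the majorant for Fubini.
  set A : ℝ := A₀ + ∫ s in Icc 0 t, |B s| with hAdef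
  have haA : ∀ x ∈ tsupport χ, ∀ s ∈ Icc 0 t, |a s x| ≤ A := by
    intro x hx s hs
    rw [hab x s hs]
    refine (abs_add_le _ _).trans (add_le_add (hA₀ x hx) ?_)
    rw [intervalIntegral.integral_of_le hs.1]
    refine (norm_integral_le_integral_norm (fun r => b r x)).trans ?_
    have hsub : Ioc 0 s ⊆ Icc 0 t := fun r hr => ⟨hr.1.le, hr.2.trans hs.2⟩
    refine (setIntegral_mono_set (hbI x).norm
      (Eventually.of_forall fun _ => norm_nonneg _) hsub.eventuallyLE).trans ?_
    refine integral_mono_ae (hbI x).norm hBi.abs ?_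
    filter_upwards [hbB] with r hr
    exact (hr x hx).trans (le_abs_self _)
  have hint : Integrable (Function.uncurry fun s x => χ x * (a s x * b s x)) (μ.prod volume) := by
    have hdom : Integrable (fun p : ℝ × E3 => |B p.1| * (|χ p.2| * A)) (μ.prod volume) :=
      (Integrable.abs hBi).mul_prod (hχ.integrable.abs.mul_const A)
    refine hdom.mono' ((hχ.continuous.comp continuous_snd).aestronglyMeasurable.mul (ham.mul hbm)) ?_
    have h1 : ∀ᵐ s ∂μ, s ∈ Icc 0 t := ae_restrict_mem measurableSet_Icc
    filter_upwards [Measure.quasiMeasurePreserving_fst.ae (hbB.and h1)] with p hp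
    obtain ⟨s, x⟩ := p
    simp only [Function.uncurry_apply_pair, norm_mul, Real.norm_eq_abs] at hp ⊢
    by_cases hx : x ∈ tsupport χ
    · have e1 := haA x hx s hp.2
      have e2 := (hp.1 x hx).trans (le_abs_self _)
      have := mul_le_mul e1 e2 (abs_nonneg _) ((abs_nonneg _).trans e1)
      calc |χ x| * (|a s x| * |b s x|) ≤ |χ x| * (A * |B s|) :=
            mul_le_mul_of_nonneg_left this (abs_nonneg _)
        _ = _ := by ring
    · rw [image_eq_zero_of_notMem_tsupport hx]
      simp
  refine ⟨hint.integral_prod_left, ?_⟩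
  have hχa : ∀ s ∈ Icc 0 t, Integrable (fun x => χ x * a s x ^ 2) := fun s hs =>
    (hχ.continuous.mul ((hac s hs).pow 2)).integrable_of_hasCompactSupport hχ.2.mul_right
  rw [← integral_sub (hχa t htt) (hχa 0 h0), intervalIntegral.integral_of_le ht,
    ← integral_Icc_eq_integral_Ioc, integral_const_mul]
  have hswap := integral_integral_swap (f := fun s x => χ x * (a s x * b s x)) hint
  rw [← hμ, hswap, ← integral_const_mul]
  congr 1 with x
  rw [← mul_sub, sq_sub_sq_eq_integral (a := fun s => a s x) ht (hb x) (hab x),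
    intervalIntegral.integral_of_le ht, ← integral_Icc_eq_integral_Ioc, integral_const_mul,
    integral_const_mul]
  ring

end TimeDependence

/-! ### Energy balance for `∂ₜv + y ∂ₓv = G` -/

section ScalarEnergy

/-- Once `y` is commuted out of the convolution, it is bounded on the compact support of `χ`; each
remaining convolution is bounded pointwise by Cauchy–Schwarz. -/
theorem exists_abs_conv_transport_le {k χ : E3 → ℝ} (hk : IsTest k) (hχ : IsTest χ) :
    ∃ K : ℝ, ∀ (G f : E3 → ℝ), MemLp G 2 → MemLp f 2 → ∀ x ∈ tsupport χ,
      |conv k (fun y => G y - y 1 * f y) x| ≤ K * (l2Norm G + l2Norm f) := by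
  obtain ⟨R, hR⟩ := IsCompact.exists_bound_of_continuousOn (f := fun x : E3 => x 1) hχ.2
    (contDiff_coord 1).continuous.continuousOn
  have hκ : IsTest (fun w : E3 => w 1 * k w) := by
    simpa only [mul_comm] using hk.mul_contDiff (contDiff_coord 1)
  refine ⟨l2Norm k + l2Norm (fun w : E3 => w 1 * k w) + |R| * l2Norm k,
    fun G f hG hf x hx => ?_⟩
  rw [conv_sub_coord_mul hk hG hf]
  have h1 := abs_conv_le hk hG x
  have h2 := abs_conv_le hκ hf x
  have h3 := abs_conv_le hk hf x
  have h4 : |x 1 * conv k f x| ≤ |R| * (l2Norm k * l2Norm f) := by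
    rw [abs_mul]
    exact mul_le_mul ((hR x hx).trans (le_abs_self R)) h3 (abs_nonneg _) (abs_nonneg _)
  have n1 := l2Norm_nonneg k
  have n2 := l2Norm_nonneg (fun w : E3 => w 1 * k w)
  have n3 := l2Norm_nonneg G
  have n4 := l2Norm_nonneg f
  have n5 := abs_nonneg R
  calc |conv k G x + conv (fun w => w 1 * k w) f x - x 1 * conv k f x|
      ≤ |conv k G x| + |conv (fun w => w 1 * k w) f x| + |x 1 * conv k f x| :=
        (abs_sub _ _).trans (add_le_add (abs_add_le _ _) le_rfl)
    _ ≤ l2Norm k * l2Norm G + l2Norm (fun w : E3 => w 1 * k w) * l2Norm f +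
        |R| * (l2Norm k * l2Norm f) := by linarith
    _ ≤ _ := by
        have e1 := mul_nonneg n1 n4
        have e2 := mul_nonneg n2 n3
        have e3 := mul_nonneg n5 (mul_nonneg n1 n3)
        nlinarith

/-- The regularized energy of a scalar. -/
noncomputable def regEnergy (n : ℕ) (v : E3 → ℝ) : ℝ :=
  (∫ x, cutoff n x * conv (mollifier n) v x ^ 2) +
    ∑ i, ∫ x, cutoff n x * conv (classicalPartial i (mollifier n)) v x ^ 2

theorem tendsto_regEnergy {v : E3 → ℝ} {g : Fin 3 → E3 → ℝ} (hv : IsH1 v g) :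
    Tendsto (fun n => regEnergy n v) atTop (𝓝 (l2Norm v ^ 2 + ∑ i, l2Norm (g i) ^ 2)) := by
  have t : ∀ {A : ℕ → E3 → ℝ} {a : E3 → ℝ}, TendstoL2 A a →
      Tendsto (fun n => ∫ x, cutoff n x * A n x ^ 2) atTop (𝓝 (l2Norm a ^ 2)) := fun hA => by
    simpa only [sq, l2Norm_sq hA.memLp_lim, one_mul] using
      hA.tendsto_integral_mul_mul hA (c := cutoff)
        (fun n => (isTest_cutoff n).continuous.aestronglyMeasurable) abs_cutoff_le_one
        tendsto_cutoff
  unfold regEnergy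
  simp only [conv_classicalPartial (isTest_mollifier _) (hv.weak _)]
  exact (t (tendstoL2_mollify hv.memLp)).add
    (tendsto_finsetSum _ fun i _ => t (tendstoL2_mollify (hv.memLp_partial i)))

theorem l2Norm_le_one_add_sizeH2_sq (v G : E3 → ℝ) (g : Fin 3 → E3 → ℝ)
    (h : Fin 3 → Fin 3 → E3 → ℝ) : l2Norm G + l2Norm (g 0) ≤ 1 + sizeH2 v G g h ^ 2 := by
  have h1 : l2Norm G + l2Norm (g 0) ≤ sizeH2 v G g h := by
    have h1 : l2Norm (g 0) ≤ ∑ i, l2Norm (g i) :=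
      Finset.single_le_sum (f := fun i => l2Norm (g i)) (fun i _ => l2Norm_nonneg _)
        (Finset.mem_univ 0)
    have h2 : 0 ≤ ∑ i, l2Norm (h i i) := Finset.sum_nonneg fun i _ => l2Norm_nonneg _
    have := l2Norm_nonneg v
    unfold sizeH2
    linarith
  nlinarith [sq_nonneg (sizeH2 v G g h - 1)]

variable {t : ℝ} {v G : ℝ → E3 → ℝ} {g : ℝ → Fin 3 → E3 → ℝ} {h : ℝ → Fin 3 → Fin 3 → E3 → ℝ}
  {m : ℝ → ℝ}

/-- The energy balance of the regularizations of a solution of `∂ₜ v + y ∂ₓ v = G`. -/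
theorem regEnergy_sub_regEnergy (ht : 0 ≤ t) (hv : ∀ s ∈ Icc 0 t, IsH1 (v s) (g s))
    (hae : ∀ᵐ s ∂(volume.restrict (Icc 0 t)), MemLp (G s) 2 ∧
      sizeH2 (v s) (G s) (g s) (h s) ^ 2 ≤ m s)
    (hm : IntegrableOn m (Icc 0 t))
    (hint : ∀ φ, IsTest φ → IntervalIntegrable
      (fun s => ∫ x, φ x * (G s x - x 1 * g s 0 x)) volume 0 t)
    (hmom : ∀ φ, IsTest φ → ∀ s ∈ Icc 0 t, (∫ x, φ x * v s x) - ∫ x, φ x * v 0 x =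
      ∫ r in (0 : ℝ)..s, ∫ x, φ x * (G r x - x 1 * g r 0 x)) (n : ℕ) :
    IntegrableOn (fun s => regRate n (v s) (fun x => G s x - x 1 * g s 0 x)) (Icc 0 t) ∧
    regEnergy n (v t) - regEnergy n (v 0) =
      ∫ s in (0 : ℝ)..t, 2 * regRate n (v s) (fun x => G s x - x 1 * g s 0 x) := by
  have key : ∀ k, IsTest k → IntegrableOn (fun s => ∫ x, cutoff n x * (conv k (v s) x *
        conv k (fun x => G s x - x 1 * g s 0 x) x)) (Icc 0 t) ∧
      (∫ x, cutoff n x * conv k (v t) x ^ 2) - ∫ x, cutoff n x * conv k (v 0) x ^ 2 =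
      ∫ s in (0 : ℝ)..t, 2 * ∫ x, cutoff n x * (conv k (v s) x *
        conv k (fun x => G s x - x 1 * g s 0 x) x) := by
    intro k hk
    obtain ⟨K, hK⟩ := exists_abs_conv_transport_le hk (isTest_cutoff n)
    have hmem : ∀ᵐ s ∂(volume.restrict (Icc 0 t)), s ∈ Icc 0 t := ae_restrict_mem measurableSet_Icc
    have hcomm : ∀ (f : E3 → ℝ) x, conv k f x = ∫ y, k (x - y) * f y := fun f x => by
      rw [conv_apply]; simp only [mul_comm]
    -- The pointwise bound is linear in the norms while `m` controls their squares, whence `1 + m`.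
    refine integral_cutoff_sq_sub_sq (isTest_cutoff n) ht (B := fun s => |K| * (1 + m s)) ?_ ?_ ?_
      (fun s hs => (contDiff_conv hk (hv s hs |>.weak 0).1).continuous) ?_ ?_
    · exact ((integrable_const (1 : ℝ)).add hm).const_mul _
    · intro x
      simpa only [hcomm] using hint _ (hk.comp_sub_left x)
    · intro x s hs
      have := hmom _ (hk.comp_sub_left x) s hs
      simp only [hcomm]
      linarith
    · filter_upwards [hae, hmem] with s hs hs'
      exact (contDiff_conv hk ((locallyIntegrable_of_memLp hs.1).sub
        (locallyIntegrable_coord_mul ((hv s hs').weak 0).2.1 1))).continuous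
    · filter_upwards [hae, hmem] with s hs hs' x hx
      have h1 := hK (G s) (g s 0) hs.1 ((hv s hs').memLp_partial 0) x hx
      have h2 := l2Norm_le_one_add_sizeH2_sq (v s) (G s) (g s) (h s)
      have h3 : 0 ≤ l2Norm (G s) + l2Norm (g s 0) :=
        add_nonneg (l2Norm_nonneg _) (l2Norm_nonneg _)
      calc _ ≤ K * (l2Norm (G s) + l2Norm (g s 0)) := h1
        _ ≤ |K| * (l2Norm (G s) + l2Norm (g s 0)) :=
          mul_le_mul_of_nonneg_right (le_abs_self K) h3
        _ ≤ _ := mul_le_mul_of_nonneg_left (by linarith [hs.2]) (abs_nonneg K)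
  obtain ⟨i0, e0⟩ := key _ (isTest_mollifier n)
  have kp := fun i => key _ ((isTest_mollifier n).classicalPartial i)
  have isum : IntegrableOn (fun s => ∑ i, ∫ x, cutoff n x *
      (conv (classicalPartial i (mollifier n)) (v s) x *
        conv (classicalPartial i (mollifier n)) (fun x => G s x - x 1 * g s 0 x) x)) (Icc 0 t) :=
    integrable_finsetSum _ fun i _ => (kp i).1
  refine ⟨i0.add isum, ?_⟩
  have ii : ∀ {f : ℝ → ℝ}, IntegrableOn f (Icc 0 t) → IntervalIntegrable f volume 0 t := fun hf =>
    (intervalIntegrable_iff_integrableOn_Icc_of_le ht).2 hf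
  have e1 : regEnergy n (v t) - regEnergy n (v 0) =
      ((∫ x, cutoff n x * conv (mollifier n) (v t) x ^ 2) -
        ∫ x, cutoff n x * conv (mollifier n) (v 0) x ^ 2) +
      ∑ i, ((∫ x, cutoff n x * conv (classicalPartial i (mollifier n)) (v t) x ^ 2) -
        ∫ x, cutoff n x * conv (classicalPartial i (mollifier n)) (v 0) x ^ 2) := by
    simp only [regEnergy, Finset.sum_sub_distrib]
    ring
  rw [e1, e0, Finset.sum_congr rfl fun i _ => (kp i).2]
  simp only [regRate, mul_add, Finset.mul_sum]
  rw [intervalIntegral.integral_add (ii (i0.const_mul 2)) (ii (integrable_finsetSum _ fun i _ =>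
    (kp i).1.const_mul 2)), intervalIntegral.integral_finsetSum fun i _ => ii ((kp i).1.const_mul 2)]

/-- The `H¹` energy balance of a solution of `∂ₜ v + y ∂ₓ v = G`. -/
theorem energy_balance (ht : 0 ≤ t) (hv : ∀ s ∈ Icc 0 t, IsH1 (v s) (g s))
    (hae : ∀ᵐ s ∂(volume.restrict (Icc 0 t)), (∀ k, IsH1 (g s k) (fun i => h s i k)) ∧
      MemLp (G s) 2 ∧ sizeH2 (v s) (G s) (g s) (h s) ^ 2 ≤ m s)
    (hm : IntegrableOn m (Icc 0 t))
    (hint : ∀ φ, IsTest φ → IntervalIntegrable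
      (fun s => ∫ x, φ x * (G s x - x 1 * g s 0 x)) volume 0 t)
    (hmom : ∀ φ, IsTest φ → ∀ s ∈ Icc 0 t, (∫ x, φ x * v s x) - ∫ x, φ x * v 0 x =
      ∫ r in (0 : ℝ)..s, ∫ x, φ x * (G r x - x 1 * g r 0 x)) :
    IntegrableOn (fun s => (∫ x, v s x * G s x) - (∑ i, ∫ x, h s i i x * G s x) -
      ∫ x, g s 1 x * g s 0 x) (Icc 0 t) ∧
    (l2Norm (v t) ^ 2 + ∑ i, l2Norm (g t i) ^ 2) - (l2Norm (v 0) ^ 2 + ∑ i, l2Norm (g 0 i) ^ 2) =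
      ∫ s in (0 : ℝ)..t, 2 * ((∫ x, v s x * G s x) - (∑ i, ∫ x, h s i i x * G s x) -
        ∫ x, g s 1 x * g s 0 x) := by
  obtain ⟨M, hM0, hM⟩ := exists_abs_regRate_le
  have hreg := regEnergy_sub_regEnergy ht hv (hae.mono fun s hs => hs.2) hm hint hmom
  have hmem : ∀ᵐ s ∂(volume.restrict (Icc 0 t)), s ∈ Icc 0 t := ae_restrict_mem measurableSet_Icc
  have hlim : ∀ᵐ s ∂(volume.restrict (Icc 0 t)),
      Tendsto (fun n => regRate n (v s) (fun x => G s x - x 1 * g s 0 x)) atTop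
      (𝓝 ((∫ x, v s x * G s x) - (∑ i, ∫ x, h s i i x * G s x) - ∫ x, g s 1 x * g s 0 x)) := by
    filter_upwards [hae, hmem] with s hs hs'
    exact tendsto_regRate (hv s hs') hs.1 hs.2.1
  have hbd : ∀ n, ∀ᵐ s ∂(volume.restrict (Icc 0 t)),
      ‖regRate n (v s) (fun x => G s x - x 1 * g s 0 x)‖ ≤ M * m s := fun n => by
    filter_upwards [hae, hmem] with s hs hs'
    exact (hM _ _ _ _ (hv s hs') hs.1 hs.2.1 n).trans (mul_le_mul_of_nonneg_left hs.2.2 hM0)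
  have hI : IntegrableOn (fun s => (∫ x, v s x * G s x) - (∑ i, ∫ x, h s i i x * G s x) -
      ∫ x, g s 1 x * g s 0 x) (Icc 0 t) := by
    refine Integrable.mono' (hm.const_mul M)
      (aestronglyMeasurable_of_tendsto_ae atTop (fun n => (hreg n).1.1) hlim) ?_
    filter_upwards [hlim, ae_all_iff.2 hbd] with s h1 h2
    exact le_of_tendsto h1.norm (Eventually.of_forall h2)
  refine ⟨hI, ?_⟩
  have h0 : (0 : ℝ) ∈ Icc 0 t := ⟨le_rfl, ht⟩
  have htt : t ∈ Icc 0 t := ⟨ht, le_rfl⟩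
  have hL := (tendsto_regEnergy (hv t htt)).sub (tendsto_regEnergy (hv 0 h0))
  simp only [(hreg _).2] at hL
  refine tendsto_nhds_unique hL ?_
  simp only [intervalIntegral.integral_of_le ht, ← integral_Icc_eq_integral_Ioc,
    integral_const_mul]
  exact (tendsto_integral_of_dominated_convergence _ (fun n => (hreg n).1.1) (hm.const_mul M) hbd
    hlim).const_mul 2

end ScalarEnergy

/-! ### Convection bound, absorption, and the exact energy rate -/

section Rate

theorem l2Norm_sum_le {ι : Type*} (s : Finset ι) {f : ι → E3 → ℝ} (hf : ∀ i ∈ s, MemLp (f i) 2) :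
    l2Norm (fun x => ∑ i ∈ s, f i x) ≤ ∑ i ∈ s, l2Norm (f i) := by
  classical
  induction s using Finset.induction_on with
  | empty => simp [l2Norm]
  | insert a s ha ih =>
    simp only [Finset.sum_insert ha]
    have hs : ∀ i ∈ s, MemLp (f i) 2 := fun i hi => hf i (Finset.mem_insert_of_mem hi)
    exact (l2Norm_add_le (hf a (Finset.mem_insert_self a s)) (memLp_finsetSum s hs)).trans
      (add_le_add le_rfl (ih hs))

variable {U : Fin 3 → E3 → ℝ} {D : Fin 3 → Fin 3 → E3 → ℝ} {H : Fin 3 → Fin 3 → Fin 3 → E3 → ℝ}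

theorem memLp_laplacian {D : Fin 3 → E3 → ℝ} {H : Fin 3 → Fin 3 → E3 → ℝ}
    (hD : ∀ k, IsH1 (D k) (fun i => H i k)) : MemLp (fun x => ∑ i, H i i x) 2 :=
  memLp_finsetSum _ fun i _ => (hD i).memLp_partial i

theorem integral_mul_laplacian {w : E3 → ℝ} {g k : Fin 3 → E3 → ℝ} {h : Fin 3 → Fin 3 → E3 → ℝ}
    (hg : ∀ k, IsH1 (g k) (fun i => h i k)) (hw : IsH1 w k) :
    ∫ x, w x * ∑ i, h i i x = -∑ i, ∫ x, g i x * k i x := by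
  simp only [Finset.mul_sum]
  rw [integral_finsetSum _ fun i _ => integrable_mul hw.memLp ((hg i).memLp_partial i),
    ← Finset.sum_neg_distrib]
  refine Finset.sum_congr rfl fun i _ => ?_
  rw [← integral_weakPartial_mul (hg i).memLp ((hg i).memLp_partial i) hw.memLp
    (hw.memLp_partial i) ((hg i).weak i) (hw.weak i)]
  simp only [mul_comm]

theorem exists_l2Norm_convection_sq_le : ∃ C : ℝ, 0 ≤ C ∧ ∀ (U : Fin 3 → E3 → ℝ)
    (D : Fin 3 → Fin 3 → E3 → ℝ) (H : Fin 3 → Fin 3 → Fin 3 → E3 → ℝ),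
    (∀ j, IsH1 (U j) (fun i => D i j)) → (∀ j k, IsH1 (D k j) (fun i => H i k j)) →
    ∀ B L : ℝ, B ≤ 1 → (∀ i j, l2Norm (D i j) ≤ B) → (∀ i k j, l2Norm (H i k j) ≤ L) →
    ∀ j, MemLp (fun x => ∑ i, U i x * D i j x) 2 ∧
      l2Norm (fun x => ∑ i, U i x * D i j x) ^ 2 ≤ C * (B * L) := by
  obtain ⟨C, hC0, hC⟩ := exists_l2Norm_mul_sq_le
  -- Each product costs `C (3B)² (3L) B ≤ 27 C B L`, where `B ≤ 1` removes the square. For three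
  -- summands `(a + b + c)² ≤ 3 (a² + b² + c²)`, and `3 · 3 · 27 = 243`.
  refine ⟨243 * C, by positivity, fun U D H hU hD B L hB1 hB hL j => ?_⟩
  have hB0 : 0 ≤ B := (l2Norm_nonneg _).trans (hB 0 0)
  have hL0 : 0 ≤ L := (l2Norm_nonneg _).trans (hL 0 0 0)
  have hmem : ∀ i, MemLp (fun x => U i x * D i j x) 2 := fun i => (hC _ _ _ _ (hU i) (hD j i)).1
  refine ⟨memLp_finsetSum _ fun i _ => hmem i, ?_⟩
  have hterm : ∀ i, l2Norm (fun x => U i x * D i j x) ^ 2 ≤ 27 * C * (B * L) := fun i => by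
    have h1 : ∑ k, l2Norm (D k i) ≤ 3 * B :=
      (Finset.sum_le_card_nsmul _ _ B fun k _ => hB k i).trans_eq (by simp)
    have h2 : ∑ k, l2Norm (H k i j) ≤ 3 * L :=
      (Finset.sum_le_card_nsmul _ _ L fun k _ => hL k i j).trans_eq (by simp)
    have n1 : 0 ≤ ∑ k, l2Norm (D k i) := Finset.sum_nonneg fun _ _ => l2Norm_nonneg _
    have n2 : 0 ≤ ∑ k, l2Norm (H k i j) := Finset.sum_nonneg fun _ _ => l2Norm_nonneg _
    have n3 := l2Norm_nonneg (D i j)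
    have e1 : (∑ k, l2Norm (D k i)) ^ 2 ≤ 9 := by nlinarith
    calc l2Norm (fun x => U i x * D i j x) ^ 2
        ≤ C * (∑ k, l2Norm (D k i)) ^ 2 * (∑ k, l2Norm (H k i j)) * l2Norm (D i j) :=
          (hC _ _ _ _ (hU i) (hD j i)).2
      _ ≤ C * 9 * (3 * L) * B :=
          mul_le_mul (mul_le_mul (mul_le_mul_of_nonneg_left e1 hC0) h2 n2 (by positivity))
            (hB i j) n3 (by positivity)
      _ = 27 * C * (B * L) := by ring
  have hs : l2Norm (fun x => ∑ i, U i x * D i j x) ≤ ∑ i, l2Norm (fun x => U i x * D i j x) :=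
    l2Norm_sum_le _ fun i _ => hmem i
  have h0 := hterm 0
  have h1 := hterm 1
  have h2 := hterm 2
  rw [Fin.sum_univ_three] at hs
  have n := l2Norm_nonneg (fun x => ∑ i, U i x * D i j x)
  refine (pow_le_pow_left₀ n hs 2).trans ?_
  set a := l2Norm (fun x => U 0 x * D 0 j x)
  set b := l2Norm (fun x => U 1 x * D 1 j x)
  set c := l2Norm (fun x => U 2 x * D 2 j x)
  nlinarith [sq_nonneg (a - b), sq_nonneg (b - c), sq_nonneg (a - c)]

/-- Here `A`, `B`, `L`, `N` stand for `‖u‖`, `‖∇u‖`, `‖Δu‖` and the convective norm. The two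
constraints reduce every term to a product `A L` or `B L`. Young applied to `B L` leaves `B²`, which
is again at most `3 A L`; a final use of Young leaves only `A²`. -/
theorem exists_energy_absorption {ν C₁ : ℝ} (hν : 0 < ν) (hC₁ : 0 ≤ C₁) :
    ∃ C : ℝ, 0 < C ∧ ∀ A B L N : ℝ, 0 ≤ A → 0 ≤ B → 0 ≤ L → 0 ≤ N → N ^ 2 ≤ C₁ * (B * L) →
      B ^ 2 ≤ 3 * (A * L) →
      -ν * (B ^ 2 + L ^ 2) + 3 * ((A + L) * N) + (A + L) * A + 3 * B ^ 2 ≤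
        -(ν / 2) * (B ^ 2 + L ^ 2) + C * A ^ 2 := by
  -- Young's inequality is used five times, each at the cost of `η L²`, and `5ν/12 ≤ ν/2`.
  obtain ⟨η, hη, hηd⟩ : ∃ η : ℝ, 0 < η ∧ η = ν / 12 := ⟨ν / 12, by positivity, rfl⟩
  have young : ∀ a b : ℝ, a * b ≤ η * b ^ 2 + 1 / (4 * η) * a ^ 2 := fun a b => by
    have : η * b ^ 2 + 1 / (4 * η) * a ^ 2 - a * b = η * (b - a / (2 * η)) ^ 2 := by
      field_simp
      ring
    nlinarith [mul_nonneg hη.le (sq_nonneg (b - a / (2 * η)))]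
  set κ := 1 / (4 * η) with hκ
  have hκ0 : 0 < κ := by positivity
  -- The factor `3 + 9κ` collects the `N²` from `3 A N ≤ 3A² + 3N²` and from Young for `3 N L`.
  set P := (3 + 9 * κ) * C₁ with hP
  have hP0 : 0 ≤ P := by positivity
  refine ⟨3 + κ + 1 + 81 * κ + 9 * (κ * P ^ 2) ^ 2 * κ, by positivity,
    fun A B L N hA hB hL hN hNB hBL => ?_⟩
  have y1 := young (3 * N) L
  have y2 := young A L
  have y3 := young (9 * A) L
  have y4 := young (P * B) L
  have y5 := young (3 * (κ * P ^ 2) * A) L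
  have h1 : (3 + 9 * κ) * N ^ 2 ≤ P * (B * L) := by
    calc (3 + 9 * κ) * N ^ 2 ≤ (3 + 9 * κ) * (C₁ * (B * L)) :=
          mul_le_mul_of_nonneg_left hNB (by positivity)
      _ = _ := by rw [hP]; ring
  have h2 : κ * P ^ 2 * B ^ 2 ≤ κ * P ^ 2 * (3 * (A * L)) :=
    mul_le_mul_of_nonneg_left hBL (by positivity)
  have h3 : 3 * (A * N) ≤ 3 * A ^ 2 + 3 * N ^ 2 := by nlinarith [sq_nonneg (A - N)]
  have h4 : 0 ≤ ν / 2 * B ^ 2 := by positivity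
  have h5 : 5 * (η * L ^ 2) ≤ ν / 2 * L ^ 2 := by
    rw [hηd]
    nlinarith [mul_nonneg hν.le (sq_nonneg L)]
  nlinarith [y1, y2, y3, y4, y5, h1, h2, h3, h4, h5]

/-- The components of the right-hand side of the momentum equation, without the term `y ∂ₓ u`. -/
noncomputable def fieldForce (ν f : ℝ) (U : Fin 3 → E3 → ℝ) (D : Fin 3 → Fin 3 → E3 → ℝ)
    (H : Fin 3 → Fin 3 → Fin 3 → E3 → ℝ) (p : Fin 3 → E3 → ℝ) (j : Fin 3) (x : E3) : ℝ :=
  ν * (∑ i, H i i j x) - p j x - (∑ i, U i x * D i j x) - (![U 1, 0, 0] : Fin 3 → E3 → ℝ) j x -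
    f * (![-U 1, U 0, 0] : Fin 3 → E3 → ℝ) j x

/-- Half the rate of change of the `H¹` energy of a scalar `v` with `∂ₜ v + y ∂ₓ v = G`. -/
noncomputable def energyRate (v G : E3 → ℝ) (g : Fin 3 → E3 → ℝ) (h : Fin 3 → Fin 3 → E3 → ℝ) : ℝ :=
  (∫ x, v x * G x) - (∑ i, ∫ x, h i i x * G x) - ∫ x, g 1 x * g 0 x

theorem memLp_vec₁ (hU : ∀ j, MemLp (U j) 2) (j : Fin 3) :
    MemLp ((![U 1, 0, 0] : Fin 3 → E3 → ℝ) j) 2 := by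
  fin_cases j
  · exact hU 1
  · exact MemLp.zero
  · exact MemLp.zero

theorem memLp_vec₂ (hU : ∀ j, MemLp (U j) 2) (j : Fin 3) :
    MemLp ((![-U 1, U 0, 0] : Fin 3 → E3 → ℝ) j) 2 := by
  fin_cases j
  · exact (hU 1).neg
  · exact hU 0
  · exact MemLp.zero

/-- The limit of the energy rates, with the pressure and the Coriolis force cancelled. -/
theorem sum_energyRate_eq {ν f : ℝ} {p : Fin 3 → E3 → ℝ}
    (hU : ∀ j, IsH1 (U j) (fun i => D i j)) (hD : ∀ j k, IsH1 (D k j) (fun i => H i k j))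
    (hp : ∀ j, MemLp (p j) 2) (hN : ∀ j, MemLp (fun x => ∑ i, U i x * D i j x) 2)
    (hpU : ∑ j, ∫ x, (U j x - ∑ i, H i i j x) * p j x = 0) :
    ∑ j, energyRate (U j) (fieldForce ν f U D H p j) (fun i => D i j) (fun i k => H i k j) =
      -ν * (∑ j, ∑ i, l2Norm (D i j) ^ 2 + ∑ j, l2Norm (fun x => ∑ i, H i i j x) ^ 2) -
      (∑ j, ∫ x, (U j x - ∑ i, H i i j x) * ∑ i, U i x * D i j x) -
      (∫ x, (U 0 x - ∑ i, H i i 0 x) * U 1 x) - ∑ j, ∫ x, D 1 j x * D 0 j x := by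
  set Λ : Fin 3 → E3 → ℝ := fun j x => ∑ i, H i i j x with hΛdef
  have hΛ : ∀ j, MemLp (Λ j) 2 := fun j => memLp_laplacian (hD j)
  have hUm : ∀ j, MemLp (U j) 2 := fun j => (hU j).memLp
  set W : Fin 3 → E3 → ℝ := fun j x => U j x - Λ j x with hWdef
  have hW : ∀ j, MemLp (W j) 2 := fun j => memLp_sub (hUm j) (hΛ j)
  set N : Fin 3 → E3 → ℝ := fun j x => ∑ i, U i x * D i j x with hNdef
  set s : Fin 3 → E3 → ℝ := ![U 1, 0, 0] with hs
  set r : Fin 3 → E3 → ℝ := ![-U 1, U 0, 0] with hr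
  have hsm : ∀ j, MemLp (s j) 2 := memLp_vec₁ hUm
  have hrm : ∀ j, MemLp (r j) 2 := memLp_vec₂ hUm
  have hUΛ : ∀ a b, ∫ x, U b x * Λ a x = -∑ i, ∫ x, D i a x * D i b x := fun a b =>
    integral_mul_laplacian (hD a) (hU b)
  have hG : ∀ j, MemLp (fieldForce ν f U D H p j) 2 := fun j =>
    memLp_sub (memLp_sub (memLp_sub (memLp_sub ((hΛ j).const_mul ν) (hp j)) (hN j)) (hsm j))
      ((hrm j).const_mul f)
  have h1 : ∀ j, energyRate (U j) (fieldForce ν f U D H p j) (fun i => D i j)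
      (fun i k => H i k j) = ν * (∫ x, W j x * Λ j x) - (∫ x, W j x * p j x) -
        (∫ x, W j x * N j x) - (∫ x, W j x * s j x) - f * (∫ x, W j x * r j x) -
        ∫ x, D 1 j x * D 0 j x := by
    intro j
    have e1 : ∑ i, ∫ x, H i i j x * fieldForce ν f U D H p j x =
        ∫ x, Λ j x * fieldForce ν f U D H p j x := by
      rw [← integral_finsetSum _ fun i _ => integrable_mul ((hD j i).memLp_partial i) (hG j)]
      simp only [hΛdef, Finset.sum_mul]
    have e2 : (∫ x, U j x * fieldForce ν f U D H p j x) -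
        ∫ x, Λ j x * fieldForce ν f U D H p j x = ∫ x, W j x * fieldForce ν f U D H p j x := by
      rw [← integral_sub (integrable_mul (hUm j) (hG j)) (integrable_mul (hΛ j) (hG j))]
      simp only [hWdef, sub_mul]
    have e3 : ∀ x, W j x * fieldForce ν f U D H p j x = ν * (W j x * Λ j x) - W j x * p j x -
        W j x * N j x - W j x * s j x - f * (W j x * r j x) := fun x => by
      simp only [fieldForce, ← hs, ← hr, hΛdef, hNdef]
      ring
    have i1 := (integrable_mul (hW j) (hΛ j)).const_mul ν
    have i2 := integrable_mul (hW j) (hp j)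
    have i3 := integrable_mul (hW j) (hN j)
    have i4 := integrable_mul (hW j) (hsm j)
    have i5 := (integrable_mul (hW j) (hrm j)).const_mul f
    have i12 : Integrable (fun x => ν * (W j x * Λ j x) - W j x * p j x) := i1.sub i2
    have i13 : Integrable (fun x => ν * (W j x * Λ j x) - W j x * p j x - W j x * N j x) :=
      i12.sub i3
    have i14 : Integrable (fun x => ν * (W j x * Λ j x) - W j x * p j x - W j x * N j x -
      W j x * s j x) := i13.sub i4
    rw [energyRate, e1, e2]
    simp only [e3]
    rw [integral_sub i14 i5, integral_sub i13 i4, integral_sub i12 i3, integral_sub i1 i2,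
      integral_const_mul, integral_const_mul]
  have h2 : ∀ j, ∫ x, W j x * Λ j x = -(∑ i, l2Norm (D i j) ^ 2) - l2Norm (Λ j) ^ 2 := by
    intro j
    have e : ∫ x, W j x * Λ j x = (∫ x, U j x * Λ j x) - ∫ x, Λ j x * Λ j x := by
      rw [← integral_sub (integrable_mul (hUm j) (hΛ j)) (integrable_mul (hΛ j) (hΛ j))]
      simp only [hWdef, sub_mul]
    rw [e, hUΛ]
    simp only [l2Norm_sq (hΛ j), l2Norm_sq ((hU j).memLp_partial _), sq]
  -- The Coriolis force does no work: the products `u₁ u₂` cancel, and so do the Laplacian terms,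
  -- since `∫ u₂ Δu₁` and `∫ u₁ Δu₂` both equal `-∫ ∇u₁ · ∇u₂`.
  have h3 : ∑ j, ∫ x, W j x * r j x = 0 := by
    have e0 : ∫ x, W 0 x * r 0 x = (∫ x, U 1 x * Λ 0 x) - ∫ x, U 0 x * U 1 x := by
      rw [← integral_sub (integrable_mul (hUm 1) (hΛ 0)) (integrable_mul (hUm 0) (hUm 1))]
      congr 1 with x
      simp [hr, hWdef]
      ring
    have e1 : ∫ x, W 1 x * r 1 x = (∫ x, U 0 x * U 1 x) - ∫ x, U 0 x * Λ 1 x := by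
      rw [← integral_sub (integrable_mul (hUm 0) (hUm 1)) (integrable_mul (hUm 0) (hΛ 1))]
      congr 1 with x
      simp [hr, hWdef]
      ring
    have e2 : ∫ x, W 2 x * r 2 x = 0 := by simp [hr]
    have e3 : ∑ i, ∫ x, D i 0 x * D i 1 x = ∑ i, ∫ x, D i 1 x * D i 0 x := by
      simp only [mul_comm]
    rw [Fin.sum_univ_three, e0, e1, e2, hUΛ, hUΛ, e3]
    ring
  have h4 : ∑ j, ∫ x, W j x * s j x = ∫ x, W 0 x * U 1 x := by
    simp [Fin.sum_univ_three, hs]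
  have h5 : ∑ j, ∫ x, W j x * p j x = 0 := hpU
  simp only [h1, h2, Finset.sum_sub_distrib, ← Finset.mul_sum, h3, h4, h5, Finset.sum_neg_distrib]
  simp only [hWdef, hNdef]
  ring

end Rate

/-! ### Bounds for the energy rate and for its majorant -/

section RateBound

theorem l2Norm_sub_le {f g : E3 → ℝ} (hf : MemLp f 2) (hg : MemLp g 2) :
    l2Norm (fun x => f x - g x) ≤ l2Norm f + l2Norm g := by
  have h := l2Norm_add_le hf (hg.const_mul (-1))
  rw [l2Norm_const_mul] at h
  simpa [sub_eq_add_neg] using h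

theorem le_sqrt_sum_sq {ι : Type*} [Fintype ι] (a : ι → ℝ) (i : ι) :
    a i ≤ Real.sqrt (∑ i, a i ^ 2) :=
  Real.le_sqrt_of_sq_le (Finset.single_le_sum (f := fun i => a i ^ 2) (fun i _ => sq_nonneg (a i))
    (Finset.mem_univ i))

theorem le_sqrt_sum_sum_sq {ι κ : Type*} [Fintype ι] [Fintype κ] (a : ι → κ → ℝ) (i : ι) (k : κ) :
    a i k ≤ Real.sqrt (∑ k, ∑ i, a i k ^ 2) := by
  refine Real.le_sqrt_of_sq_le (le_trans ?_ (Finset.single_le_sum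
    (f := fun k => ∑ i, a i k ^ 2) (fun k _ => Finset.sum_nonneg fun i _ => sq_nonneg _)
    (Finset.mem_univ k)))
  exact Finset.single_le_sum (f := fun i => a i k ^ 2) (fun i _ => sq_nonneg _) (Finset.mem_univ i)

theorem sum_l2Norm_laplacian_sq {U : Fin 3 → E3 → ℝ} {D : Fin 3 → Fin 3 → E3 → ℝ}
    {H : Fin 3 → Fin 3 → Fin 3 → E3 → ℝ} (hU : ∀ j, IsH1 (U j) (fun i => D i j))
    (hD : ∀ j k, IsH1 (D k j) (fun i => H i k j)) :
    ∑ j, l2Norm (fun x => ∑ i, H i i j x) ^ 2 = ∑ j, ∑ i, ∑ k, l2Norm (H i k j) ^ 2 := by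
  refine Finset.sum_congr rfl fun j _ => ?_
  rw [l2Norm_sq (memLp_laplacian (hD j)), integral_laplacian_sq (hU j) (hD j)]
  simp only [l2Norm_sq ((hD j _).memLp_partial _)]

theorem l2Norm_hessian_le {U : Fin 3 → E3 → ℝ} {D : Fin 3 → Fin 3 → E3 → ℝ}
    {H : Fin 3 → Fin 3 → Fin 3 → E3 → ℝ} (hU : ∀ j, IsH1 (U j) (fun i => D i j))
    (hD : ∀ j k, IsH1 (D k j) (fun i => H i k j)) (i k j : Fin 3) :
    l2Norm (H i k j) ≤ Real.sqrt (∑ j, l2Norm (fun x => ∑ i, H i i j x) ^ 2) := by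
  rw [sum_l2Norm_laplacian_sq hU hD]
  refine Real.le_sqrt_of_sq_le ?_
  refine le_trans ?_ (Finset.single_le_sum (f := fun j => ∑ i, ∑ k, l2Norm (H i k j) ^ 2)
    (fun _ _ => Finset.sum_nonneg fun _ _ => Finset.sum_nonneg fun _ _ => sq_nonneg _)
    (Finset.mem_univ j))
  refine le_trans ?_ (Finset.single_le_sum (f := fun i => ∑ k, l2Norm (H i k j) ^ 2)
    (fun _ _ => Finset.sum_nonneg fun _ _ => sq_nonneg _) (Finset.mem_univ i))
  exact Finset.single_le_sum (f := fun k => l2Norm (H i k j) ^ 2) (fun _ _ => sq_nonneg _)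
    (Finset.mem_univ k)

theorem sizeH2_nonneg (v G : E3 → ℝ) (g : Fin 3 → E3 → ℝ) (h : Fin 3 → Fin 3 → E3 → ℝ) :
    0 ≤ sizeH2 v G g h := by
  unfold sizeH2
  exact add_nonneg (add_nonneg (add_nonneg (l2Norm_nonneg _)
    (Finset.sum_nonneg fun _ _ => l2Norm_nonneg _)) (Finset.sum_nonneg fun _ _ => l2Norm_nonneg _))
    (l2Norm_nonneg _)

theorem sum_four_sq_le {a b L P N C : ℝ} (hL : 0 ≤ L) (hC : 0 ≤ C) (hN : N ^ 2 ≤ C * L) :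
    (a + b * L + P + N) ^ 2 ≤ 4 * (a ^ 2 + b ^ 2 + 1 + C) * (1 + L ^ 2 + P ^ 2) := by
  have q1 : (a + b * L + P + N) ^ 2 ≤ 4 * (a ^ 2 + (b * L) ^ 2 + P ^ 2 + N ^ 2) := by
    generalize b * L = c
    linarith [sq_nonneg (a - c), sq_nonneg (a - P), sq_nonneg (a - N),
      sq_nonneg (c - P), sq_nonneg (c - N), sq_nonneg (P - N)]
  have q2 : C * L ≤ C * (1 + L ^ 2) :=
    mul_le_mul_of_nonneg_left (by linarith [sq_nonneg (L - 1)]) hC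
  have r1 : 0 ≤ a ^ 2 * (L ^ 2 + P ^ 2) := by positivity
  have r2 : 0 ≤ b ^ 2 * (1 + P ^ 2) := by positivity
  have r3 : 0 ≤ C * P ^ 2 := by positivity
  have r4 : 0 ≤ 1 + L ^ 2 := by positivity
  linarith [mul_pow b L 2]

/-- Cauchy–Schwarz bounds the three surviving terms of `sum_energyRate_eq`, in which `f` no longer
occurs; this allows `C` to be chosen before `f`. -/
theorem exists_sum_energyRate_le {ν : ℝ} (hν : 0 < ν) : ∃ C : ℝ, 0 < C ∧
    ∀ (f : ℝ) (U : Fin 3 → E3 → ℝ) (D : Fin 3 → Fin 3 → E3 → ℝ)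
      (H : Fin 3 → Fin 3 → Fin 3 → E3 → ℝ) (p : Fin 3 → E3 → ℝ),
      (∀ j, IsH1 (U j) (fun i => D i j)) → (∀ j k, IsH1 (D k j) (fun i => H i k j)) →
      (∀ j, MemLp (p j) 2) → ∑ j, ∫ x, (U j x - ∑ i, H i i j x) * p j x = 0 →
      ∑ j, ∑ i, l2Norm (D i j) ^ 2 ≤ 1 →
      ∑ j, energyRate (U j) (fieldForce ν f U D H p j) (fun i => D i j) (fun i k => H i k j) ≤
        -(ν / 2) * (∑ j, ∑ i, l2Norm (D i j) ^ 2 +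
          ∑ j, l2Norm (fun x => ∑ i, H i i j x) ^ 2) + C * ∑ j, l2Norm (U j) ^ 2 := by
  obtain ⟨C₁, hC₁, hconv⟩ := exists_l2Norm_convection_sq_le
  obtain ⟨C, hC, habs⟩ := exists_energy_absorption hν hC₁
  refine ⟨C, hC, fun f U D H p hU hD hp hpU hsmall => ?_⟩
  have hΛ : ∀ j, MemLp (fun x => ∑ i, H i i j x) 2 := fun j => memLp_laplacian (hD j)
  have hlap := sum_l2Norm_laplacian_sq hU hD
  set A := Real.sqrt (∑ j, l2Norm (U j) ^ 2) with hA
  set B := Real.sqrt (∑ j, ∑ i, l2Norm (D i j) ^ 2) with hB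
  set L := Real.sqrt (∑ j, l2Norm (fun x => ∑ i, H i i j x) ^ 2) with hL
  have sA : A ^ 2 = ∑ j, l2Norm (U j) ^ 2 :=
    Real.sq_sqrt (Finset.sum_nonneg fun _ _ => sq_nonneg _)
  have sB : B ^ 2 = ∑ j, ∑ i, l2Norm (D i j) ^ 2 :=
    Real.sq_sqrt (Finset.sum_nonneg fun _ _ => Finset.sum_nonneg fun _ _ => sq_nonneg _)
  have sL : L ^ 2 = ∑ j, l2Norm (fun x => ∑ i, H i i j x) ^ 2 :=
    Real.sq_sqrt (Finset.sum_nonneg fun _ _ => sq_nonneg _)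
  have hA0 : 0 ≤ A := Real.sqrt_nonneg _
  have hB0 : 0 ≤ B := Real.sqrt_nonneg _
  have hL0 : 0 ≤ L := Real.sqrt_nonneg _
  have hUA : ∀ j, l2Norm (U j) ≤ A := le_sqrt_sum_sq fun j => l2Norm (U j)
  have hDB : ∀ i j, l2Norm (D i j) ≤ B := le_sqrt_sum_sum_sq fun i j => l2Norm (D i j)
  have hΛL : ∀ j, l2Norm (fun x => ∑ i, H i i j x) ≤ L :=
    le_sqrt_sum_sq fun j => l2Norm (fun x => ∑ i, H i i j x)
  have hHL : ∀ i k j, l2Norm (H i k j) ≤ L := l2Norm_hessian_le hU hD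
  have hB1 : B ≤ 1 := by
    rw [← sB] at hsmall
    exact (sq_le_one_iff₀ hB0).1 hsmall
  clear_value A B L
  have hN := hconv U D H hU hD B L hB1 hDB hHL
  obtain ⟨N, hN0, sN, hNj⟩ : ∃ N : ℝ, 0 ≤ N ∧ N ^ 2 = C₁ * (B * L) ∧
      ∀ j, l2Norm (fun x => ∑ i, U i x * D i j x) ≤ N :=
    ⟨Real.sqrt (C₁ * (B * L)), Real.sqrt_nonneg _,
      Real.sq_sqrt (mul_nonneg hC₁ (mul_nonneg hB0 hL0)), fun j =>
      Real.le_sqrt_of_sq_le (hN j).2⟩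
  have hW : ∀ j, MemLp (fun x => U j x - ∑ i, H i i j x) 2 := fun j =>
    memLp_sub (hU j).memLp (hΛ j)
  have hWn : ∀ j, l2Norm (fun x => U j x - ∑ i, H i i j x) ≤ A + L := fun j =>
    (l2Norm_sub_le (hU j).memLp (hΛ j)).trans (add_le_add (hUA j) (hΛL j))
  -- Interpolation: `‖∇u_j‖² = -∫ u_j Δu_j ≤ A L` for each of the three components.
  have hBL : B ^ 2 ≤ 3 * (A * L) := by
    have e : ∀ j, ∑ i, l2Norm (D i j) ^ 2 ≤ A * L := fun j => by
      have h1 := integral_mul_laplacian (hD j) (hU j)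
      have h2 : ∑ i, ∫ x, D i j x * D i j x = ∑ i, l2Norm (D i j) ^ 2 := by
        simp only [l2Norm_sq ((hU j).memLp_partial _), sq]
      rw [h2] at h1
      have h3 := (abs_le.1 (abs_integral_mul_le (hU j).memLp (hΛ j))).1
      have h4 := mul_le_mul (hUA j) (hΛL j) (l2Norm_nonneg _) hA0
      linarith
    rw [sB, Fin.sum_univ_three]
    linarith [e 0, e 1, e 2]
  have key := habs A B L N hA0 hB0 hL0 hN0 sN.le hBL
  rw [sum_energyRate_eq hU hD hp (fun j => (hN j).1) hpU, ← sA, ← sB, ← sL]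
  have t1 : ∀ j, -((A + L) * N) ≤
      ∫ x, (U j x - ∑ i, H i i j x) * ∑ i, U i x * D i j x := fun j => by
    have h3 := (abs_le.1 (abs_integral_mul_le (hW j) (hN j).1)).1
    have h4 := mul_le_mul (hWn j) (hNj j) (l2Norm_nonneg _) (add_nonneg hA0 hL0)
    linarith
  have t2 : -((A + L) * A) ≤ ∫ x, (U 0 x - ∑ i, H i i 0 x) * U 1 x := by
    have h3 := (abs_le.1 (abs_integral_mul_le (hW 0) (hU 1).memLp)).1
    have h4 := mul_le_mul (hWn 0) (hUA 1) (l2Norm_nonneg _) (add_nonneg hA0 hL0)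
    linarith
  have t3 : ∀ j, -B ^ 2 ≤ ∫ x, D 1 j x * D 0 j x := fun j => by
    have h3 := (abs_le.1 (abs_integral_mul_le ((hU j).memLp_partial 1)
      ((hU j).memLp_partial 0))).1
    have h4 := mul_le_mul (hDB 1 j) (hDB 0 j) (l2Norm_nonneg _) hB0
    linarith [sq B]
  rw [Fin.sum_univ_three (fun j => ∫ x, (U j x - ∑ i, H i i j x) * ∑ i, U i x * D i j x),
    Fin.sum_univ_three (fun j => ∫ x, D 1 j x * D 0 j x)]
  linarith [t1 0, t1 1, t1 2, t3 0, t3 1, t3 2]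

theorem memLp_fieldForce {ν f : ℝ} {U : Fin 3 → E3 → ℝ} {D : Fin 3 → Fin 3 → E3 → ℝ}
    {H : Fin 3 → Fin 3 → Fin 3 → E3 → ℝ} {p : Fin 3 → E3 → ℝ} (hU : ∀ j, MemLp (U j) 2)
    (hD : ∀ j k, IsH1 (D k j) (fun i => H i k j)) (hp : ∀ j, MemLp (p j) 2)
    (hN : ∀ j, MemLp (fun x => ∑ i, U i x * D i j x) 2) (j : Fin 3) :
    MemLp (fieldForce ν f U D H p j) 2 ∧ l2Norm (fieldForce ν f U D H p j) ≤
      |ν| * l2Norm (fun x => ∑ i, H i i j x) + l2Norm (p j) +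
        l2Norm (fun x => ∑ i, U i x * D i j x) + l2Norm ((![U 1, 0, 0] : Fin 3 → E3 → ℝ) j) +
        |f| * l2Norm ((![-U 1, U 0, 0] : Fin 3 → E3 → ℝ) j) := by
  have h1 : MemLp (fun x => ν * ∑ i, H i i j x) 2 := (memLp_laplacian (hD j)).const_mul ν
  have h2 := memLp_sub h1 (hp j)
  have h3 := memLp_sub h2 (hN j)
  have h4 := memLp_sub h3 (memLp_vec₁ hU j)
  have h5 : MemLp (fun x => f * (![-U 1, U 0, 0] : Fin 3 → E3 → ℝ) j x) 2 :=
    (memLp_vec₂ hU j).const_mul f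
  refine ⟨memLp_sub h4 h5, ?_⟩
  refine (l2Norm_sub_le h4 h5).trans (add_le_add ?_ (l2Norm_const_mul _ _).le)
  refine (l2Norm_sub_le h3 (memLp_vec₁ hU j)).trans (add_le_add ?_ le_rfl)
  refine (l2Norm_sub_le h2 (hN j)).trans (add_le_add ?_ le_rfl)
  exact (l2Norm_sub_le h1 (hp j)).trans (add_le_add (l2Norm_const_mul _ _).le le_rfl)

/-- The dependence of `K` on `f` is harmless: the bound serves only to make the majorant integrable
in time and does not enter the final constant. -/
theorem exists_sizeH2_sq_le (ν f : ℝ) : ∃ K : ℝ, ∀ (U : Fin 3 → E3 → ℝ)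
    (D : Fin 3 → Fin 3 → E3 → ℝ) (H : Fin 3 → Fin 3 → Fin 3 → E3 → ℝ) (p : Fin 3 → E3 → ℝ),
    (∀ j, IsH1 (U j) (fun i => D i j)) → (∀ j k, IsH1 (D k j) (fun i => H i k j)) →
    (∀ j, MemLp (p j) 2) → ∑ j, l2Norm (U j) ^ 2 ≤ 1 → ∑ j, ∑ i, l2Norm (D i j) ^ 2 ≤ 1 →
    ∀ j, MemLp (fieldForce ν f U D H p j) 2 ∧
      sizeH2 (U j) (fieldForce ν f U D H p j) (fun i => D i j) (fun i k => H i k j) ^ 2 ≤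
        K * (1 + ∑ j, l2Norm (fun x => ∑ i, H i i j x) ^ 2 + ∑ j, l2Norm (p j) ^ 2) := by
  obtain ⟨C₁, hC₁, hconv⟩ := exists_l2Norm_convection_sq_le
  -- Norms at most one: `u_j`, three first derivatives and the shear term give `5`, the Coriolis
  -- term `|f|`. Norms at most `L`: three pure second derivatives and the viscous term give `3 +
  -- |ν|`.
  refine ⟨4 * ((5 + |f|) ^ 2 + (3 + |ν|) ^ 2 + 1 + C₁), fun U D H p hU hD hp hU1 hD1 j => ?_⟩
  set L := Real.sqrt (∑ j, l2Norm (fun x => ∑ i, H i i j x) ^ 2) with hL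
  set P := Real.sqrt (∑ j, l2Norm (p j) ^ 2) with hP
  have sL : L ^ 2 = ∑ j, l2Norm (fun x => ∑ i, H i i j x) ^ 2 :=
    Real.sq_sqrt (Finset.sum_nonneg fun _ _ => sq_nonneg _)
  have sP : P ^ 2 = ∑ j, l2Norm (p j) ^ 2 :=
    Real.sq_sqrt (Finset.sum_nonneg fun _ _ => sq_nonneg _)
  have hL0 : 0 ≤ L := Real.sqrt_nonneg _
  have hUA : ∀ j, l2Norm (U j) ≤ 1 := fun j =>
    (le_sqrt_sum_sq (fun j => l2Norm (U j)) j).trans (Real.sqrt_le_iff.2 ⟨zero_le_one, hU1.trans_eq (one_pow 2).symm⟩)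
  have hDB : ∀ i j, l2Norm (D i j) ≤ 1 := fun i j =>
    (le_sqrt_sum_sum_sq (fun i j => l2Norm (D i j)) i j).trans (Real.sqrt_le_iff.2 ⟨zero_le_one, hD1.trans_eq (one_pow 2).symm⟩)
  have hΛL : ∀ j, l2Norm (fun x => ∑ i, H i i j x) ≤ L :=
    le_sqrt_sum_sq fun j => l2Norm (fun x => ∑ i, H i i j x)
  have hpP : ∀ j, l2Norm (p j) ≤ P := le_sqrt_sum_sq fun j => l2Norm (p j)
  have hHL : ∀ i k j, l2Norm (H i k j) ≤ L := l2Norm_hessian_le hU hD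
  have hN := hconv U D H hU hD 1 L le_rfl hDB hHL
  obtain ⟨hG, hGle⟩ := memLp_fieldForce (ν := ν) (f := f) (fun j => (hU j).memLp) hD hp
    (fun j => (hN j).1) j
  refine ⟨hG, ?_⟩
  rw [← sL, ← sP]
  set N := l2Norm (fun x => ∑ i, U i x * D i j x)
  have hN0 : 0 ≤ N := l2Norm_nonneg _
  have sN : N ^ 2 ≤ C₁ * (1 * L) := (hN j).2
  have z : l2Norm (0 : E3 → ℝ) = 0 := by simp [l2Norm]
  have v1 : l2Norm ((![U 1, 0, 0] : Fin 3 → E3 → ℝ) j) ≤ 1 := by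
    fin_cases j
    · exact hUA 1
    · exact z.le.trans zero_le_one
    · exact z.le.trans zero_le_one
  have v2 : l2Norm ((![-U 1, U 0, 0] : Fin 3 → E3 → ℝ) j) ≤ 1 := by
    fin_cases j
    · have : l2Norm (-U 1) = l2Norm (U 1) := by simp [l2Norm]
      exact this.le.trans (hUA 1)
    · exact hUA 0
    · exact z.le.trans zero_le_one
  have w1 := mul_le_mul_of_nonneg_left (hΛL j) (abs_nonneg ν)
  have w2 := mul_le_mul_of_nonneg_left v2 (abs_nonneg f)
  have hS : sizeH2 (U j) (fieldForce ν f U D H p j) (fun i => D i j) (fun i k => H i k j) ≤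
      (5 + |f|) + (3 + |ν|) * L + P + N := by
    unfold sizeH2
    rw [Fin.sum_univ_three, Fin.sum_univ_three]
    linarith [hUA j, hDB 0 j, hDB 1 j, hDB 2 j, hHL 0 0 j, hHL 1 1 j, hHL 2 2 j, hpP j]
  refine (pow_le_pow_left₀ (sizeH2_nonneg _ _ _ _) hS 2).trans ?_
  exact sum_four_sq_le hL0 hC₁ (by simpa using sN)

end RateBound

/-! ### From vector fields to their components -/

section Components

theorem locallyIntegrable_component {f : E3 → E3} (hf : LocallyIntegrable f) (j : Fin 3) :
    LocallyIntegrable (fun x => f x j) := fun x => by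
  obtain ⟨s, hs, hi⟩ := hf x
  exact ⟨s, hs, (EuclideanSpace.proj (𝕜 := ℝ) j).integrable_comp hi⟩

theorem eq_sum_smul_single (v : E3) : v = ∑ j, v j • EuclideanSpace.single j (1 : ℝ) := by
  ext i
  simp [Fin.sum_univ_three]
  fin_cases i <;> simp

theorem integrable_of_component {f : E3 → E3} (hf : ∀ j, Integrable (fun x => f x j)) :
    Integrable f := by
  have : f = fun x => ∑ j, f x j • EuclideanSpace.single j (1 : ℝ) :=
    funext fun x => eq_sum_smul_single (f x)
  rw [this]
  exact integrable_finsetSum _ fun j _ => (hf j).smul_const _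

theorem integral_smul_component {φ : E3 → ℝ} (hφ : IsTest φ) {f : E3 → E3}
    (hf : ∀ j, LocallyIntegrable (fun x => f x j)) (j : Fin 3) :
    (∫ x, φ x • f x) j = ∫ x, φ x * f x j := by
  have hi : Integrable (fun x => φ x • f x) := integrable_of_component fun j =>
    (hf j).integrable_smul_left_of_hasCompactSupport hφ.continuous hφ.2
  exact ((EuclideanSpace.proj (𝕜 := ℝ) j).integral_comp_comm hi).symm

theorem IsWeakPartial.component {i : Fin 3} {f g : E3 → E3} (h : IsWeakPartial i f g)
    (j : Fin 3) : IsWeakPartial i (fun x => f x j) (fun x => g x j) := by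
  have h1 := locallyIntegrable_component h.1
  have h2 := locallyIntegrable_component h.2.1
  refine ⟨h1 j, h2 j, fun φ hφ => ?_⟩
  have h3 := congrArg (fun v : E3 => v j) (h.2.2 φ hφ)
  simp only [PiLp.neg_apply] at h3
  rwa [integral_smul_component (hφ.classicalPartial i) h1, integral_smul_component hφ h2] at h3

theorem memLp_component {f : E3 → E3} {p : ENNReal} (hf : MemLp f p) (j : Fin 3) :
    MemLp (fun x => f x j) p :=
  (EuclideanSpace.proj (𝕜 := ℝ) j).comp_memLp' hf

theorem MemH1.isH1_component {u : E3 → E3} (h : MemH1 u) (j : Fin 3) :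
    IsH1 (fun x => u x j) (fun i x => weakPartial i u x j) where
  memLp := memLp_component h.1 j
  memLp_partial i := memLp_component (h.2 i).2 j
  weak i := (h.2 i).1.isWeakPartial.component j

theorem l2Sq_eq_sum {f : E3 → E3} (hf : MemLp f 2) :
    l2Sq f = ∑ j, l2Norm (fun x => f x j) ^ 2 := by
  simp only [l2Sq, EuclideanSpace.real_norm_sq_eq, l2Norm_sq (memLp_component hf _)]
  exact integral_finsetSum _ fun j _ => (memLp_component hf j).integrable_sq

theorem l2Sq_eq_l2Norm_sq {f : E3 → ℝ} (hf : MemLp f 2) : l2Sq f = l2Norm f ^ 2 := by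
  simp only [l2Sq, l2Norm_sq hf, Real.norm_eq_abs, sq_abs]

theorem gradSq_eq_sum {u : E3 → E3} (h : MemH1 u) :
    gradSq u = ∑ j, ∑ i, l2Norm (fun x => weakPartial i u x j) ^ 2 := by
  rw [Finset.sum_comm]
  exact Finset.sum_congr rfl fun i _ => l2Sq_eq_sum (h.2 i).2

theorem weakLaplacian_component (u : E3 → E3) (j : Fin 3) (x : E3) :
    weakLaplacian u x j = ∑ i, weakPartial i (weakPartial i u) x j := by
  simp [weakLaplacian]

theorem MemH2.l2Sq_weakLaplacian {u : E3 → E3} (h : MemH2 u) :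
    l2Sq (weakLaplacian u) =
      ∑ j, l2Norm (fun x => ∑ i, weakPartial i (weakPartial i u) x j) ^ 2 := by
  have : MemLp (weakLaplacian u) 2 := memLp_finsetSum _ fun i _ => ((h.2 i).2 i).2
  simp only [l2Sq_eq_sum this, weakLaplacian_component]

/-- This transfers integrability in time from the individual second derivatives to `‖Δu‖²`. -/
theorem MemH2.l2Sq_weakLaplacian_eq_sum {u : E3 → E3} (h : MemH2 u) :
    l2Sq (weakLaplacian u) = ∑ i, ∑ k, l2Sq (weakPartial i (weakPartial k u)) := by
  rw [h.l2Sq_weakLaplacian, sum_l2Norm_laplacian_sq (U := fun j x => u x j)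
    (D := fun i j x => weakPartial i u x j)
    (H := fun i k j x => weakPartial i (weakPartial k u) x j) (fun j => h.1.isH1_component j)
    (fun j k => (h.2 k).isH1_component j), Finset.sum_comm]
  refine Finset.sum_congr rfl fun i _ => ?_
  rw [Finset.sum_comm]
  exact Finset.sum_congr rfl fun k _ => (l2Sq_eq_sum ((h.2 k).2 i).2).symm

end Components

/-! ### `u - Δu` is divergence free -/

section DivergenceFree

variable {U : Fin 3 → E3 → ℝ} {D : Fin 3 → Fin 3 → E3 → ℝ} {H : Fin 3 → Fin 3 → Fin 3 → E3 → ℝ}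

theorem IsTest.integrable_mul {φ f : E3 → ℝ} (hφ : IsTest φ) (hf : LocallyIntegrable f) :
    Integrable (fun x => φ x * f x) :=
  hf.integrable_smul_left_of_hasCompactSupport hφ.continuous hφ.2

theorem sum_integral_mul_classicalPartial_eq_zero (hU : ∀ j, IsH1 (U j) (fun i => D i j))
    (hdiv : ∀ᵐ x : E3, ∑ j, D j j x = 0) {φ : E3 → ℝ} (hφ : IsTest φ) :
    ∑ j, ∫ x, U j x * classicalPartial j φ x = 0 := by
  have h1 : ∀ j, ∫ x, U j x * classicalPartial j φ x = -∫ x, φ x * D j j x := fun j => by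
    have := ((hU j).weak j).2.2 φ hφ
    simp only [smul_eq_mul] at this
    rw [← this]
    simp only [mul_comm]
  simp only [h1, Finset.sum_neg_distrib]
  rw [← integral_finsetSum _ fun j _ => hφ.integrable_mul ((hU j).weak j).2.1, neg_eq_zero]
  refine integral_eq_zero_of_ae (hdiv.mono fun x hx => ?_)
  simp only [← Finset.mul_sum, hx, mul_zero, Pi.zero_apply]

/-- Two weak integrations by parts move the Laplacian onto the test function, so that only the
divergence of `u` against `∂_i ∂_i φ` is needed and no third derivative of `u` appears. -/
theorem sum_integral_laplacian_mul_classicalPartial_eq_zero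
    (hU : ∀ j, IsH1 (U j) (fun i => D i j)) (hD : ∀ j k, IsH1 (D k j) (fun i => H i k j))
    (hdiv : ∀ᵐ x : E3, ∑ j, D j j x = 0) {φ : E3 → ℝ} (hφ : IsTest φ) :
    ∑ j, ∫ x, (∑ i, H i i j x) * classicalPartial j φ x = 0 := by
  have h1 : ∀ i j, ∫ x, H i i j x * classicalPartial j φ x =
      ∫ x, U j x * classicalPartial j (classicalPartial i (classicalPartial i φ)) x := by
    intro i j
    have hj := hφ.classicalPartial j
    have e1 := ((hD j i).weak i).2.2 _ hj
    have e2 := ((hU j).weak i).2.2 _ (hj.classicalPartial i)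
    have e3 : classicalPartial i (classicalPartial i (classicalPartial j φ)) =
        classicalPartial j (classicalPartial i (classicalPartial i φ)) := by
      have : classicalPartial i (classicalPartial j φ) =
          classicalPartial j (classicalPartial i φ) := funext (classicalPartial_comm hφ.1 i j)
      rw [this]
      exact funext (classicalPartial_comm (hφ.classicalPartial i).1 i j)
    rw [e3] at e2
    simp only [smul_eq_mul] at e1 e2
    simp only [mul_comm (H i i j _), mul_comm (U j _)]
    linarith
  have h2 : ∀ j, ∫ x, (∑ i, H i i j x) * classicalPartial j φ x =
      ∑ i, ∫ x, H i i j x * classicalPartial j φ x := fun j => by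
    simp only [Finset.sum_mul]
    refine integral_finsetSum _ fun i _ => ?_
    simp only [mul_comm (H i i j _)]
    exact (hφ.classicalPartial j).integrable_mul ((hD j i).weak i).2.1
  simp only [h2, h1]
  rw [Finset.sum_comm]
  exact Finset.sum_eq_zero fun i _ => sum_integral_mul_classicalPartial_eq_zero hU hdiv
    ((hφ.classicalPartial i).classicalPartial i)

/-- The pressure gradient is orthogonal to `u - Δ u`. -/
theorem sum_integral_sub_laplacian_mul_pressure_eq_zero {q : E3 → ℝ} {p : Fin 3 → E3 → ℝ}
    (hU : ∀ j, IsH1 (U j) (fun i => D i j)) (hD : ∀ j k, IsH1 (D k j) (fun i => H i k j))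
    (hdiv : ∀ᵐ x : E3, ∑ j, D j j x = 0) (hq : MemLp q 6) (hp : ∀ i, MemLp (p i) 2)
    (hqp : ∀ i, IsWeakPartial i q (p i)) :
    ∑ j, ∫ x, (U j x - ∑ i, H i i j x) * p j x = 0 := by
  refine sum_integral_weakPartial_mul_eq_zero hq hp hqp
    (fun j => memLp_sub (hU j).memLp (memLp_laplacian (hD j))) fun φ hφ => ?_
  have h1 : ∀ j, ∫ x, (U j x - ∑ i, H i i j x) * classicalPartial j φ x =
      (∫ x, U j x * classicalPartial j φ x) -
        ∫ x, (∑ i, H i i j x) * classicalPartial j φ x := fun j => by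
    have hj := (hφ.classicalPartial j).memLp 2
    rw [← integral_sub (integrable_mul (hU j).memLp hj) (integrable_mul (memLp_laplacian (hD j)) hj)]
    simp only [sub_mul]
  simp only [h1, Finset.sum_sub_distrib]
  rw [sum_integral_mul_classicalPartial_eq_zero hU hdiv hφ,
    sum_integral_laplacian_mul_classicalPartial_eq_zero hU hD hdiv hφ, sub_zero]

end DivergenceFree

/-! ### Splitting the momentum equation into force and transport -/

section Force

theorem momentum_force_component (ν f : ℝ) (u : E3 → E3) (q : E3 → ℝ) (x : E3) (j : Fin 3) :
    (ν • weakLaplacian u x - weakGrad q x - inertialTerm f u x) j =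
      fieldForce ν f (fun j x => u x j) (fun i j x => weakPartial i u x j)
        (fun i k j x => weakPartial i (weakPartial k u) x j) (fun j => weakPartial j q) j x -
        x 1 * weakPartial 0 u x j := by
  fin_cases j <;>
  simp [fieldForce, weakLaplacian, weakGrad, inertialTerm, convection] <;> ring

end Force

/-! ### The energy inequality for strong solutions -/

section EnergyInequality

variable {ν f T t : ℝ}

/-- The component `u_j`. -/
abbrev comp (u : E3 → E3) (j : Fin 3) : E3 → ℝ := fun x => u x j

/-- The weak derivative `∂_i u_j`. -/
noncomputable abbrev partialComp (u : E3 → E3) (i j : Fin 3) : E3 → ℝ :=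
  fun x => weakPartial i u x j

/-- The weak derivative `∂_i ∂_k u_j`. -/
noncomputable abbrev hessianComp (u : E3 → E3) (i k j : Fin 3) : E3 → ℝ :=
  fun x => weakPartial i (weakPartial k u) x j

/-- The `j`-th component of the right-hand side of the momentum equation, without the term
`y ∂ₓ u_j`. -/
noncomputable def force (ν f : ℝ) (u : E3 → E3) (q : E3 → ℝ) (j : Fin 3) : E3 → ℝ :=
  fieldForce ν f (comp u) (partialComp u) (hessianComp u) (fun j => weakPartial j q) j

theorem l2Sq_nonneg {V : Type*} [NormedAddCommGroup V] (v : E3 → V) :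
    0 ≤ l2Sq v :=
  integral_nonneg fun _ => sq_nonneg _

theorem gradSq_nonneg {V : Type*} [NormedAddCommGroup V] [NormedSpace ℝ V] (v : E3 → V) :
    0 ≤ gradSq v :=
  Finset.sum_nonneg fun _ _ => l2Sq_nonneg _

theorem h1Norm_sq (u : E3 → E3) : h1Norm u ^ 2 = l2Sq u + gradSq u :=
  Real.sq_sqrt (add_nonneg (l2Sq_nonneg u) (gradSq_nonneg u))

theorem l2Sq_add_gradSq_le_one {u : E3 → E3} (h : h1Norm u ≤ 1) : l2Sq u + gradSq u ≤ 1 := by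
  rw [← h1Norm_sq]
  exact pow_le_one₀ (Real.sqrt_nonneg _) h

theorem MemH2.isH1_partialComp {u : E3 → E3} (h : MemH2 u) (j k : Fin 3) :
    IsH1 (partialComp u k j) (fun i => hessianComp u i k j) :=
  (h.2 k).isH1_component j

theorem exists_sizeH2_force_sq_le (ν f : ℝ) : ∃ K : ℝ, ∀ (u : E3 → E3) (q : E3 → ℝ),
    MemH2 u → (∀ i, MemLp (weakPartial i q) 2) → h1Norm u ≤ 1 →
    ∀ j, MemLp (force ν f u q j) 2 ∧
      sizeH2 (comp u j) (force ν f u q j) (fun i => partialComp u i j)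
        (fun i k => hessianComp u i k j) ^ 2 ≤
        K * (1 + l2Sq (weakLaplacian u) + ∑ i, l2Sq (weakPartial i q)) := by
  obtain ⟨K, hK⟩ := exists_sizeH2_sq_le ν f
  refine ⟨K, fun u q hu hq h1 j => ?_⟩
  have h2 := l2Sq_add_gradSq_le_one h1
  have h3 := l2Sq_nonneg u
  have h4 := gradSq_nonneg u
  rw [l2Sq_eq_sum hu.1.1] at h3 h2
  rw [gradSq_eq_sum hu.1] at h4 h2
  have := hK (comp u) (partialComp u) (hessianComp u) (fun j => weakPartial j q)
    (fun j => hu.1.isH1_component j) hu.isH1_partialComp hq (by linarith) (by linarith) j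
  simp only [hu.l2Sq_weakLaplacian, fun i => l2Sq_eq_l2Norm_sq (hq i)]
  exact this

theorem exists_sum_energyRate_force_le (hν : 0 < ν) : ∃ C : ℝ, 0 < C ∧
    ∀ (f : ℝ) (u : E3 → E3) (q : E3 → ℝ), MemH2 u → MemLp q 6 →
      (∀ i, HasWeakPartial i q ∧ MemLp (weakPartial i q) 2) →
      (∀ᵐ x : E3, weakDiv u x = 0) → h1Norm u ≤ 1 →
      ∑ j, energyRate (comp u j) (force ν f u q j) (fun i => partialComp u i j)
        (fun i k => hessianComp u i k j) ≤
        -(ν / 2) * (gradSq u + l2Sq (weakLaplacian u)) + C * l2Sq u := by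
  obtain ⟨C, hC0, hC⟩ := exists_sum_energyRate_le hν
  refine ⟨C, hC0, fun f u q hu hq hp hdiv h1 => ?_⟩
  have h2 := l2Sq_add_gradSq_le_one h1
  have h3 := l2Sq_nonneg u
  rw [gradSq_eq_sum hu.1] at h2
  rw [hu.l2Sq_weakLaplacian, gradSq_eq_sum hu.1, l2Sq_eq_sum hu.1.1]
  have hU := fun j => hu.1.isH1_component j
  exact hC f (comp u) (partialComp u) (hessianComp u) (fun j => weakPartial j q) hU
    hu.isH1_partialComp (fun j => (hp j).2)
    (sum_integral_sub_laplacian_mul_pressure_eq_zero hU hu.isH1_partialComp hdiv hq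
      (fun j => (hp j).2) fun j => (hp j).1.isWeakPartial) (by linarith)

theorem integral_smul_momentum_component {u : E3 → E3} {q : E3 → ℝ} (hu : MemH1 u)
    (hF : ∀ j, MemLp (force ν f u q j) 2) {φ : E3 → ℝ} (hφ : IsTest φ) (j : Fin 3) :
    (∫ x, φ x • (ν • weakLaplacian u x - weakGrad q x - inertialTerm f u x)) j =
      ∫ x, φ x * (force ν f u q j x - x 1 * partialComp u 0 j x) := by
  rw [integral_smul_component hφ fun j => ?_]
  · simp only [momentum_force_component]
    rfl
  · simp only [momentum_force_component]
    exact (locallyIntegrable_of_memLp (hF j)).sub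
      (locallyIntegrable_coord_mul (locallyIntegrable_of_memLp (memLp_component (hu.2 0).2 j)) 1)

namespace IsStrongSolution

variable {u : ℝ → E3 → E3} {q : ℝ → E3 → ℝ}

theorem ae_memLp_force (h : IsStrongSolution ν f T u q)
    (hsmall : ∀ t ∈ Icc 0 T, h1Norm (u t) ≤ 1) :
    ∀ᵐ s ∂(volume.restrict (Icc 0 T)), ∀ j, MemLp (force ν f (u s) (q s) j) 2 := by
  obtain ⟨K, hK⟩ := exists_sizeH2_force_sq_le ν f
  filter_upwards [h.square_integrable_H2.1, h.pressure, ae_restrict_mem measurableSet_Icc]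
    with s h1 h2 h3 j
  exact (hK _ _ h1 (fun i => (h2.2.1 i).2) (hsmall s h3) j).1

theorem momentum_component (h : IsStrongSolution ν f T u q)
    (hsmall : ∀ t ∈ Icc 0 T, h1Norm (u t) ≤ 1) {φ : E3 → ℝ} (hφ : IsTest φ) (ht : t ∈ Icc 0 T)
    (j : Fin 3) :
    IntervalIntegrable (fun s => ∫ x, φ x * (force ν f (u s) (q s) j x -
      x 1 * partialComp (u s) 0 j x)) volume 0 t ∧
    (∫ x, φ x * comp (u t) j x) - ∫ x, φ x * comp (u 0) j x =
      ∫ s in (0 : ℝ)..t, ∫ x, φ x * (force ν f (u s) (q s) j x -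
        x 1 * partialComp (u s) 0 j x) := by
  obtain ⟨hi, he⟩ := h.momentum φ hφ t ht
  let L : E3 →L[ℝ] ℝ := EuclideanSpace.proj j
  have hsub : uIoc 0 t ⊆ Icc 0 T := by
    rw [uIoc_of_le ht.1]
    exact Ioc_subset_Icc_self.trans (Icc_subset_Icc_right ht.2)
  have hae : (fun s => L (∫ x, φ x • (ν • weakLaplacian (u s) x - weakGrad (q s) x -
      inertialTerm f (u s) x))) =ᵐ[volume.restrict (uIoc 0 t)]
      fun s => ∫ x, φ x * (force ν f (u s) (q s) j x - x 1 * partialComp (u s) 0 j x) := by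
    filter_upwards [ae_restrict_of_ae_restrict_of_subset hsub (h.ae_memLp_force hsmall),
      ae_restrict_mem measurableSet_uIoc] with s h1 h2
    exact integral_smul_momentum_component (h.continuous_H1.1 s (hsub h2)) h1 hφ j
  have hLi : IntervalIntegrable (fun s => L (∫ x, φ x • (ν • weakLaplacian (u s) x -
      weakGrad (q s) x - inertialTerm f (u s) x))) volume 0 t :=
    ⟨L.integrable_comp hi.1, L.integrable_comp hi.2⟩
  refine ⟨hLi.congr_ae hae, ?_⟩
  rw [← intervalIntegral.integral_congr_ae_restrict hae, L.intervalIntegral_comp_comm hi, ← he,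
    map_sub]
  have h0 : ∀ s ∈ Icc 0 T, L (∫ x, φ x • u s x) = ∫ x, φ x * comp (u s) j x := fun s hs =>
    integral_smul_component hφ (fun j => locallyIntegrable_of_memLp
      (memLp_component (h.continuous_H1.1 s hs).1 j)) j
  rw [h0 t ht, h0 0 ⟨le_rfl, ht.1.trans ht.2⟩]

theorem ae_sum_hessian_eq (h : IsStrongSolution ν f T u q) :
    (fun s => ∑ i, ∑ k, l2Sq (weakPartial i (weakPartial k (u s))))
      =ᵐ[volume.restrict (Icc 0 T)] fun s => l2Sq (weakLaplacian (u s)) :=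
  h.square_integrable_H2.1.mono fun _ hs => hs.l2Sq_weakLaplacian_eq_sum.symm

theorem integrableOn_weakLaplacian (h : IsStrongSolution ν f T u q) :
    IntegrableOn (fun s => l2Sq (weakLaplacian (u s))) (Icc 0 T) :=
  Integrable.congr (integrable_finsetSum _ fun i _ => integrable_finsetSum _ fun k _ =>
    (h.square_integrable_H2.2.2.2 i k).2.2) h.ae_sum_hessian_eq

theorem integrableOn_gradSq (h : IsStrongSolution ν f T u q) :
    IntegrableOn (fun s => gradSq (u s)) (Icc 0 T) :=
  integrable_finsetSum _ fun i _ => (h.square_integrable_H2.2.2.1 i).2.2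

theorem component_energy_balance (h : IsStrongSolution ν f T u q)
    (hsmall : ∀ t ∈ Icc 0 T, h1Norm (u t) ≤ 1) (ht : t ∈ Icc 0 T) (j : Fin 3) :
    IntegrableOn (fun s => energyRate (comp (u s) j) (force ν f (u s) (q s) j)
      (fun i => partialComp (u s) i j) (fun i k => hessianComp (u s) i k j)) (Icc 0 t) ∧
    (l2Norm (comp (u t) j) ^ 2 + ∑ i, l2Norm (partialComp (u t) i j) ^ 2) -
      (l2Norm (comp (u 0) j) ^ 2 + ∑ i, l2Norm (partialComp (u 0) i j) ^ 2) =
      ∫ s in (0 : ℝ)..t, 2 * energyRate (comp (u s) j) (force ν f (u s) (q s) j)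
        (fun i => partialComp (u s) i j) (fun i k => hessianComp (u s) i k j) := by
  obtain ⟨K, hK⟩ := exists_sizeH2_force_sq_le ν f
  have hsub : Icc 0 t ⊆ Icc 0 T := Icc_subset_Icc_right ht.2
  refine energy_balance (v := fun s => comp (u s) j) (g := fun s i => partialComp (u s) i j)
    (h := fun s i k => hessianComp (u s) i k j) (G := fun s => force ν f (u s) (q s) j)
    -- Integrable in time because `u ∈ L²H²` and `∇q ∈ L²L²`.
    (m := fun s => K * (1 + l2Sq (weakLaplacian (u s)) + ∑ i, l2Sq (weakPartial i (q s))))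
    ht.1 (fun s hs => (h.continuous_H1.1 s (hsub hs)).isH1_component j)
    (ae_restrict_of_ae_restrict_of_subset hsub ?_) (IntegrableOn.mono_set ?_ hsub)
    (fun φ hφ => (h.momentum_component hsmall hφ ht j).1)
    (fun φ hφ s hs => (h.momentum_component hsmall hφ (hsub hs) j).2)
  · filter_upwards [h.square_integrable_H2.1, h.pressure, ae_restrict_mem measurableSet_Icc]
      with s h1 h2 h3
    exact ⟨h1.isH1_partialComp j, hK _ _ h1 (fun i => (h2.2.1 i).2) (hsmall s h3) j⟩
  · exact (((integrableOn_const (by simp)).add h.integrableOn_weakLaplacian).add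
      (integrable_finsetSum _ fun i _ => (h.pressure_grad i).2.2)).const_mul K

/-- The component balances are summed and the rate is bounded at almost every time; twice the
dissipation `ν/2` gives the factor `ν`. The rate bound is a hypothesis so that `C` is fixed before
`f`, `T` and `u`. -/
theorem energy_inequality {C : ℝ} (hC : ∀ (f : ℝ) (u : E3 → E3) (q : E3 → ℝ), MemH2 u →
      MemLp q 6 → (∀ i, HasWeakPartial i q ∧ MemLp (weakPartial i q) 2) →
      (∀ᵐ x : E3, weakDiv u x = 0) → h1Norm u ≤ 1 →
      ∑ j, energyRate (comp u j) (force ν f u q j) (fun i => partialComp u i j)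
        (fun i k => hessianComp u i k j) ≤
        -(ν / 2) * (gradSq u + l2Sq (weakLaplacian u)) + C * l2Sq u)
    (h : IsStrongSolution ν f T u q) (hsmall : ∀ t ∈ Icc 0 T, h1Norm (u t) ≤ 1)
    (ht : t ∈ Icc 0 T) :
    l2Sq (u t) + gradSq (u t) +
        ν * ∫ τ in (0 : ℝ)..t, (gradSq (u τ) + l2Sq (weakLaplacian (u τ))) ≤
      h1Norm (u 0) ^ 2 + 2 * C * ∫ τ in (0 : ℝ)..t, l2Sq (u τ) := by
  have hsub : Icc 0 t ⊆ Icc 0 T := Icc_subset_Icc_right ht.2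
  have h0 : (0 : ℝ) ∈ Icc 0 T := ⟨le_rfl, ht.1.trans ht.2⟩
  have hE : ∀ s ∈ Icc 0 T, l2Sq (u s) + gradSq (u s) =
      ∑ j, (l2Norm (comp (u s) j) ^ 2 + ∑ i, l2Norm (partialComp (u s) i j) ^ 2) := fun s hs => by
    rw [Finset.sum_add_distrib, l2Sq_eq_sum (h.continuous_H1.1 s hs).1,
      gradSq_eq_sum (h.continuous_H1.1 s hs)]
  have ii : ∀ {F : ℝ → ℝ}, IntegrableOn F (Icc 0 t) → IntervalIntegrable F volume 0 t :=
    fun hF => (intervalIntegrable_iff_integrableOn_Icc_of_le ht.1).2 hF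
  have hb := fun j => h.component_energy_balance hsmall ht j
  have i1 : IntervalIntegrable (fun s => gradSq (u s) + l2Sq (weakLaplacian (u s))) volume 0 t :=
    ii ((h.integrableOn_gradSq.add h.integrableOn_weakLaplacian).mono_set hsub)
  have i2 := ii (h.square_integrable_H2.2.1.2.2.mono_set hsub)
  have hbal : (l2Sq (u t) + gradSq (u t)) - (l2Sq (u 0) + gradSq (u 0)) =
      ∫ s in (0 : ℝ)..t, ∑ j, 2 * energyRate (comp (u s) j) (force ν f (u s) (q s) j)
        (fun i => partialComp (u s) i j) (fun i k => hessianComp (u s) i k j) := by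
    rw [intervalIntegral.integral_finsetSum fun j _ => ii ((hb j).1.const_mul 2), hE t ht,
      hE 0 h0, ← Finset.sum_sub_distrib]
    exact Finset.sum_congr rfl fun j _ => (hb j).2
  have hle : ∫ s in (0 : ℝ)..t, ∑ j, 2 * energyRate (comp (u s) j) (force ν f (u s) (q s) j)
        (fun i => partialComp (u s) i j) (fun i k => hessianComp (u s) i k j) ≤
      ∫ s in (0 : ℝ)..t, (-ν * (gradSq (u s) + l2Sq (weakLaplacian (u s))) +
        2 * C * l2Sq (u s)) := by
    refine intervalIntegral.integral_mono_ae_restrict ht.1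
      (ii (integrable_finsetSum _ fun j _ => (hb j).1.const_mul 2))
      ((i1.const_mul _).add (i2.const_mul _)) ?_
    refine ae_restrict_of_ae_restrict_of_subset hsub ?_
    filter_upwards [h.square_integrable_H2.1, h.pressure, ae_restrict_mem measurableSet_Icc]
      with s h1 h2 h3
    have := hC f (u s) (q s) h1 h2.1 h2.2.1 (h.div_free s h3) (hsmall s h3)
    rw [← Finset.mul_sum]
    linarith
  rw [intervalIntegral.integral_add (i1.const_mul _) (i2.const_mul _),
    intervalIntegral.integral_const_mul, intervalIntegral.integral_const_mul] at hle
  rw [h1Norm_sq]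
  linarith

end IsStrongSolution

end EnergyInequality

end RotatingCouette

/-! ### Conclusion: choice of the constants -/

theorem mainTheorem9 :
    ∃ δ₀ : ℝ, 0 < δ₀ ∧ δ₀ ≤ 1 ∧
      ∀ ν : ℝ, 0 < ν → ∃ C : ℝ, 0 < C ∧
        ∀ f : ℝ, 0 < f → ∀ T : ℝ, 0 < T →
          ∀ (u : ℝ → RotatingCouette.E3 → RotatingCouette.E3) (q : ℝ → RotatingCouette.E3 → ℝ),
            RotatingCouette.IsStrongSolution ν f T u q →
            (∀ t ∈ Set.Icc 0 T, RotatingCouette.h1Norm (u t) ≤ δ₀) →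
            ∀ t ∈ Set.Icc 0 T,
              RotatingCouette.l2Sq (u t) + RotatingCouette.gradSq (u t) +
                  ∫ τ in (0 : ℝ)..t, (RotatingCouette.gradSq (u τ) +
                    RotatingCouette.l2Sq (RotatingCouette.weakLaplacian (u τ))) ≤
                C * (RotatingCouette.h1Norm (u 0) ^ 2 +
                  ∫ τ in (0 : ℝ)..t, RotatingCouette.l2Sq (u τ)) := by
  -- The threshold `1` suffices: the absorption uses only `‖∇u‖ ≤ 1`, since the lower-order
  -- remainder `C ‖u‖²` is kept on the right.
  refine ⟨1, one_pos, le_rfl, fun ν hν => ?_⟩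
  obtain ⟨C, hC0, hC⟩ := RotatingCouette.exists_sum_energyRate_force_le hν
  -- The factor `1 + 1/ν` passes from `E + ν X` to `E + X`; `1 + 2C` dominates both coefficients `1`
  -- and `2C` of the energy inequality.
  refine ⟨(1 + 1 / ν) * (1 + 2 * C), by positivity, fun f _ T _ u q h hsmall t ht => ?_⟩
  have key := h.energy_inequality hC hsmall ht
  have hE : 0 ≤ RotatingCouette.l2Sq (u t) + RotatingCouette.gradSq (u t) :=
    add_nonneg (RotatingCouette.l2Sq_nonneg _) (RotatingCouette.gradSq_nonneg _)
  have hX : 0 ≤ ∫ τ in (0 : ℝ)..t, (RotatingCouette.gradSq (u τ) +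
      RotatingCouette.l2Sq (RotatingCouette.weakLaplacian (u τ))) :=
    intervalIntegral.integral_nonneg ht.1 fun _ _ =>
      add_nonneg (RotatingCouette.gradSq_nonneg _) (RotatingCouette.l2Sq_nonneg _)
  have hY : 0 ≤ ∫ τ in (0 : ℝ)..t, RotatingCouette.l2Sq (u τ) :=
    intervalIntegral.integral_nonneg ht.1 fun _ _ => RotatingCouette.l2Sq_nonneg _
  have hE0 : 0 ≤ RotatingCouette.h1Norm (u 0) ^ 2 := sq_nonneg _
  generalize RotatingCouette.l2Sq (u t) + RotatingCouette.gradSq (u t) = E at *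
  generalize (∫ τ in (0 : ℝ)..t, (RotatingCouette.gradSq (u τ) +
      RotatingCouette.l2Sq (RotatingCouette.weakLaplacian (u τ)))) = X at *
  generalize (∫ τ in (0 : ℝ)..t, RotatingCouette.l2Sq (u τ)) = Y at *
  generalize RotatingCouette.h1Norm (u 0) ^ 2 = E₀ at *
  calc E + X ≤ (1 + 1 / ν) * (E + ν * X) := by
        have h1 : (1 + 1 / ν) * (E + ν * X) = E + X + (1 / ν * E + ν * X) := by
          field_simp
          ring
        have h2 : 0 ≤ 1 / ν * E + ν * X := by positivity
        linarith
    _ ≤ (1 + 1 / ν) * ((1 + 2 * C) * (E₀ + Y)) := by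
        refine mul_le_mul_of_nonneg_left (key.trans ?_) (by positivity)
        linarith [mul_nonneg hC0.le hE0]
    _ = (1 + 1 / ν) * (1 + 2 * C) * (E₀ + Y) := (mul_assoc _ _ _).symm
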